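/- Let $4<p<\infty$ and let $q$ be defined by $\frac2p+\frac1q=\frac12$. For $u\in L^2(\mathbb R)$ (complex valued) let $\hat u(\xi)=\frac1{\sqrt{2\pi}}\int_{\mathbb R}u(x)e^{-ix\xi}\,dx$ be its Fourier transform, and put $$\Psi_p[u](t,x)=\big(|D_x|^{1/p}e^{-t\partial_x^3}u\big)(x)=\frac1{\sqrt{2\pi}}\int_{\mathbb R}|\xi|^{1/p}e^{it\xi^3+ix\xi}\,\hat u(\xi)\,d\xi,\qquad (e^{-3it\partial_x^2}u)(x)=\frac1{\sqrt{2\pi}}\int_{\mathbb R}e^{3it\xi^2+ix\xi}\,\hat u(\xi)\,d\xi,$$ the integrals being understood as inverse Fourier transforms of tempered distributions in $x$, for almost every $t$. Let $$a_p=\frac{2^{p/2}}{\pi^{p/(2q)}}\left(\frac{\Gamma\left(\frac{q+1}2\right)}{\Gamma\left(\frac{q+2}2\right)}\right)^{p/q}.$$ Let $\chi\in L^2(\mathbb R)$, $\chi\neq0$, and for $\epsilon>0$ define $\chi_\epsilon\in L^2(\mathbb R)$ by $$\widehat{\chi_\epsilon}(\xi)=\hat\chi\left(\frac{\xi-1}\epsilon\right)+\overline{\hat\chi\left(-\frac{\xi+1}\epsilon\right)}\qquad\text{for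 a.e. }\xi\in\mathbb R.$$ Then $\Psi_p[\chi_\epsilon]$ (for every $\epsilon>0$) and $e^{-3it\partial_x^2}\chi$ are given by measurable functions of $(t,x)$ for which the integrals below are finite, $\chi_\epsilon\ne0$ for all sufficiently small $\epsilon>0$, and $$\frac{\displaystyle\int_{\mathbb R}\left(\int_{\mathbb R}|\Psi_p[\chi_\epsilon](t,x)|^q\,dx\right)^{p/q}dt}{\|\chi_\epsilon\|_{L^2}^p}\;\xrightarrow[\epsilon\to0^+]{}\;a_p\,\frac{\displaystyle\int_{\mathbb R}\left(\int_{\mathbb R}|(e^{-3it\partial_x^2}\chi)(x)|^q\,dx\right)^{p/q}dt}{\|\chi\|_{L^2}^p}.$$ -/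

import Mathlib

open MeasureTheory Filter Topology FourierTransform
open scoped ENNReal SchwartzMap ComplexConjugate

noncomputable section

namespace AiryStrichartz

/-- The complex Hilbert space `L²(ℝ)`. -/
abbrev L2 : Type := Lp ℂ 2 (volume : Measure ℝ)

/-- The unitary Fourier transform of `u ∈ L²(ℝ)` in the normalization
`û(ξ) = (2π)^{-1/2} ∫ u(x) e^{-ixξ} dx` (extended to `L²` by Plancherel), obtained from Mathlib's
`L²` Fourier transform, whose kernel is `e^{-2πixξ}`. It is a function of `ξ` up to null sets. -/
def hat (u : L2) (ξ : ℝ) : ℂ :=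
  ((Real.sqrt (2 * Real.pi) : ℝ) : ℂ)⁻¹ * ((𝓕 u : L2) : ℝ → ℂ) (ξ / (2 * Real.pi))

/-- The inverse Fourier transform `(2π)^{-1/2} ∫ φ(x) e^{ixξ} dx` of a Schwartz function. -/
def invHat (φ : 𝓢(ℝ, ℂ)) (ξ : ℝ) : ℂ :=
  ((Real.sqrt (2 * Real.pi) : ℝ) : ℂ)⁻¹ * ∫ x : ℝ, Complex.exp (Complex.I * x * ξ) * φ x

/-- For a symbol `σ(t, ξ)` and `u ∈ L²(ℝ)`, the measurable function `F(t, x)` is (a version of)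
`(2π)^{-1/2} ∫ σ(t, ξ) e^{ixξ} û(ξ) dξ`. Since this integral need not converge absolutely, it is
understood as an inverse Fourier transform of tempered distributions: for almost every `t`,
the function `F t` represents the inverse Fourier transform of `σ(t, ·) û`. -/
def IsFourierFlow (σ : ℝ → ℝ → ℂ) (u : L2) (F : ℝ → ℝ → ℂ) : Prop :=
  Measurable (Function.uncurry F) ∧
    ∀ᵐ t : ℝ, ∀ φ : 𝓢(ℝ, ℂ),
      Integrable (fun x : ℝ => F t x * φ x) ∧
        ∫ x : ℝ, F t x * φ x = ∫ ξ : ℝ, σ t ξ * hat u ξ * invHat φ ξ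

/-- `Ψ` is (a version of) `Ψ_p[u](t, x) = (|D_x|^{1/p} e^{-t∂_x³} u)(x)`, the Fourier multiplier
with symbol `|ξ|^{1/p} e^{itξ³}` applied to `u`. -/
def IsAiryFlow (p : ℝ) (u : L2) (Ψ : ℝ → ℝ → ℂ) : Prop :=
  IsFourierFlow (fun t ξ => ((|ξ| ^ (1 / p) : ℝ) : ℂ) * Complex.exp (Complex.I * t * ξ ^ 3)) u Ψ

/-- `v` is (a version of) `v(t, x) = (e^{-3it∂_x²} u)(x)`, the Fourier multiplier
with symbol `e^{3itξ²}` applied to `u`. -/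
def IsSchrodingerFlow (u : L2) (v : ℝ → ℝ → ℂ) : Prop :=
  IsFourierFlow (fun t ξ => Complex.exp (3 * Complex.I * t * ξ ^ 2)) u v

/-- `∫ (∫ |F(t, x)|^q dx)^{p/q} dt`, the `p`-th power of the norm of `L^p_t L^q_x`. -/
def mixedEnergy (p q : ℝ) (F : ℝ → ℝ → ℂ) : ℝ≥0∞ :=
  ∫⁻ t : ℝ, (∫⁻ x : ℝ, ‖F t x‖ₑ ^ q) ^ (p / q)

/-- The constant `a_p = 2^{p/2} π^{-p/(2q)} (Γ((q+1)/2) / Γ((q+2)/2))^{p/q}`. -/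
def aConst (p q : ℝ) : ℝ :=
  2 ^ (p / 2) / Real.pi ^ (p / (2 * q)) *
    (Real.Gamma ((q + 1) / 2) / Real.Gamma ((q + 2) / 2)) ^ (p / q)

/-- `w = χ_ε`: its Fourier transform is `χ̂((ξ - 1)/ε) + conj (χ̂(-(ξ + 1)/ε))`. -/
def IsTwoBubble (χ : L2) (ε : ℝ) (w : L2) : Prop :=
  ∀ᵐ ξ : ℝ, hat w ξ = hat χ ((ξ - 1) / ε) + conj (hat χ (-((ξ + 1) / ε)))

lemma quasiMeasurePreserving_affine {a : ℝ} (ha : a ≠ 0) (b : ℝ) :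
    Measure.QuasiMeasurePreserving (fun x : ℝ => a * x + b) volume volume := by
  refine ⟨by fun_prop, ?_⟩
  have h : Measure.map (fun x : ℝ => a * x + b) volume
      = ENNReal.ofReal |a⁻¹| • (volume : Measure ℝ) := by
    rw [show (fun x : ℝ => a * x + b) = (fun x => x + b) ∘ (fun x => a * x) from rfl,
      ← Measure.map_map (by fun_prop) (by fun_prop), Real.map_volume_mul_left ha,
      Measure.map_smul, map_add_right_eq_self]
  rw [h]
  exact Measure.smul_absolutelyContinuous

lemma memLp_affine {f : ℝ → ℂ} (hf : MemLp f 2) {a : ℝ} (ha : a ≠ 0) (b : ℝ) :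
    MemLp (fun x : ℝ => f (a * x + b)) 2 := by
  have h : Measure.map (fun x : ℝ => a * x + b) volume
      = ENNReal.ofReal |a⁻¹| • (volume : Measure ℝ) := by
    rw [show (fun x : ℝ => a * x + b) = (fun x => x + b) ∘ (fun x => a * x) from rfl,
      ← Measure.map_map (by fun_prop) (by fun_prop), Real.map_volume_mul_left ha,
      Measure.map_smul, map_add_right_eq_self]
  have h2 : MemLp f 2 (Measure.map (fun x : ℝ => a * x + b) volume) := by
    rw [h]; exact hf.smul_measure ENNReal.ofReal_ne_top
  exact h2.comp_of_map (by fun_prop)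

/-- The function `χ_ε` exists for every `ε > 0`. -/
theorem exists_isTwoBubble (χ : L2) {ε : ℝ} (hε : 0 < ε) : ∃ w : L2, IsTwoBubble χ ε w := by
  have hπ : (2 * Real.pi) ≠ 0 := by positivity
  have hs : ((Real.sqrt (2 * Real.pi) : ℝ) : ℂ) ≠ 0 := by
    have : Real.sqrt (2 * Real.pi) ≠ 0 := by positivity
    exact_mod_cast this
  have hG : MemLp (hat χ) 2 := by
    have := (memLp_affine (Lp.memLp (𝓕 χ : L2)) (inv_ne_zero hπ) 0).const_mul
      ((Real.sqrt (2 * Real.pi) : ℝ) : ℂ)⁻¹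
    refine this.ae_eq (Eventually.of_forall fun ξ => ?_)
    simp only [hat, add_zero]
    rw [div_eq_inv_mul]
  set g : ℝ → ℂ := fun ξ => hat χ ((ξ - 1) / ε) + conj (hat χ (-((ξ + 1) / ε))) with hg
  have hgm : MemLp g 2 := by
    have h1 := memLp_affine hG (inv_ne_zero hε.ne') (-(1 / ε))
    have h2 := (memLp_affine hG (neg_ne_zero.2 (inv_ne_zero hε.ne')) (-(1 / ε))).star
    refine (h1.add h2).ae_eq (Eventually.of_forall fun ξ => ?_)
    simp only [hg, Pi.add_apply, Pi.star_apply]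
    rw [starRingEnd_apply]
    congr 3
    · field_simp
      ring
    · field_simp
      ring
  have hh : MemLp (fun η : ℝ =>
      ((Real.sqrt (2 * Real.pi) : ℝ) : ℂ) * g (2 * Real.pi * η + 0)) 2 :=
    (memLp_affine hgm hπ 0).const_mul _
  refine ⟨𝓕⁻ (hh.toLp _ : L2), ?_⟩
  have hq := (quasiMeasurePreserving_affine (inv_ne_zero hπ) 0).ae hh.coeFn_toLp
  filter_upwards [hq] with ξ hξ
  rw [hat, fourier_fourierInv_eq, div_eq_inv_mul,
    show (2 * Real.pi)⁻¹ * ξ = (2 * Real.pi)⁻¹ * ξ + 0 by ring, hξ, inv_mul_cancel_left₀ hs]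
  rw [show 2 * Real.pi * ((2 * Real.pi)⁻¹ * ξ + 0) + 0 = ξ by field_simp; ring]

end AiryStrichartz

end

open MeasureTheory Filter Topology FourierTransform
open scoped ENNReal SchwartzMap ComplexConjugate

noncomputable section

namespace AiryStrichartz

/-! Put ξ = 1 + εη. Then tξ³ + xξ = (x + t) + η(εx + 3εt) + ε²t(3η² + εη³), so the Airy flow of the
bubble at frequency 1 is ε e^{i(x+t)} times a profile evaluated at T = ε²t, X = εx + 3εt
(`invFT_airySymbol_bubble`). The profile has symbol |1 + εη|^{1/p} e^{iT(3η² + εη³)}, which tends to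
the Schrödinger symbol e^{3iTη²}. The bubble at −1 contributes the complex conjugate, so the full
flow is twice the real part of the profile modulated by the carrier e^{i(X/ε − 2T/ε²)}.
Admissibility makes the change of variables cost exactly ε^{p/2}, and this cancels against the norm
of the datum, which is asymptotically (2ε)^{1/2}‖χ‖.

At fixed T the phase of the carrier equidistributes as ε → 0 (Riemann–Lebesgue for trigonometric
polynomials, then Weierstrass approximation). Hence the q-th power integral of the real part tends
to the mean of |cos|^q times that of the Schrödinger flow (`tendsto_lintegral_re`). That mean is a
quotient of Gamma functions; together with 2^p from twice the real part and 2^{p/2} from the two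
nearly orthogonal bubbles in the denominator it produces the constant (`aConst_eq`). The T integral
passes to the limit by dominated convergence: a dispersive bound |T|^{-1/2}, uniform in ε,
interpolated with Plancherel, gives a majorant of order |T|^{-2}, because (q − 2)p/q = 4.

This settles profiles that are C¹ and compactly supported in frequency. General data follow by
density, since Strichartz estimates make both rescaled norms Lipschitz in the datum uniformly in ε.
The Airy estimate is proved from the kernel bound |t|^{-1/2} for the symbol |ξ|^{1/2}e^{itξ³}: with
Hardy–Littlewood–Sobolev and TT* along an arbitrary measurable curve x = X(t) it gives the L^4_t
L^∞_x endpoint with 1/4 derivative, and at each fixed time a Gagliardo–Nirenberg inequality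
interpolates this with the conserved L² norm. Applied to a single bubble, with Fatou as ε → 0, the
Airy estimate yields the Schrödinger one. The same density argument constructs the flows of
arbitrary L² data and shows their energies are finite. -/

/-! ### The inverse Fourier integral: pairings, uniqueness, Plancherel -/

/-- The inverse Fourier integral `(2π)^{-1/2} ∫ k(ξ) e^{iξx} dξ`. -/
def invFT (k : ℝ → ℂ) (x : ℝ) : ℂ :=
  ((Real.sqrt (2 * Real.pi) : ℝ) : ℂ)⁻¹ * ∫ ξ : ℝ, Complex.exp (Complex.I * ξ * x) * k ξ

lemma invHat_eq_invFT (φ : 𝓢(ℝ, ℂ)) : invHat φ = invFT φ := rfl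

lemma norm_exp_I_mul_mul (a b : ℝ) : ‖Complex.exp (Complex.I * a * b)‖ = 1 := by
  rw [show Complex.I * a * b = ((a * b : ℝ) : ℂ) * Complex.I by push_cast; ring,
    Complex.norm_exp_ofReal_mul_I]

lemma norm_inv_sqrt_two_pi_le : ‖((Real.sqrt (2 * Real.pi) : ℝ) : ℂ)⁻¹‖ ≤ 1 := by
  rw [norm_inv, Complex.norm_real, Real.norm_of_nonneg (Real.sqrt_nonneg _)]
  apply inv_le_one_of_one_le₀
  rw [Real.one_le_sqrt]
  linarith [Real.pi_gt_three]

lemma integrable_exp_mul {k : ℝ → ℂ} (hk : Integrable k) (x : ℝ) :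
    Integrable (fun ξ : ℝ => Complex.exp (Complex.I * ξ * x) * k ξ) := by
  refine hk.bdd_mul (c := 1) (by fun_prop) (Eventually.of_forall fun ξ => ?_)
  rw [norm_exp_I_mul_mul]

lemma norm_invFT_le (k : ℝ → ℂ) (x : ℝ) : ‖invFT k x‖ ≤ ∫ ξ, ‖k ξ‖ := by
  rw [invFT, norm_mul]
  calc _ ≤ 1 * ‖∫ ξ : ℝ, Complex.exp (Complex.I * ξ * x) * k ξ‖ := by
        gcongr; exact norm_inv_sqrt_two_pi_le
    _ ≤ ∫ ξ : ℝ, ‖Complex.exp (Complex.I * ξ * x) * k ξ‖ := by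
        rw [one_mul]; exact norm_integral_le_integral_norm _
    _ = _ := by simp only [norm_mul, norm_exp_I_mul_mul, one_mul]

lemma continuous_invFT {k : ℝ → ℂ} (hk : Integrable k) : Continuous (invFT k) := by
  unfold invFT
  refine continuous_const.mul ?_
  refine continuous_of_dominated (bound := fun ξ => ‖k ξ‖)
    (fun x => (integrable_exp_mul hk x).aestronglyMeasurable) ?_ hk.norm ?_
  · intro x
    exact Eventually.of_forall fun ξ => by rw [norm_mul, norm_exp_I_mul_mul, one_mul]
  · exact Eventually.of_forall fun ξ => by fun_prop

lemma invFT_sub {k l : ℝ → ℂ} (hk : Integrable k) (hl : Integrable l) (x : ℝ) :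
    invFT (fun ξ => k ξ - l ξ) x = invFT k x - invFT l x := by
  simp only [invFT, mul_sub]
  rw [integral_sub (integrable_exp_mul hk x) (integrable_exp_mul hl x), mul_sub]

lemma invFT_add {k l : ℝ → ℂ} (hk : Integrable k) (hl : Integrable l) (x : ℝ) :
    invFT (fun ξ => k ξ + l ξ) x = invFT k x + invFT l x := by
  simp only [invFT, mul_add]
  rw [integral_add (integrable_exp_mul hk x) (integrable_exp_mul hl x), mul_add]

lemma integral_invFT_mul {k φ : ℝ → ℂ} (hk : Integrable k) (hφ : Integrable φ) :
    ∫ x, invFT k x * φ x = ∫ ξ, k ξ * invFT φ ξ := by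
  have h2 : Integrable (fun z : ℝ × ℝ =>
      Complex.exp (Complex.I * z.2 * z.1) * (φ z.1 * k z.2)) (volume.prod volume) := by
    refine (hφ.mul_prod hk).bdd_mul (c := 1) (by fun_prop) (Eventually.of_forall fun z => ?_)
    rw [norm_exp_I_mul_mul]
  have e1 : ∀ x, invFT k x * φ x = ((Real.sqrt (2 * Real.pi) : ℝ) : ℂ)⁻¹ *
      ∫ ξ : ℝ, Complex.exp (Complex.I * ξ * x) * (φ x * k ξ) := by
    intro x
    rw [invFT, mul_assoc, ← integral_mul_const]
    congr 2; ext ξ; ring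
  have e2 : ∀ ξ, k ξ * invFT φ ξ = ((Real.sqrt (2 * Real.pi) : ℝ) : ℂ)⁻¹ *
      ∫ x : ℝ, Complex.exp (Complex.I * ξ * x) * (φ x * k ξ) := by
    intro ξ
    rw [invFT, mul_left_comm, ← integral_const_mul]
    congr 2; ext x
    rw [show Complex.I * (x : ℂ) * ξ = Complex.I * ξ * x by ring]; ring
  simp_rw [e1, e2, integral_const_mul]
  congr 1
  exact integral_integral_swap h2

lemma lintegral_comp_affine (g : ℝ → ℝ≥0∞) {a : ℝ} (ha : a ≠ 0) (b : ℝ) :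
    ∫⁻ x, g (a * x + b) = ENNReal.ofReal |a⁻¹| * ∫⁻ x, g x := by
  have h : Measure.map (fun x : ℝ => a * x + b) volume
      = ENNReal.ofReal |a⁻¹| • (volume : Measure ℝ) := by
    rw [show (fun x : ℝ => a * x + b) = (fun x => x + b) ∘ (fun x => a * x) from rfl,
      ← Measure.map_map (by fun_prop) (by fun_prop), Real.map_volume_mul_left ha,
      Measure.map_smul, map_add_right_eq_self]
  have he : MeasurableEmbedding (fun x : ℝ => a * x + b) :=
    ((Homeomorph.mulLeft₀ a ha).trans (Homeomorph.addRight b)).measurableEmbedding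
  rw [← he.lintegral_map, h, lintegral_smul_measure, smul_eq_mul]

lemma lintegral_comp_div (g : ℝ → ℝ≥0∞) {a : ℝ} (ha : 0 < a) :
    ∫⁻ x, g (x / a) = ENNReal.ofReal a * ∫⁻ x, g x := by
  have := lintegral_comp_affine g (inv_ne_zero ha.ne') 0
  rw [inv_inv, abs_of_pos ha] at this
  rw [← this]
  simp only [add_zero, div_eq_inv_mul]

lemma eLpNorm_two_sq (f : ℝ → ℂ) : eLpNorm f 2 ^ 2 = ∫⁻ x, ‖f x‖ₑ ^ 2 := by
  rw [eLpNorm_eq_lintegral_rpow_enorm_toReal (by norm_num) (by norm_num), ← ENNReal.rpow_natCast,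
    ← ENNReal.rpow_mul]
  simp

/-- Testing with a bump equal to 1 near a point shows that both functions are locally integrable, so
smooth compactly supported tests determine them. This gives uniqueness of flows and identifies `L²`
transforms with integrals. -/
lemma ae_eq_of_forall_integral_mul_schwartz {F G : ℝ → ℂ}
    (hF : ∀ φ : 𝓢(ℝ, ℂ), Integrable (fun x => F x * φ x))
    (hG : ∀ φ : 𝓢(ℝ, ℂ), Integrable (fun x => G x * φ x))
    (h : ∀ φ : 𝓢(ℝ, ℂ), ∫ x, F x * φ x = ∫ x, G x * φ x) : F =ᵐ[volume] G := by
  have hloc : ∀ {F : ℝ → ℂ}, (∀ φ : 𝓢(ℝ, ℂ), Integrable (fun x => F x * φ x)) →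
      LocallyIntegrable F := by
    intro F hF x
    let b : ContDiffBump x := ⟨1, 2, by norm_num, by norm_num⟩
    have hg₁ : HasCompactSupport (Complex.ofRealCLM ∘ b) := b.hasCompactSupport.comp_left rfl
    have hg₂ : ContDiff ℝ (⊤ : ℕ∞) (Complex.ofRealCLM ∘ b) :=
      Complex.ofRealCLM.contDiff.comp b.contDiff
    refine ⟨Metric.closedBall x 1, Metric.closedBall_mem_nhds x one_pos, ?_⟩
    refine ((hF (hg₁.toSchwartzMap hg₂)).integrableOn (s := Metric.closedBall x 1)).congr_fun ?_
      Metric.isClosed_closedBall.measurableSet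
    intro y hy
    have : b y = 1 := b.one_of_mem_closedBall hy
    simp [this]
  have key := ae_eq_zero_of_integral_contDiff_smul_eq_zero ((hloc hF).sub (hloc hG)) ?_
  · filter_upwards [key] with x hx
    exact sub_eq_zero.1 hx
  · intro g hg hc
    have hg₁ : HasCompactSupport (Complex.ofRealCLM ∘ g) := hc.comp_left rfl
    have hg₂ : ContDiff ℝ (⊤ : ℕ∞) (Complex.ofRealCLM ∘ g) :=
      Complex.ofRealCLM.contDiff.comp hg
    set φ := hg₁.toSchwartzMap hg₂
    have := h φ
    rw [← sub_eq_zero, ← integral_sub (hF φ) (hG φ)] at this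
    rw [← this]
    congr 1; ext x
    simp [φ, mul_sub, mul_comm]

lemma invFT_eq_fourierInv (k : ℝ → ℂ) (x : ℝ) :
    invFT k x = ((Real.sqrt (2 * Real.pi) : ℝ) : ℂ)⁻¹ * 𝓕⁻ k (x / (2 * Real.pi)) := by
  rw [invFT, Real.fourierInv_eq']
  congr 2; ext ξ
  rw [smul_eq_mul]
  congr 2
  simp only [RCLike.inner_apply, conj_trivial]
  push_cast
  have : (Real.pi : ℂ) ≠ 0 := by exact_mod_cast Real.pi_ne_zero
  field_simp

lemma integrable_mul_schwartz {f : ℝ → ℂ} (hf : MemLp f 2) (φ : 𝓢(ℝ, ℂ)) :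
    Integrable (fun x => f x * φ x) :=
  hf.integrable_mul (φ.memLp 2)

/-- Both sides have the same pairings with Schwartz functions: the `L²` transform through tempered
distributions, the integral through Fubini. -/
lemma fourierInv_toLp_ae_eq {k : ℝ → ℂ} (hk : Integrable k) (hk2 : MemLp k 2) :
    ((𝓕⁻ (hk2.toLp k) : L2) : ℝ → ℂ) =ᵐ[volume] 𝓕⁻ k := by
  have hc : Continuous (𝓕⁻ k) := by
    have h1 : 𝓕⁻ k = fun x => ((Real.sqrt (2 * Real.pi) : ℝ) : ℂ) * invFT k (2 * Real.pi * x) := by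
      ext x
      have hs : ((Real.sqrt (2 * Real.pi) : ℝ) : ℂ) ≠ 0 := by
        have : Real.sqrt (2 * Real.pi) ≠ 0 := by positivity
        exact_mod_cast this
      rw [invFT_eq_fourierInv, mul_inv_cancel_left₀ hs]
      field_simp
    rw [h1]
    exact continuous_const.mul ((continuous_invFT hk).comp (by fun_prop))
  have hb : ∀ x, ‖𝓕⁻ k x‖ ≤ ∫ ξ, ‖k ξ‖ := fun x =>
    VectorFourier.norm_fourierIntegral_le_integral_norm _ _ _ _ _
  refine ae_eq_of_forall_integral_mul_schwartz (fun φ => integrable_mul_schwartz (Lp.memLp _) φ)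
    (fun φ => ?_) fun φ => ?_
  · exact φ.integrable.bdd_mul hc.aestronglyMeasurable (Eventually.of_forall hb)
  · have h1 := congrArg (fun T : 𝓢'(ℝ, ℂ) => T φ)
      (Lp.fourierInv_toTemperedDistribution_eq (hk2.toLp k))
    simp only [TemperedDistribution.fourierInv_apply, Lp.toTemperedDistribution_apply] at h1
    have h2 : ∫ x, (𝓕⁻ φ) x • (hk2.toLp k : ℝ → ℂ) x = ∫ x, (𝓕⁻ φ) x • k x := by
      refine integral_congr_ae ?_
      filter_upwards [hk2.coeFn_toLp] with x hx
      rw [hx]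
    rw [h2] at h1
    have h3 : ∫ x, 𝓕⁻ k x • φ x = ∫ x, k x • 𝓕⁻ (φ : ℝ → ℂ) x := by
      have := VectorFourier.integral_fourierIntegral_smul_eq_flip (e := Real.fourierChar)
        (L := -(innerₗ ℝ)) (μ := volume) (ν := volume) Real.continuous_fourierChar
        (by simp; fun_prop) hk φ.integrable
      have hfl : (-(innerₗ ℝ) : ℝ →ₗ[ℝ] ℝ →ₗ[ℝ] ℝ).flip = -(innerₗ ℝ) := by
        ext; simp
      rw [hfl] at this
      exact this
    simp only [smul_eq_mul] at h1 h3
    rw [h3, ← SchwartzMap.fourierInv_coe]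
    simp only [mul_comm] at h1 ⊢
    exact h1.symm

/-- Plancherel's identity for the inverse Fourier integral. -/
lemma lintegral_invFT_sq {k : ℝ → ℂ} (hk : Integrable k) (hk2 : MemLp k 2) :
    ∫⁻ x, ‖invFT k x‖ₑ ^ 2 = ∫⁻ ξ, ‖k ξ‖ₑ ^ 2 := by
  have hπ : 0 < 2 * Real.pi := by positivity
  have e1 : ∫⁻ x, ‖𝓕⁻ k x‖ₑ ^ 2 = ∫⁻ ξ, ‖k ξ‖ₑ ^ 2 := by
    rw [← eLpNorm_two_sq, ← eLpNorm_two_sq, ← eLpNorm_congr_ae (fourierInv_toLp_ae_eq hk hk2),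
      ← Lp.enorm_def]
    have : ‖(𝓕⁻ (hk2.toLp k) : L2)‖ₑ = ‖hk2.toLp k‖ₑ := by
      have := Lp.norm_fourier_eq (𝓕⁻ (hk2.toLp k) : L2)
      rw [fourier_fourierInv_eq] at this
      rw [← ofReal_norm, ← ofReal_norm, this]
    rw [this, Lp.enorm_toLp]
  have e2 : ∀ x, ‖invFT k x‖ₑ ^ 2 =
      ENNReal.ofReal (2 * Real.pi)⁻¹ * ‖𝓕⁻ k (x / (2 * Real.pi))‖ₑ ^ 2 := by
    intro x
    rw [invFT_eq_fourierInv, enorm_mul, mul_pow]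
    congr 1
    rw [← ofReal_norm, ← ENNReal.ofReal_pow (norm_nonneg _), norm_inv, Complex.norm_real,
      Real.norm_of_nonneg (Real.sqrt_nonneg _), inv_pow, Real.sq_sqrt hπ.le]
  simp_rw [e2]
  rw [lintegral_const_mul' _ _ ENNReal.ofReal_ne_top,
    lintegral_comp_div (fun y => ‖𝓕⁻ k y‖ₑ ^ 2) hπ, ← mul_assoc,
    ← ENNReal.ofReal_mul (by positivity), inv_mul_cancel₀ hπ.ne', ENNReal.ofReal_one, one_mul, e1]

lemma memLp_hat (u : L2) : MemLp (hat u) 2 := by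
  have hπ : (2 * Real.pi) ≠ 0 := by positivity
  have := (memLp_affine (Lp.memLp (𝓕 u : L2)) (inv_ne_zero hπ) 0).const_mul
    ((Real.sqrt (2 * Real.pi) : ℝ) : ℂ)⁻¹
  refine this.ae_eq (Eventually.of_forall fun ξ => ?_)
  simp only [hat, add_zero]
  rw [div_eq_inv_mul]

lemma lintegral_hat_sq (u : L2) : ∫⁻ ξ, ‖hat u ξ‖ₑ ^ 2 = ‖u‖ₑ ^ 2 := by
  have hπ : 0 < 2 * Real.pi := by positivity
  have e2 : ∀ x, ‖hat u x‖ₑ ^ 2 =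
      ENNReal.ofReal (2 * Real.pi)⁻¹ * ‖((𝓕 u : L2) : ℝ → ℂ) (x / (2 * Real.pi))‖ₑ ^ 2 := by
    intro x
    rw [hat, enorm_mul, mul_pow]
    congr 1
    rw [← ofReal_norm, ← ENNReal.ofReal_pow (norm_nonneg _), norm_inv, Complex.norm_real,
      Real.norm_of_nonneg (Real.sqrt_nonneg _), inv_pow, Real.sq_sqrt hπ.le]
  simp_rw [e2]
  rw [lintegral_const_mul' _ _ ENNReal.ofReal_ne_top,
    lintegral_comp_div (fun y => ‖((𝓕 u : L2) : ℝ → ℂ) y‖ₑ ^ 2) hπ, ← mul_assoc,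
    ← ENNReal.ofReal_mul (by positivity), inv_mul_cancel₀ hπ.ne', ENNReal.ofReal_one, one_mul,
    ← eLpNorm_two_sq, ← Lp.enorm_def, ← ofReal_norm, ← ofReal_norm, Lp.norm_fourier_eq]

lemma eLpNorm_hat (u : L2) : eLpNorm (hat u) 2 = ‖u‖ₑ := by
  have := lintegral_hat_sq u
  rw [← eLpNorm_two_sq] at this
  exact (ENNReal.pow_right_strictMono two_ne_zero).injective this

/-! ### Dispersive estimate for the truncated Airy kernel -/

/-- The elementary van der Corput estimate: integration by parts against an oscillating
exponential. -/
lemma norm_integral_mul_deriv_exp_le {a b : ℝ} (hab : a ≤ b) {φ φ' h h' : ℝ → ℝ}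
    (hφ : ∀ x ∈ Set.Icc a b, HasDerivAt φ (φ' x) x)
    (hh : ∀ x ∈ Set.Icc a b, HasDerivAt h (h' x) x)
    (cφ : ContinuousOn φ' (Set.Icc a b)) (ch : ContinuousOn h' (Set.Icc a b)) :
    ‖∫ x in a..b, ((h x * φ' x : ℝ) : ℂ) * Complex.exp (Complex.I * (φ x : ℝ))‖
      ≤ |h a| + |h b| + ∫ x in a..b, |h' x| := by
  rw [← Set.uIcc_of_le hab] at *
  have hφc : ContinuousOn φ (Set.uIcc a b) := fun x hx => (hφ x hx).continuousAt.continuousWithinAt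
  have hv : ∀ x ∈ Set.uIcc a b, HasDerivAt
      (fun x => -Complex.I * Complex.exp (Complex.I * (φ x : ℝ)))
      ((φ' x : ℂ) * Complex.exp (Complex.I * (φ x : ℝ))) x := by
    intro x hx
    have h1 := (((hφ x hx).ofReal_comp.const_mul Complex.I).cexp).const_mul (-Complex.I)
    refine h1.congr_deriv ?_
    linear_combination (-(φ' x : ℂ) * Complex.exp (Complex.I * (φ x : ℝ))) * Complex.I_sq
  have hu : ∀ x ∈ Set.uIcc a b, HasDerivAt (fun x => (h x : ℂ)) (h' x : ℂ) x :=
    fun x hx => (hh x hx).ofReal_comp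
  have ec : ContinuousOn (fun x : ℝ => Complex.exp (Complex.I * (φ x : ℝ))) (Set.uIcc a b) := by
    fun_prop
  have key := intervalIntegral.integral_mul_deriv_eq_deriv_mul
    hu hv
    (ContinuousOn.intervalIntegrable (by fun_prop))
    (ContinuousOn.intervalIntegrable (by fun_prop))
  have e1 : ∫ x in a..b, ((h x * φ' x : ℝ) : ℂ) * Complex.exp (Complex.I * (φ x : ℝ)) =
      ∫ x in a..b, (h x : ℂ) * ((φ' x : ℂ) * Complex.exp (Complex.I * (φ x : ℝ))) := by
    congr 1; ext x; push_cast; ring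
  have n1 : ∀ y : ℝ, ‖-Complex.I * Complex.exp (Complex.I * (y : ℝ))‖ = 1 := by
    intro y
    rw [norm_mul, mul_comm Complex.I, Complex.norm_exp_ofReal_mul_I]; simp
  have e2 : ‖∫ x in a..b, (h' x : ℂ) * (-Complex.I * Complex.exp (Complex.I * (φ x : ℝ)))‖
      ≤ ∫ x in a..b, |h' x| := by
    refine (intervalIntegral.norm_integral_le_integral_norm hab).trans (le_of_eq ?_)
    congr 1; ext x
    rw [norm_mul, n1, mul_one, Complex.norm_real, Real.norm_eq_abs]
  rw [e1, key]
  refine (norm_sub_le _ _).trans (add_le_add ((norm_sub_le _ _).trans ?_) e2)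
  rw [norm_mul (h b : ℂ), norm_mul (h a : ℂ), n1, n1, mul_one, mul_one, Complex.norm_real, Complex.norm_real,
    Real.norm_eq_abs, Real.norm_eq_abs, add_comm]

/-- A monotone function has total variation equal to the difference of its end values. -/
lemma integral_abs_deriv_le_of_bound {a b M : ℝ} (hab : a ≤ b) {h h' : ℝ → ℝ}
    (hh : ∀ x ∈ Set.Icc a b, HasDerivAt h (h' x) x) (ch : ContinuousOn h' (Set.Icc a b))
    (hs : (∀ x ∈ Set.Icc a b, 0 ≤ h' x) ∨ (∀ x ∈ Set.Icc a b, h' x ≤ 0))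
    (hM : ∀ x ∈ Set.Icc a b, |h x| ≤ M) : ∫ x in a..b, |h' x| ≤ 2 * M := by
  have ha := hM a (Set.left_mem_Icc.2 hab)
  have hb := hM b (Set.right_mem_Icc.2 hab)
  have e : ∫ x in a..b, h' x = h b - h a := by
    rw [← Set.uIcc_of_le hab] at *
    exact intervalIntegral.integral_eq_sub_of_hasDerivAt hh ch.intervalIntegrable
  rw [abs_le] at ha hb
  rcases hs with hs | hs
  · have : ∫ x in a..b, |h' x| = ∫ x in a..b, h' x := by
      refine intervalIntegral.integral_congr fun x hx => ?_
      rw [Set.uIcc_of_le hab] at hx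
      exact abs_of_nonneg (hs x hx)
    rw [this, e]; linarith
  · have : ∫ x in a..b, |h' x| = ∫ x in a..b, -h' x := by
      refine intervalIntegral.integral_congr fun x hx => ?_
      rw [Set.uIcc_of_le hab] at hx
      exact abs_of_nonpos (hs x hx)
    rw [this, intervalIntegral.integral_neg, e]; linarith

/-- The truncated Airy kernel with symbol `ξ^{1/2}`. -/
def airyKer (t x a b : ℝ) : ℂ :=
  ∫ ξ in a..b, (Real.sqrt ξ : ℂ) * Complex.exp (Complex.I * (t * ξ ^ 3 + x * ξ : ℝ))

lemma continuous_airyKer_integrand (t x : ℝ) :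
    Continuous fun ξ : ℝ =>
      (Real.sqrt ξ : ℂ) * Complex.exp (Complex.I * (t * ξ ^ 3 + x * ξ : ℝ)) := by
  fun_prop

lemma airyKer_add (t x a b c : ℝ) : airyKer t x a b + airyKer t x b c = airyKer t x a c :=
  intervalIntegral.integral_add_adjacent_intervals
    ((continuous_airyKer_integrand t x).intervalIntegrable _ _)
    ((continuous_airyKer_integrand t x).intervalIntegrable _ _)

/-- An interval is cut at `p` and the two bounds are added. The lower limit `q` is carried along so
that the cut can be repeated on a range already known to lie above an earlier cut. -/
lemma norm_airyKer_glue {t x p M₁ M₂ q : ℝ} (h1 : ∀ a b, 0 < a → q ≤ a → a ≤ b → b ≤ p →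
      ‖airyKer t x a b‖ ≤ M₁)
    (h2 : ∀ a b, 0 < a → q ≤ a → p ≤ a → a ≤ b → ‖airyKer t x a b‖ ≤ M₂) (hM₁ : 0 ≤ M₁)
    (hM₂ : 0 ≤ M₂) {a b : ℝ} (ha : 0 < a) (hq : q ≤ a) (hab : a ≤ b) : ‖airyKer t x a b‖ ≤ M₁ + M₂ := by
  rcases le_total b p with hb | hb
  · linarith [h1 a b ha hq hab hb]
  rcases le_total p a with hp | hp
  · linarith [h2 a b ha hq hp hab]
  rw [← airyKer_add t x a p b]
  exact (norm_add_le _ _).trans (add_le_add (h1 a p ha hq hp le_rfl)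
    (h2 p b (ha.trans_le hp) (hq.trans hp) le_rfl hb))

lemma norm_airyKer_le_of_nonneg {t x a b : ℝ} (ha : 0 < a) (hab : a ≤ b) :
    ‖airyKer t x a b‖ ≤ 2 / 3 * (b * Real.sqrt b - a * Real.sqrt a) := by
  have hd : ∀ y ∈ Set.uIcc a b,
      HasDerivAt (fun y : ℝ => 2 / 3 * (y * Real.sqrt y)) (Real.sqrt y) y := by
    intro y hy
    rw [Set.uIcc_of_le hab] at hy
    have hy0 : 0 < y := ha.trans_le hy.1
    have h1 := ((hasDerivAt_id y).mul (Real.hasDerivAt_sqrt hy0.ne')).const_mul (2 / 3)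
    refine h1.congr_deriv ?_
    have hs : Real.sqrt y ≠ 0 := (Real.sqrt_pos.2 hy0).ne'
    have hq := Real.sq_sqrt hy0.le
    simp only [id]
    field_simp
    nlinarith
  have e := intervalIntegral.integral_eq_sub_of_hasDerivAt hd
    (Real.continuous_sqrt.intervalIntegrable _ _)
  refine (intervalIntegral.norm_integral_le_integral_norm hab).trans (le_of_eq ?_)
  rw [mul_sub, ← e]
  congr 1; ext y
  rw [norm_mul, mul_comm Complex.I, Complex.norm_exp_ofReal_mul_I, mul_one, Complex.norm_real,
    Real.norm_of_nonneg (Real.sqrt_nonneg _)]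

/-- Write √y e^{iφ} = h φ' e^{iφ} with φ' = 3y² + x and h = √y/φ'. The sign of h' is that of x −
9y², so h is monotone under `hs`, and `hne` says |h| ≤ 1/3. Van der Corput then gives 1/3 + 1/3 +
2/3. -/
lemma norm_airyKer_one_le_of_monotone {x a b : ℝ} (ha : 0 < a) (hab : a ≤ b)
    (hne : ∀ y ∈ Set.Icc a b, Real.sqrt y ≤ |3 * y ^ 2 + x| * (1 / 3))
    (hs : (∀ y ∈ Set.Icc a b, 9 * y ^ 2 ≤ x) ∨ (∀ y ∈ Set.Icc a b, x ≤ 9 * y ^ 2)) :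
    ‖airyKer 1 x a b‖ ≤ 4 / 3 := by
  have h0 : ∀ y ∈ Set.Icc a b, 0 < y := fun y hy => ha.trans_le hy.1
  have hs0 : ∀ y ∈ Set.Icc a b, 0 < Real.sqrt y := fun y hy => Real.sqrt_pos.2 (h0 y hy)
  have hd0 : ∀ y ∈ Set.Icc a b, 3 * y ^ 2 + x ≠ 0 := by
    intro y hy h
    have := hne y hy
    rw [h] at this
    simp only [abs_zero, zero_mul] at this
    linarith [hs0 y hy]
  set h : ℝ → ℝ := fun y => Real.sqrt y / (3 * y ^ 2 + x) with hh
  set h' : ℝ → ℝ := fun y => (x - 9 * y ^ 2) / (2 * Real.sqrt y * (3 * y ^ 2 + x) ^ 2) with hh'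
  have hder : ∀ y ∈ Set.Icc a b, HasDerivAt h (h' y) y := by
    intro y hy
    have hs1 := (hs0 y hy).ne'
    have hd1 := hd0 y hy
    have h1 := (Real.hasDerivAt_sqrt (h0 y hy).ne').div
      ((((hasDerivAt_pow 2 y)).const_mul 3).add_const x) hd1
    refine h1.congr_deriv ?_
    have hq := Real.sq_sqrt (h0 y hy).le
    simp only [hh']
    field_simp
    rw [hq]
    push_cast
    ring
  have hch : ContinuousOn h' (Set.Icc a b) := by
    refine ContinuousOn.div (by fun_prop) (by fun_prop) fun y hy => ?_
    have hs1 := (hs0 y hy).ne'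
    have hd1 := hd0 y hy
    positivity
  have hb : ∀ y ∈ Set.Icc a b, |h y| ≤ 1 / 3 := by
    intro y hy
    rw [hh]
    simp only
    rw [abs_div, abs_of_pos (hs0 y hy), div_le_iff₀ (abs_pos.2 (hd0 y hy)), mul_comm]
    exact hne y hy
  have hsg : (∀ y ∈ Set.Icc a b, 0 ≤ h' y) ∨ (∀ y ∈ Set.Icc a b, h' y ≤ 0) := by
    rcases hs with hs | hs
    · left
      intro y hy
      have := hs y hy
      have := hs0 y hy
      apply div_nonneg (by linarith) (by positivity)
    · right
      intro y hy
      have := hs y hy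
      have := hs0 y hy
      apply div_nonpos_of_nonpos_of_nonneg (by linarith) (by positivity)
  have k1 := norm_integral_mul_deriv_exp_le hab (φ := fun y => 1 * y ^ 3 + x * y)
    (φ' := fun y => 3 * y ^ 2 + x) (h := h) (h' := h') (fun y _ => by
      have := ((hasDerivAt_pow 3 y).const_mul 1).add ((hasDerivAt_id y).const_mul x)
      refine this.congr_deriv ?_
      push_cast; ring) hder (by fun_prop) hch
  have k2 := integral_abs_deriv_le_of_bound hab hder hch hsg hb
  have k3 : airyKer 1 x a b = ∫ y in a..b, ((h y * (3 * y ^ 2 + x) : ℝ) : ℂ) *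
      Complex.exp (Complex.I * (1 * y ^ 3 + x * y : ℝ)) := by
    refine intervalIntegral.integral_congr fun y hy => ?_
    rw [Set.uIcc_of_le hab] at hy
    simp only [hh]
    rw [div_mul_cancel₀ _ (hd0 y hy)]
  rw [k3]
  linarith [hb a (Set.left_mem_Icc.2 hab), hb b (Set.right_mem_Icc.2 hab)]

/-- For x ≥ 0 the phase has no positive stationary point: [0, 1] is estimated by absolute values,
and [1, ∞) is cut at √x/3, where h stops increasing. For x ≤ 0 a window around the stationary point
is estimated by absolute values and the two sides by van der Corput. The weight √ξ makes the bounds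
independent of x. -/
lemma norm_airyKer_one_le {x a b : ℝ} (ha : 0 < a) (hab : a ≤ b) : ‖airyKer 1 x a b‖ ≤ 4 := by
  rcases le_total 0 x with hx | hx
  · have hs : ∀ y : ℝ, 1 ≤ y → Real.sqrt y ≤ |3 * y ^ 2 + x| * (1 / 3) := by
      intro y hy
      have h1 : Real.sqrt y ≤ y := by
        rw [Real.sqrt_le_left (by linarith)]; nlinarith
      rw [abs_of_nonneg (by positivity)]
      nlinarith
    have := norm_airyKer_glue (t := 1) (x := x) (p := 1) (M₁ := 2 / 3) (M₂ := 4 / 3 + 4 / 3)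
      (q := 0) ?_ ?_ (by norm_num) (by norm_num) ha ha.le hab
    · linarith
    · intro a b ha _ hab hb
      refine (norm_airyKer_le_of_nonneg ha hab).trans ?_
      have h1 : Real.sqrt b ≤ 1 := Real.sqrt_le_one.2 hb
      have h2 : 0 ≤ a * Real.sqrt a := by positivity
      nlinarith [Real.sqrt_nonneg b]
    · intro a b ha0 _ ha hab
      refine norm_airyKer_glue (p := Real.sqrt x / 3) (q := 1) ?_ ?_ (by norm_num)
        (by norm_num) ha0 ha hab
      · intro a b ha0 ha hab hb
        refine norm_airyKer_one_le_of_monotone ha0 hab (fun y hy => hs y (ha.trans hy.1))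
          (Or.inl fun y hy => ?_)
        have h1 : 3 * y ≤ Real.sqrt x := by linarith [hy.2]
        have h2 := Real.sq_sqrt hx
        have h3 := hy.1
        nlinarith
      · intro a b ha0 ha hp hab
        refine norm_airyKer_one_le_of_monotone ha0 hab (fun y hy => hs y (ha.trans hy.1))
          (Or.inr fun y hy => ?_)
        have h1 : Real.sqrt x ≤ 3 * y := by linarith [hy.1]
        have h2 := Real.sq_sqrt hx
        nlinarith [Real.sqrt_nonneg x]
  -- The stationary point is ξ = α.
  · obtain ⟨α, hα, rfl⟩ : ∃ α : ℝ, 0 ≤ α ∧ x = -3 * α ^ 2 := by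
      refine ⟨Real.sqrt (-x / 3), Real.sqrt_nonneg _, ?_⟩
      rw [Real.sq_sqrt (by linarith)]; ring
    have hpow : ∀ z : ℝ, 0 ≤ z → z ^ (2 / 3 : ℝ) * Real.sqrt (z ^ (2 / 3 : ℝ)) = z := by
      intro z hz
      rw [Real.sqrt_eq_rpow, ← Real.rpow_mul hz, ← Real.rpow_add_of_nonneg hz (by norm_num)
        (by norm_num)]
      norm_num
    have hmono : ∀ y z : ℝ, 0 ≤ y → y ≤ z → y * Real.sqrt y ≤ z * Real.sqrt z := by
      intro y z hy hyz
      exact mul_le_mul hyz (Real.sqrt_le_sqrt hyz) (Real.sqrt_nonneg _) (hy.trans hyz)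
    have hmono' : ∀ y z : ℝ, 0 ≤ z → y * Real.sqrt y < z * Real.sqrt z → y < z := by
      intro y z hz h
      by_contra! hc
      exact absurd (hmono z y hz hc) (not_le.2 h)
    -- In the variable ξ^{3/2} the weight √ξ dξ is 2/3 of Lebesgue measure. The window |ξ^{3/2} − A|
    -- ≤ 1, between `p` and `q`, therefore contributes at most 4/3; the maximum with 0 covers A < 1.
    -- Each outer piece also costs 4/3, which makes 4 in total.
    set A := α * Real.sqrt α with hA
    have hA0 : 0 ≤ A := by positivity
    have hsign : ∀ y : ℝ, -3 * α ^ 2 ≤ 9 * y ^ 2 := fun y => by nlinarith [sq_nonneg y, sq_nonneg α]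
    set p := (max 0 (A - 1)) ^ (2 / 3 : ℝ) with hp
    set q := (A + 1) ^ (2 / 3 : ℝ) with hq
    have hpp : p * Real.sqrt p = max 0 (A - 1) := hpow _ (le_max_left _ _)
    have hqq : q * Real.sqrt q = A + 1 := hpow _ (by positivity)
    have hp0 : 0 ≤ p := by positivity
    have hq0 : 0 ≤ q := by positivity
    have hαα := Real.sq_sqrt hα
    have := norm_airyKer_glue (t := 1) (x := -3 * α ^ 2) (p := p) (M₁ := 4 / 3)
      (M₂ := 4 / 3 + 4 / 3) (q := 0) ?_ ?_ (by norm_num) (by norm_num) ha ha.le hab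
    · linarith
    · intro a b ha _ hab hb
      refine norm_airyKer_one_le_of_monotone ha hab (fun y hy => ?_) (Or.inr fun y _ => hsign y)
      have hy0 : 0 < y := ha.trans_le hy.1
      have h1 := hmono y p hy0.le (hy.2.trans hb)
      have h2 := hmono a y ha.le hy.1
      have h3 : 0 < a * Real.sqrt a := by positivity
      have h4 : y * Real.sqrt y ≤ A - 1 := by
        rw [hpp] at h1
        rcases le_total 0 (A - 1) with h | h
        · rwa [max_eq_right h] at h1
        · rw [max_eq_left h] at h1; linarith
      have h5 : y < α := hmono' y α hα (by linarith)
      have h6 : Real.sqrt y ≤ Real.sqrt α := Real.sqrt_le_sqrt h5.le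
      have hyy := Real.sq_sqrt hy0.le
      have hsy := Real.sqrt_nonneg y
      rw [abs_of_nonpos (by nlinarith)]
      -- Below the window, α² − y² = √α·A − √y·y^{3/2} ≥ √y (A − y^{3/2}) ≥ √y, which is the
      -- required lower bound on the derivative of the phase.
      have h7 : α ^ 2 = Real.sqrt α * A := by rw [hA]; linear_combination (-α) * hαα
      have h8 : y ^ 2 = Real.sqrt y * (y * Real.sqrt y) := by linear_combination (-y) * hyy
      nlinarith [mul_le_mul_of_nonneg_left h4 hsy, mul_le_mul_of_nonneg_right h6 hA0]
    · intro a b ha0 _ ha hab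
      refine norm_airyKer_glue (p := q) (q := p) ?_ ?_ (by norm_num)
        (by norm_num) ha0 ha hab
      · intro a b ha0 ha hab hb
        refine (norm_airyKer_le_of_nonneg ha0 hab).trans ?_
        have h1 := hmono b q (ha0.le.trans hab) hb
        have h2 := hmono p a hp0 ha
        rw [hqq] at h1
        rw [hpp] at h2
        have h3 := le_max_right 0 (A - 1)
        linarith
      · intro a b ha0 _ ha hab
        refine norm_airyKer_one_le_of_monotone ha0 hab (fun y hy => ?_) (Or.inr fun y _ => hsign y)
        have hy0 : 0 < y := ha0.trans_le hy.1
        have h1 := hmono q y hq0 (ha.trans hy.1)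
        rw [hqq] at h1
        have h5 : α < y := hmono' α y hy0.le (by linarith)
        have h6 : Real.sqrt α ≤ Real.sqrt y := Real.sqrt_le_sqrt h5.le
        have hyy := Real.sq_sqrt hy0.le
        have hsy := Real.sqrt_nonneg y
        rw [abs_of_nonneg (by nlinarith)]
        have h7 : α ^ 2 = Real.sqrt α * A := by rw [hA]; linear_combination (-α) * hαα
        have h8 : y ^ 2 = Real.sqrt y * (y * Real.sqrt y) := by linear_combination (-y) * hyy
        nlinarith [mul_le_mul_of_nonneg_left h1 hsy, mul_le_mul_of_nonneg_right h6 hA0]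

/-- Scaling ξ by s = t^{-1/3} normalizes the cubic coefficient to 1, and the Jacobian and the weight
together give s√s = t^{-1/2}. The bound at t = 1 is uniform in x and in the end points. -/
lemma norm_airyKer_le_of_pos {t x a b : ℝ} (ht : 0 < t) (ha : 0 < a) (hab : a ≤ b) :
    ‖airyKer t x a b‖ ≤ 4 / Real.sqrt t := by
  set s := t ^ (-(1 / 3) : ℝ) with hs
  have hs0 : 0 < s := by positivity
  have hs3 : t * s ^ 3 = 1 := by
    rw [hs, ← Real.rpow_natCast, ← Real.rpow_mul ht.le]
    norm_num
    rw [Real.rpow_neg_one]; field_simp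
  have h1 := intervalIntegral.smul_integral_comp_mul_left (a := a / s) (b := b / s)
    (fun ξ : ℝ => (Real.sqrt ξ : ℂ) * Complex.exp (Complex.I * (t * ξ ^ 3 + x * ξ : ℝ))) s
  rw [mul_div_cancel₀ _ hs0.ne', mul_div_cancel₀ _ hs0.ne'] at h1
  have h2 : airyKer t x a b = ((s * Real.sqrt s : ℝ) : ℂ) * airyKer 1 (x * s) (a / s) (b / s) := by
    rw [airyKer, ← h1, airyKer, ← intervalIntegral.integral_const_mul,
      ← intervalIntegral.integral_smul]
    congr 1; ext ξ
    rw [Real.sqrt_mul hs0.le, Complex.real_smul,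
      show t * (s * ξ) ^ 3 + x * (s * ξ) = 1 * ξ ^ 3 + x * s * ξ by
        linear_combination ξ ^ 3 * hs3]
    push_cast; ring
  have h3 : s * Real.sqrt s = 1 / Real.sqrt t := by
    rw [eq_div_iff (Real.sqrt_pos.2 ht).ne', mul_assoc, ← Real.sqrt_mul hs0.le,
      ← Real.sqrt_sq hs0.le, ← Real.sqrt_mul (by positivity), Real.sqrt_sq hs0.le,
      show s ^ 2 * (s * t) = 1 by linarith [hs3], Real.sqrt_one]
  rw [h2, norm_mul, h3, Complex.norm_real, Real.norm_of_nonneg (by positivity)]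
  calc 1 / Real.sqrt t * ‖airyKer 1 (x * s) (a / s) (b / s)‖ ≤ 1 / Real.sqrt t * 4 := by
        gcongr
        exact norm_airyKer_one_le (by positivity) (by gcongr)
    _ = _ := by ring

lemma airyKer_neg (t x a b : ℝ) : airyKer (-t) (-x) a b = conj (airyKer t x a b) := by
  simp only [airyKer, intervalIntegral, map_sub, ← integral_conj]
  have e : ∀ ξ : ℝ, (Real.sqrt ξ : ℂ) * Complex.exp (Complex.I * (-t * ξ ^ 3 + -x * ξ : ℝ)) =
      conj ((Real.sqrt ξ : ℂ) * Complex.exp (Complex.I * (t * ξ ^ 3 + x * ξ : ℝ))) := by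
    intro ξ
    rw [map_mul, ← Complex.exp_conj, map_mul, Complex.conj_I, Complex.conj_ofReal,
      Complex.conj_ofReal]
    congr 2
    push_cast; ring
  simp_rw [e]

/-- The dispersive estimate for the truncated Airy kernel. -/
lemma norm_airyKer_le {t : ℝ} (x : ℝ) {a b : ℝ} (ht : t ≠ 0) (ha : 0 < a) (hab : a ≤ b) :
    ‖airyKer t x a b‖ ≤ 4 / Real.sqrt |t| := by
  rcases lt_or_gt_of_ne ht with h | h
  · rw [← neg_neg t, ← neg_neg x, airyKer_neg, RCLike.norm_conj, neg_neg, abs_of_neg h]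
    exact norm_airyKer_le_of_pos (by linarith) ha hab
  · rw [abs_of_pos h]
    exact norm_airyKer_le_of_pos h ha hab

/-! ### Hardy–Littlewood–Sobolev with kernel |t − s|^{-1/2} -/

lemma lintegral_comp_abs (f : ℝ → ℝ≥0∞) : ∫⁻ x, f |x| = 2 * ∫⁻ x in Set.Ioi 0, f x := by
  have h1 : ∫⁻ x in Set.Ioi (0 : ℝ), f |x| = ∫⁻ x in Set.Ioi 0, f x :=
    setLIntegral_congr_fun measurableSet_Ioi fun x hx => by rw [abs_of_pos hx]
  have h2 : ∫⁻ x in Set.Iio (0 : ℝ), f |x| = ∫⁻ x in Set.Ioi 0, f x := by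
    have := (Measure.measurePreserving_neg (volume : Measure ℝ)).setLIntegral_comp_preimage_emb
      (Homeomorph.neg ℝ).measurableEmbedding f (Set.Ioi 0)
    rw [← this]
    simp only [Set.neg_preimage, Set.neg_Ioi, neg_zero]
    exact setLIntegral_congr_fun measurableSet_Iio fun x hx => by rw [abs_of_neg hx]
  rw [← lintegral_add_compl _ (measurableSet_Ioi (a := (0 : ℝ))), h1, Set.compl_Ioi,
    ← setLIntegral_congr Iio_ae_eq_Iic, h2, two_mul]

lemma setLIntegral_Ioo_rpow {s r : ℝ} (hs : -1 < s) (hr : 0 < r) :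
    ∫⁻ x in Set.Ioo 0 r, ENNReal.ofReal (x ^ s) = ENNReal.ofReal (r ^ (s + 1) / (s + 1)) := by
  have hi := (intervalIntegral.integrableOn_Ioo_rpow_iff hr).2 hs
  rw [← ofReal_integral_eq_lintegral_ofReal hi, ← integral_Ioc_eq_integral_Ioo,
    ← intervalIntegral.integral_of_le hr.le, integral_rpow (Or.inl hs),
    Real.zero_rpow (by linarith), sub_zero]
  filter_upwards [ae_restrict_mem measurableSet_Ioo] with x hx
  exact Real.rpow_nonneg hx.1.le _

lemma setLIntegral_Ioi_rpow {s c : ℝ} (hs : s < -1) (hc : 0 < c) :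
    ∫⁻ x in Set.Ioi c, ENNReal.ofReal (x ^ s) = ENNReal.ofReal (-c ^ (s + 1) / (s + 1)) := by
  have hi := integrableOn_Ioi_rpow_of_lt hs hc
  rw [← ofReal_integral_eq_lintegral_ofReal hi, integral_Ioi_rpow_of_lt hs hc]
  filter_upwards [ae_restrict_mem measurableSet_Ioi] with x hx
  exact Real.rpow_nonneg (hc.trans hx).le _

lemma setLIntegral_abs_lt_rpow {s r : ℝ} (hs : -1 < s) (hr : 0 < r) :
    ∫⁻ u in {u : ℝ | |u| < r}, ENNReal.ofReal (|u| ^ s) =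
      ENNReal.ofReal (2 * (r ^ (s + 1) / (s + 1))) := by
  have hm : MeasurableSet {u : ℝ | |u| < r} := measurableSet_lt (by fun_prop) (by fun_prop)
  have e1 : ∫⁻ u in {u : ℝ | |u| < r}, ENNReal.ofReal (|u| ^ s) =
      ∫⁻ u, (fun y => (Set.Iio r).indicator (fun y => ENNReal.ofReal (y ^ s)) y) |u| := by
    rw [← lintegral_indicator hm]
    congr 1
  rw [e1, lintegral_comp_abs, lintegral_indicator measurableSet_Iio,
    Measure.restrict_restrict measurableSet_Iio, Set.inter_comm, Set.Ioi_inter_Iio,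
    setLIntegral_Ioo_rpow hs hr, ENNReal.ofReal_mul (by norm_num)]
  norm_num

lemma setLIntegral_le_abs_rpow {s r : ℝ} (hs : s < -1) (hr : 0 < r) :
    ∫⁻ u in {u : ℝ | r < |u|}, ENNReal.ofReal (|u| ^ s) =
      ENNReal.ofReal (2 * (-r ^ (s + 1) / (s + 1))) := by
  have hm : MeasurableSet {u : ℝ | r < |u|} := measurableSet_lt (by fun_prop) (by fun_prop)
  have e1 : ∫⁻ u in {u : ℝ | r < |u|}, ENNReal.ofReal (|u| ^ s) =
      ∫⁻ u, (fun y => (Set.Ioi r).indicator (fun y => ENNReal.ofReal (y ^ s)) y) |u| := by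
    rw [← lintegral_indicator hm]
    congr 1
  rw [e1, lintegral_comp_abs, lintegral_indicator measurableSet_Ioi,
    Measure.restrict_restrict measurableSet_Ioi, Set.Ioi_inter_Ioi, sup_eq_left.2 hr.le,
    setLIntegral_Ioi_rpow hs hr, ENNReal.ofReal_mul (by norm_num)]
  norm_num

/-- For |t| < r the sup bound is used, for |t| > r Hölder with exponents 4/3 and 4. The two
contributions carry the constants 4 and 2. -/
lemma lintegral_mul_abs_rpow_neg_half_le {g : ℝ → ℝ≥0∞} (hg : Measurable g) {H N : ℝ}
    (hH : 0 < H) (hN : 0 < N) (hgH : ∀ t, g t ≤ ENNReal.ofReal H)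
    (hgN : ∫⁻ t, g t ^ (4 / 3 : ℝ) ≤ ENNReal.ofReal N) :
    ∫⁻ t, g t * ENNReal.ofReal (|t| ^ (-(1 / 2) : ℝ))
      ≤ ENNReal.ofReal (6 * (N ^ (1 / 2 : ℝ) * H ^ (1 / 3 : ℝ))) := by
  -- This radius balances H r^{1/2} against N^{3/4} r^{-1/4}.
  set r := N * H ^ (-(4 / 3) : ℝ) with hr
  have hr0 : 0 < r := by positivity
  have hm : MeasurableSet {u : ℝ | |u| < r} := measurableSet_lt (by fun_prop) (by fun_prop)
  have hm' : MeasurableSet {u : ℝ | r < |u|} := measurableSet_lt (by fun_prop) (by fun_prop)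
  have hmk : Measurable fun t : ℝ => ENNReal.ofReal (|t| ^ (-(1 / 2) : ℝ)) := by fun_prop
  have near : ∫⁻ t in {u : ℝ | |u| < r}, g t * ENNReal.ofReal (|t| ^ (-(1 / 2) : ℝ)) ≤
      ENNReal.ofReal (H * (4 * r ^ (1 / 2 : ℝ))) := by
    calc _ ≤ ∫⁻ t in {u : ℝ | |u| < r}, ENNReal.ofReal H * ENNReal.ofReal (|t| ^ (-(1 / 2) : ℝ)) :=
          lintegral_mono fun t => by gcongr; exact hgH t
      _ = ENNReal.ofReal (H * (4 * r ^ (1 / 2 : ℝ))) := by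
          rw [lintegral_const_mul _ hmk, setLIntegral_abs_lt_rpow (by norm_num) hr0,
            ← ENNReal.ofReal_mul hH.le]
          norm_num
          ring_nf
  have far : ∫⁻ t in {u : ℝ | r < |u|}, g t * ENNReal.ofReal (|t| ^ (-(1 / 2) : ℝ)) ≤
      ENNReal.ofReal (N ^ (3 / 4 : ℝ) * (2 * r⁻¹) ^ (1 / 4 : ℝ)) := by
    have hc : (4 / 3 : ℝ).HolderConjugate 4 := by
      rw [Real.holderConjugate_iff]; norm_num
    refine (ENNReal.lintegral_mul_le_Lp_mul_Lq _ hc hg.aemeasurable hmk.aemeasurable).trans ?_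
    rw [ENNReal.ofReal_mul (by positivity), ← ENNReal.ofReal_rpow_of_pos hN,
      ← ENNReal.ofReal_rpow_of_pos (by positivity)]
    refine mul_le_mul' ?_ ?_
    · rw [show (1 : ℝ) / (4 / 3) = 3 / 4 by norm_num]
      gcongr
      exact (setLIntegral_le_lintegral _ _).trans hgN
    · gcongr
      have : ∀ t : ℝ, ENNReal.ofReal (|t| ^ (-(1 / 2) : ℝ)) ^ (4 : ℝ) =
          ENNReal.ofReal (|t| ^ (-2 : ℝ)) := by
        intro t
        rw [ENNReal.ofReal_rpow_of_nonneg (by positivity) (by norm_num), ← Real.rpow_mul (abs_nonneg _)]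
        norm_num
      simp_rw [this]
      rw [setLIntegral_le_abs_rpow (by norm_num) hr0]
      norm_num [Real.rpow_neg_one]
  have hcov : ∫⁻ t, g t * ENNReal.ofReal (|t| ^ (-(1 / 2) : ℝ)) ≤
      (∫⁻ t in {u : ℝ | |u| < r}, g t * ENNReal.ofReal (|t| ^ (-(1 / 2) : ℝ))) +
      ∫⁻ t in {u : ℝ | r < |u|}, g t * ENNReal.ofReal (|t| ^ (-(1 / 2) : ℝ)) := by
    rw [← lintegral_add_compl _ hm]
    have h0 : ({u : ℝ | |u| < r}ᶜ : Set ℝ) =ᵐ[volume] {u : ℝ | r < |u|} := by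
      have : ∀ᵐ u : ℝ, u ∉ ({r, -r} : Set ℝ) :=
        measure_eq_zero_iff_ae_notMem.1 ((Set.toFinite _).measure_zero _)
      filter_upwards [this] with u hu
      simp only [Set.mem_insert_iff, Set.mem_singleton_iff, not_or] at hu
      have hne : r ≠ |u| := fun h => by
        rcases abs_choice u with h' | h' <;> rw [h'] at h
        · exact hu.1 h.symm
        · exact hu.2 (by linarith)
      change (¬ |u| < r) = (r < |u|)
      rw [not_lt, hne.le_iff_lt]
    exact add_le_add le_rfl (setLIntegral_congr h0).le
  refine hcov.trans ((add_le_add near far).trans ?_)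
  rw [← ENNReal.ofReal_add (by positivity) (by positivity)]
  apply ENNReal.ofReal_le_ofReal
  have e1 : H * r ^ (1 / 2 : ℝ) = N ^ (1 / 2 : ℝ) * H ^ (1 / 3 : ℝ) := by
    rw [hr, Real.mul_rpow hN.le (by positivity), ← Real.rpow_mul hH.le]
    have : H ^ (1 / 3 : ℝ) = H * H ^ (-(4 / 3) * (1 / 2) : ℝ) := by
      nth_rewrite 2 [← Real.rpow_one H]
      rw [← Real.rpow_add hH]; norm_num
    rw [this]; ring
  have e2 : N ^ (3 / 4 : ℝ) * r⁻¹ ^ (1 / 4 : ℝ) = N ^ (1 / 2 : ℝ) * H ^ (1 / 3 : ℝ) := by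
    rw [Real.inv_rpow hr0.le, ← Real.rpow_neg hr0.le, hr, Real.mul_rpow hN.le (by positivity),
      ← Real.rpow_mul hH.le, ← mul_assoc, ← Real.rpow_add hN]
    norm_num
  have e3 : (2 * r⁻¹ : ℝ) ^ (1 / 4 : ℝ) ≤ 2 * r⁻¹ ^ (1 / 4 : ℝ) := by
    rw [Real.mul_rpow (by norm_num) (by positivity)]
    gcongr
    calc (2 : ℝ) ^ (1 / 4 : ℝ) ≤ 2 ^ (1 : ℝ) :=
          Real.rpow_le_rpow_of_exponent_le (by norm_num) (by norm_num)
      _ = 2 := by norm_num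
  have e4 := mul_le_mul_of_nonneg_left e3 (show 0 ≤ N ^ (3 / 4 : ℝ) by positivity)
  nlinarith

/-- The Hardy–Littlewood–Sobolev inequality on the line with kernel `|t - s|^{-1/2}`. -/
lemma hardyLittlewoodSobolev_half {h : ℝ → ℝ≥0∞} (hh : Measurable h) (hfin : ∀ t, h t ≠ ∞) :
    ∫⁻ s, ∫⁻ t, h s * h t * ENNReal.ofReal (|t - s| ^ (-(1 / 2) : ℝ))
      ≤ 12 * (∫⁻ t, h t ^ (4 / 3 : ℝ)) ^ (3 / 2 : ℝ) := by
  set N := ∫⁻ t, h t ^ (4 / 3 : ℝ) with hN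
  rcases eq_or_ne N ∞ with hNt | hNt
  · rw [hNt]; simp
  rcases eq_or_ne N 0 with hN0 | hN0
  · have h0 : ∀ᵐ t, h t = 0 := by
      rw [hN, lintegral_eq_zero_iff (by fun_prop)] at hN0
      filter_upwards [hN0] with t ht
      exact (ENNReal.rpow_eq_zero_iff_of_pos (by norm_num)).1 ht
    have : ∀ᵐ s, ∫⁻ t, h s * h t * ENNReal.ofReal (|t - s| ^ (-(1 / 2) : ℝ)) = 0 := by
      filter_upwards [h0] with s hs
      simp [hs]
    rw [lintegral_congr_ae this]; simp
  have hNr : 0 < N.toReal := ENNReal.toReal_pos hN0 hNt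
  -- By symmetry of the kernel it suffices, up to a factor 2, to integrate over h t ≤ h s. There the
  -- inner function is bounded by h s, so the previous lemma gives 6 N^{1/2} h(s)^{1/3}, and h ·
  -- h^{1/3} = h^{4/3} integrates to N.
  set g : ℝ → ℝ → ℝ≥0∞ := fun s t => if h t ≤ h s then h t else 0 with hg
  have hgm : Measurable (Function.uncurry g) := by
    refine Measurable.ite (measurableSet_le ?_ ?_) ?_ measurable_const <;> fun_prop
  set k : ℝ → ℝ → ℝ≥0∞ := fun s t => ENNReal.ofReal (|t - s| ^ (-(1 / 2) : ℝ)) with hk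
  have hkm : Measurable (Function.uncurry k) := by
    simp only [hk, Function.uncurry_def]; fun_prop
  have hksymm : ∀ s t, k s t = k t s := fun s t => by simp only [hk, abs_sub_comm]
  have main : ∀ s, ∫⁻ t, g s t * k s t ≤
      ENNReal.ofReal (6 * N.toReal ^ (1 / 2 : ℝ)) * h s ^ (1 / 3 : ℝ) := by
    intro s
    rcases eq_or_ne (h s) 0 with hs | hs
    · have : ∀ t, g s t = 0 := by
        intro t; simp only [hg, hs]
        split_ifs with h'
        · exact le_antisymm h' (zero_le)
        · rfl
      simp [this]
    have hsr : 0 < (h s).toReal := ENNReal.toReal_pos hs (hfin s)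
    have e : ∫⁻ t, g s t * k s t =
        ∫⁻ t, g s (t + s) * ENNReal.ofReal (|t| ^ (-(1 / 2) : ℝ)) := by
      rw [← lintegral_add_right_eq_self _ s]
      simp [hk]
    rw [e]
    have hgs : Measurable fun t => g s (t + s) := hgm.comp (by fun_prop : Measurable fun t => (s, t + s))
    refine (lintegral_mul_abs_rpow_neg_half_le hgs hsr hNr (fun t => ?_) ?_).trans (le_of_eq ?_)
    · rw [ENNReal.ofReal_toReal (hfin s)]
      simp only [hg]
      split_ifs with h'
      · exact h'
      · exact zero_le
    · rw [ENNReal.ofReal_toReal hNt, lintegral_add_right_eq_self (fun t => g s t ^ (4 / 3 : ℝ)) s, hN]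
      refine lintegral_mono fun t => ?_
      gcongr
      simp only [hg]
      split_ifs with h'
      · exact le_rfl
      · exact zero_le
    · rw [← mul_assoc, ENNReal.ofReal_mul (by positivity), ← ENNReal.ofReal_rpow_of_pos hsr,
        ENNReal.ofReal_toReal (hfin s)]
  have hpt : ∀ s t, h s * h t * k s t ≤ h s * (g s t * k s t) + h t * (g t s * k t s) := by
    intro s t
    rw [hksymm t s]
    rcases le_total (h t) (h s) with h' | h'
    · refine le_trans (le_of_eq ?_) le_self_add
      simp only [hg, if_pos h', mul_assoc]
    · refine le_trans (le_of_eq ?_) le_add_self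
      simp only [hg, if_pos h']
      ring
  have hGm : Measurable fun z : ℝ × ℝ => h z.1 * (g z.1 z.2 * k z.1 z.2) :=
    (hh.comp measurable_fst).mul (hgm.mul hkm)
  have hGm' : Measurable fun z : ℝ × ℝ => h z.2 * (g z.2 z.1 * k z.2 z.1) :=
    hGm.comp measurable_swap
  calc ∫⁻ s, ∫⁻ t, h s * h t * k s t
      ≤ ∫⁻ s, ∫⁻ t, (h s * (g s t * k s t) + h t * (g t s * k t s)) :=
        lintegral_mono fun s => lintegral_mono fun t => hpt s t
    _ = (∫⁻ s, ∫⁻ t, h s * (g s t * k s t)) + ∫⁻ s, ∫⁻ t, h t * (g t s * k t s) := by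
        rw [← lintegral_add_left hGm.lintegral_prod_right']
        congr 1; ext s
        exact lintegral_add_left (hGm.comp measurable_prodMk_left) _
    _ = 2 * ∫⁻ s, ∫⁻ t, h s * (g s t * k s t) := by
        rw [two_mul]
        congr 1
        exact lintegral_lintegral_swap (f := fun s t => h t * (g t s * k t s)) hGm'.aemeasurable
    _ ≤ 2 * ∫⁻ s, h s * (ENNReal.ofReal (6 * N.toReal ^ (1 / 2 : ℝ)) * h s ^ (1 / 3 : ℝ)) := by
        gcongr with s
        rw [lintegral_const_mul' _ _ (hfin s)]
        gcongr
        exact main s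
    _ = 2 * (ENNReal.ofReal (6 * N.toReal ^ (1 / 2 : ℝ)) * N) := by
        congr 1
        generalize ENNReal.ofReal (6 * N.toReal ^ (1 / 2 : ℝ)) = c
        rw [hN, ← lintegral_const_mul _ (by fun_prop)]
        refine lintegral_congr fun s => ?_
        rw [mul_left_comm]
        congr 1
        nth_rewrite 1 [← ENNReal.rpow_one (h s)]
        rw [← ENNReal.rpow_add_of_nonneg _ _ (by norm_num) (by norm_num)]
        norm_num
    _ = 12 * N ^ (3 / 2 : ℝ) := by
        rw [ENNReal.ofReal_mul (by norm_num), ← ENNReal.ofReal_rpow_of_pos hNr,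
          ENNReal.ofReal_toReal hNt, mul_assoc, show (3 / 2 : ℝ) = 1 / 2 + 1 by norm_num,
          ENNReal.rpow_add_of_nonneg _ _ (by norm_num) (by norm_num), ENNReal.rpow_one, ← mul_assoc]
        norm_num

/-! ### TT* along curves and the maximal function estimate -/

/-- Square integrable functions supported in some annulus `a ≤ |ξ| ≤ b` with `0 < a`. -/
structure IsAnnular (f : ℝ → ℂ) : Prop where
  measurable : Measurable f
  memLp : MemLp f 2
  support : ∃ a b : ℝ, 0 < a ∧ a ≤ b ∧ ∀ ξ, f ξ ≠ 0 → a ≤ |ξ| ∧ |ξ| ≤ b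

lemma IsAnnular.mul {f m : ℝ → ℂ} (hf : IsAnnular f) (hm : Measurable m)
    (hb : ∀ a b : ℝ, 0 < a → ∃ C, ∀ ξ : ℝ, a ≤ |ξ| → |ξ| ≤ b → ‖m ξ‖ ≤ C) :
    IsAnnular (fun ξ => m ξ * f ξ) := by
  obtain ⟨a, b, ha, hab, hs⟩ := hf.support
  refine ⟨hm.mul hf.measurable, ?_, a, b, ha, hab, fun ξ h => hs ξ (right_ne_zero_of_mul h)⟩
  obtain ⟨C, hC⟩ := hb a b ha
  refine hf.memLp.of_le_mul (c := C) (hm.mul hf.measurable).aestronglyMeasurable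
    (Eventually.of_forall fun ξ => ?_)
  by_cases h : f ξ = 0
  · simp [h]
  · rw [norm_mul]
    gcongr
    exact hC ξ (hs ξ h).1 (hs ξ h).2

lemma IsAnnular.integrable {f : ℝ → ℂ} (hf : IsAnnular f) : Integrable f := by
  obtain ⟨a, b, ha, hab, hs⟩ := hf.support
  have h1 : IntegrableOn f (Set.Icc (-b) b) := by
    have : IsFiniteMeasure (volume.restrict (Set.Icc (-b) b)) := by
      refine ⟨?_⟩; simp
    exact (hf.memLp.restrict _).integrable (by norm_num)
  refine (integrableOn_iff_integrable_of_support_subset fun ξ h => ?_).1 h1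
  exact abs_le.1 (hs ξ h).2

lemma measurable_uncurry_invFT {σ : ℝ → ℝ → ℂ} (hσ : Measurable (Function.uncurry σ)) :
    Measurable (Function.uncurry fun t x => invFT (σ t) x) := by
  have h : StronglyMeasurable (Function.uncurry fun (z : ℝ × ℝ) (ξ : ℝ) =>
      Complex.exp (Complex.I * ξ * z.2) * σ z.1 ξ) := by
    refine Measurable.stronglyMeasurable ?_
    refine Measurable.mul (by fun_prop) ?_
    exact hσ.comp (by fun_prop : Measurable fun w : (ℝ × ℝ) × ℝ => (w.1.1, w.2))
  exact (h.integral_prod_right.measurable).const_mul _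

/-- The symbol `|ξ|^s e^{itξ³}`. -/
def airySymbol (s t ξ : ℝ) : ℂ := ((|ξ| ^ s : ℝ) : ℂ) * Complex.exp (Complex.I * t * ξ ^ 3)

lemma norm_exp_I_mul_cube (t ξ : ℝ) : ‖Complex.exp (Complex.I * t * (ξ : ℂ) ^ 3)‖ = 1 := by
  have := norm_exp_I_mul_mul t (ξ ^ 3)
  push_cast at this
  exact this

lemma norm_airySymbol (s t ξ : ℝ) : ‖airySymbol s t ξ‖ = |ξ| ^ s := by
  rw [airySymbol, norm_mul, norm_exp_I_mul_cube, mul_one, Complex.norm_real,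
    Real.norm_of_nonneg (by positivity)]

lemma measurable_airySymbol (s : ℝ) : Measurable (Function.uncurry (airySymbol s)) := by
  simp only [airySymbol, Function.uncurry_def]
  fun_prop

lemma exists_rpow_bound_annulus (s : ℝ) {a : ℝ} (b : ℝ) (ha : 0 < a) :
    ∃ C, ∀ ξ : ℝ, a ≤ |ξ| → |ξ| ≤ b → |ξ| ^ s ≤ C := by
  refine ⟨a ^ s + b ^ s, fun ξ h1 h2 => ?_⟩
  have hb : 0 < b := ha.trans_le (h1.trans h2)
  have := Real.rpow_nonneg ha.le s
  have := Real.rpow_nonneg hb.le s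
  rcases le_total 0 s with hs | hs
  · have := Real.rpow_le_rpow (abs_nonneg ξ) h2 hs
    linarith
  · have := Real.rpow_le_rpow_of_nonpos ha h1 hs
    linarith

lemma IsAnnular.airySymbol_mul {f : ℝ → ℂ} (hf : IsAnnular f) (s t : ℝ) :
    IsAnnular (fun ξ => airySymbol s t ξ * f ξ) := by
  refine hf.mul ((measurable_airySymbol s).comp measurable_prodMk_left) fun a b ha => ?_
  obtain ⟨C, hC⟩ := exists_rpow_bound_annulus s b ha
  exact ⟨C, fun ξ h1 h2 => by rw [norm_airySymbol]; exact hC ξ h1 h2⟩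

/-- The two-sided truncated kernel. -/
lemma norm_setIntegral_annulus_le {t : ℝ} (x : ℝ) {a b : ℝ} (ht : t ≠ 0) (ha : 0 < a)
    (hab : a ≤ b) :
    ‖∫ ξ in {ξ : ℝ | a < |ξ| ∧ |ξ| ≤ b}, ((|ξ| ^ (1 / 2 : ℝ) : ℝ) : ℂ) *
      Complex.exp (Complex.I * (t * ξ ^ 3 + x * ξ : ℝ))‖ ≤ 8 / Real.sqrt |t| := by
  set F : ℝ → ℂ := fun ξ => ((|ξ| ^ (1 / 2 : ℝ) : ℝ) : ℂ) *
      Complex.exp (Complex.I * (t * ξ ^ 3 + x * ξ : ℝ)) with hF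
  have hFc : Continuous F := by
    have : Continuous fun ξ : ℝ => |ξ| ^ (1 / 2 : ℝ) :=
      (Real.continuous_rpow_const (by norm_num)).comp continuous_abs
    fun_prop
  have hset : {ξ : ℝ | a < |ξ| ∧ |ξ| ≤ b} = Set.Ioc a b ∪ Set.Ico (-b) (-a) := by
    ext ξ
    simp only [Set.mem_ofPred_eq, Set.mem_union, Set.mem_Ioc, Set.mem_Ico]
    rcases le_total 0 ξ with h | h
    · rw [abs_of_nonneg h]
      constructor
      · exact Or.inl
      · rintro (h' | h')
        · exact h'
        · linarith
    · rw [abs_of_nonpos h]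
      constructor
      · exact fun h' => Or.inr ⟨by linarith, by linarith⟩
      · rintro (h' | h')
        · linarith
        · exact ⟨by linarith, by linarith⟩
  have hdisj : Disjoint (Set.Ioc a b) (Set.Ico (-b) (-a)) := by
    rw [Set.disjoint_left]
    intro ξ h1 h2
    linarith [h1.1, h2.2]
  have e1 : ∫ ξ in Set.Ioc a b, F ξ = airyKer t x a b := by
    rw [airyKer, intervalIntegral.integral_of_le hab]
    refine setIntegral_congr_fun measurableSet_Ioc fun ξ hξ => ?_
    simp only [hF]
    rw [abs_of_pos (ha.trans hξ.1), Real.sqrt_eq_rpow]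
  have e2 : ∫ ξ in Set.Ico (-b) (-a), F ξ = airyKer (-t) (-x) a b := by
    rw [integral_Ico_eq_integral_Ioo, ← integral_Ioc_eq_integral_Ioo,
      ← intervalIntegral.integral_of_le (by linarith), airyKer,
      ← intervalIntegral.integral_comp_neg]
    refine intervalIntegral.integral_congr fun ξ hξ => ?_
    rw [Set.uIcc_of_le hab] at hξ
    simp only [hF]
    rw [abs_neg, abs_of_pos (ha.trans_le hξ.1), Real.sqrt_eq_rpow]
    congr 3
    push_cast; ring
  rw [hset, setIntegral_union hdisj measurableSet_Ico
    ((hFc.integrableOn_Icc).mono_set Set.Ioc_subset_Icc_self)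
    ((hFc.integrableOn_Icc).mono_set Set.Ico_subset_Icc_self), e1, e2]
  have h1 := norm_airyKer_le x ht ha hab
  have h2 := norm_airyKer_le (-x) (neg_ne_zero.2 ht) ha hab
  rw [abs_neg] at h2
  refine (norm_add_le _ _).trans ((add_le_add h1 h2).trans (le_of_eq ?_))
  ring

/-- The dual (extension) estimate: `L^{4/3}_t → L²_ξ`. -/
lemma lintegral_dual_sq_le {k : ℝ → ℂ} (hk : Integrable k) (hkm : Measurable k) {X : ℝ → ℝ}
    (hX : Measurable X) {a b : ℝ} (ha : 0 < a) (hab : a ≤ b) :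
    ∫⁻ ξ in {ξ : ℝ | a < |ξ| ∧ |ξ| ≤ b}, ‖((|ξ| ^ (1 / 4 : ℝ) : ℝ) : ℂ) *
      ∫ t, k t * Complex.exp (Complex.I * (t * ξ ^ 3 + X t * ξ : ℝ))‖ₑ ^ 2
      ≤ 96 * (∫⁻ t, ‖k t‖ₑ ^ (4 / 3 : ℝ)) ^ (3 / 2 : ℝ) := by
  set A : Set ℝ := {ξ : ℝ | a < |ξ| ∧ |ξ| ≤ b} with hA
  have hAm : MeasurableSet A :=
    (measurableSet_lt measurable_const continuous_abs.measurable).inter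
      (measurableSet_le continuous_abs.measurable measurable_const)
  have hAfin : IsFiniteMeasure (volume.restrict A) := by
    refine ⟨?_⟩
    rw [Measure.restrict_apply_univ]
    refine (measure_mono (t := Set.Icc (-b) b) fun ξ hξ => abs_le.1 hξ.2).trans_lt ?_
    simp
  set e : ℝ → ℝ → ℂ := fun t ξ => Complex.exp (Complex.I * (t * ξ ^ 3 + X t * ξ : ℝ)) with he
  have hem : Measurable (Function.uncurry e) := by
    simp only [he, Function.uncurry_def]; fun_prop
  have hen : ∀ t ξ, ‖e t ξ‖ = 1 := fun t ξ => by
    simp only [he]; rw [mul_comm, Complex.norm_exp_ofReal_mul_I]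
  set K : ℝ → ℂ := fun ξ => ∫ t, k t * e t ξ with hK
  have hKm : Measurable K := by
    have h : StronglyMeasurable (Function.uncurry fun ξ t => k t * e t ξ) := by
      refine Measurable.stronglyMeasurable ?_
      exact (hkm.comp measurable_snd).mul (hem.comp measurable_swap)
    exact h.integral_prod_right.measurable
  -- Expanding |K|² as a double time integral and integrating in ξ first leaves the truncated Airy
  -- kernel at time difference z.1 − z.2 and position difference X z.1 − X z.2. Its bound does not
  -- see the positions, so any measurable curve is allowed.
  have hKK : ∀ ξ, K ξ * conj (K ξ) =
      ∫ z : ℝ × ℝ, (k z.1 * e z.1 ξ) * conj (k z.2 * e z.2 ξ) ∂(volume.prod volume) := by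
    intro ξ
    rw [integral_prod_mul (fun t => k t * e t ξ) (fun s => conj (k s * e s ξ)), integral_conj]
  set W : ℝ → ℂ := fun ξ => ((|ξ| ^ (1 / 2 : ℝ) : ℝ) : ℂ) with hW
  have hWm : Measurable W := by simp only [hW]; fun_prop
  have hWint : Integrable W (volume.restrict A) := by
    refine Integrable.of_bound hWm.aestronglyMeasurable (b ^ (1 / 2 : ℝ)) ?_
    filter_upwards [ae_restrict_mem hAm] with ξ hξ
    simp only [hW]
    rw [Complex.norm_real, Real.norm_of_nonneg (by positivity)]
    exact Real.rpow_le_rpow (abs_nonneg _) hξ.2 (by norm_num)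
  have hsq : ∀ ξ, ‖((|ξ| ^ (1 / 4 : ℝ) : ℝ) : ℂ) * K ξ‖ₑ ^ 2 = ‖W ξ * (K ξ * conj (K ξ))‖ₑ := by
    intro ξ
    rw [enorm_mul, enorm_mul, enorm_mul, mul_pow]
    congr 1
    · rw [← ofReal_norm, ← ofReal_norm, ← ENNReal.ofReal_pow (norm_nonneg _), Complex.norm_real,
        Complex.norm_real, Real.norm_of_nonneg (by positivity), Real.norm_of_nonneg (by positivity),
        ← Real.rpow_natCast, ← Real.rpow_mul (abs_nonneg _)]
      norm_num
    · rw [sq, ← ofReal_norm (conj (K ξ)), RCLike.norm_conj, ofReal_norm]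
  have hpos : ∀ ξ, W ξ * (K ξ * conj (K ξ)) = ((|ξ| ^ (1 / 2 : ℝ) * ‖K ξ‖ ^ 2 : ℝ) : ℂ) := by
    intro ξ
    rw [Complex.mul_conj, Complex.normSq_eq_norm_sq]
    push_cast; rfl
  have hkk : Integrable (fun z : ℝ × ℝ => k z.1 * conj (k z.2)) (volume.prod volume) :=
    hk.mul_prod (((Complex.conjLIE : ℂ ≃ₗᵢ[ℝ] ℂ).toContinuousLinearEquiv : ℂ →L[ℝ] ℂ).integrable_comp hk)
  have hbig : Integrable (fun w : ℝ × (ℝ × ℝ) =>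
      (e w.2.1 w.1 * conj (e w.2.2 w.1)) * (W w.1 * (k w.2.1 * conj (k w.2.2))))
      ((volume.restrict A).prod (volume.prod volume)) := by
    refine (hWint.mul_prod hkk).bdd_mul (c := 1) ?_ (Eventually.of_forall fun w => ?_)
    · refine Measurable.aestronglyMeasurable ?_
      refine (hem.comp (by fun_prop : Measurable fun w : ℝ × (ℝ × ℝ) => (w.2.1, w.1))).mul ?_
      exact Complex.continuous_conj.measurable.comp
        (hem.comp (by fun_prop : Measurable fun w : ℝ × (ℝ × ℝ) => (w.2.2, w.1)))
    · rw [norm_mul, RCLike.norm_conj, hen, hen, mul_one]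
  have hKint : Integrable (fun ξ => W ξ * (K ξ * conj (K ξ))) (volume.restrict A) := by
    refine hbig.integral_prod_left.congr (Eventually.of_forall fun ξ => ?_)
    simp only
    rw [hKK, ← integral_const_mul]
    congr 1; ext z
    rw [map_mul]; ring
  have step1 : ∫⁻ ξ in A, ‖((|ξ| ^ (1 / 4 : ℝ) : ℝ) : ℂ) * K ξ‖ₑ ^ 2 =
      ‖∫ ξ in A, W ξ * (K ξ * conj (K ξ))‖ₑ := by
    simp_rw [hsq]
    simp_rw [hpos] at hKint ⊢
    rw [integral_complex_ofReal, ← ofReal_norm, Complex.norm_real,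
      Real.norm_of_nonneg (integral_nonneg fun ξ => by positivity),
      ofReal_integral_eq_lintegral_ofReal (by simpa only [RCLike.re_eq_complex_re, Complex.ofReal_re] using hKint.re)
        (Eventually.of_forall fun ξ => by positivity)]
    refine lintegral_congr fun ξ => ?_
    rw [← ofReal_norm, Complex.norm_real, Real.norm_of_nonneg (by positivity)]
  have step2 : ∫ ξ in A, W ξ * (K ξ * conj (K ξ)) =
      ∫ z : ℝ × ℝ, (k z.1 * conj (k z.2)) *
        (∫ ξ in A, W ξ * Complex.exp
          (Complex.I * ((z.1 - z.2) * ξ ^ 3 + (X z.1 - X z.2) * ξ : ℝ))) ∂(volume.prod volume) := by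
    have := integral_integral_swap (f := fun ξ (z : ℝ × ℝ) =>
      (e z.1 ξ * conj (e z.2 ξ)) * (W ξ * (k z.1 * conj (k z.2)))) hbig
    convert this using 1
    · congr 1; ext ξ
      rw [hKK, ← integral_const_mul]
      congr 1; ext z
      rw [map_mul]; ring
    · congr 1; ext z
      rw [← integral_const_mul]
      congr 1; ext ξ
      have : e z.1 ξ * conj (e z.2 ξ) = Complex.exp
          (Complex.I * ((z.1 - z.2) * ξ ^ 3 + (X z.1 - X z.2) * ξ : ℝ)) := by
        simp only [he]
        rw [← Complex.exp_conj, map_mul, Complex.conj_I, Complex.conj_ofReal, ← Complex.exp_add]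
        congr 1
        push_cast; ring
      rw [this]; ring
  rw [step1, step2]
  refine (enorm_integral_le_lintegral_enorm _).trans ?_
  have hmk : Measurable fun t => ‖k t‖ₑ := hkm.enorm
  have hfin : ∀ t, ‖k t‖ₑ ≠ ∞ := fun t => enorm_ne_top
  have hls := hardyLittlewoodSobolev_half hmk hfin
  have hmeas : Measurable fun z : ℝ × ℝ =>
      8 * (‖k z.1‖ₑ * ‖k z.2‖ₑ * ENNReal.ofReal (|z.2 - z.1| ^ (-(1 / 2) : ℝ))) := by
    have h1 : Measurable fun z : ℝ × ℝ => ‖k z.1‖ₑ := hmk.comp measurable_fst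
    have h2 : Measurable fun z : ℝ × ℝ => ‖k z.2‖ₑ := hmk.comp measurable_snd
    fun_prop
  calc _ ≤ ∫⁻ z : ℝ × ℝ, 8 * (‖k z.1‖ₑ * ‖k z.2‖ₑ *
          ENNReal.ofReal (|z.2 - z.1| ^ (-(1 / 2) : ℝ))) ∂(volume.prod volume) := by
        refine lintegral_mono_ae ?_
        -- The dispersive bound requires distinct times; the diagonal is a null set.
        have hdiag : ∀ᵐ z : ℝ × ℝ ∂(volume.prod volume), z.1 - z.2 ≠ 0 := by
          refine (Measure.ae_prod_iff_ae_ae ?_).2 ?_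
          · exact (measurableSet_eq_fun (by fun_prop) measurable_const).compl
          · refine Eventually.of_forall fun t => ?_
            have : ∀ᵐ s : ℝ, s ∉ ({t} : Set ℝ) :=
              measure_eq_zero_iff_ae_notMem.1 (by simp)
            filter_upwards [this] with s hs h
            exact hs (by simp; linarith)
        filter_upwards [hdiag] with z hz
        have := norm_setIntegral_annulus_le (X z.1 - X z.2) hz ha hab
        rw [enorm_mul, enorm_mul, ← ofReal_norm (conj _), RCLike.norm_conj, ofReal_norm,
          mul_left_comm]
        gcongr
        rw [← ofReal_norm]
        refine (ENNReal.ofReal_le_ofReal this).trans (le_of_eq ?_)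
        rw [abs_sub_comm, div_eq_mul_inv, ENNReal.ofReal_mul (by norm_num), Real.sqrt_eq_rpow,
          Real.rpow_neg (abs_nonneg _)]
        norm_num
    _ = 8 * ∫⁻ s, ∫⁻ t, ‖k s‖ₑ * ‖k t‖ₑ * ENNReal.ofReal (|t - s| ^ (-(1 / 2) : ℝ)) := by
        rw [lintegral_prod _ hmeas.aemeasurable, ← lintegral_const_mul' _ _ (by norm_num)]
        refine lintegral_congr fun s => ?_
        rw [lintegral_const_mul' _ _ (by norm_num)]
    _ ≤ 8 * (12 * (∫⁻ t, ‖k t‖ₑ ^ (4 / 3 : ℝ)) ^ (3 / 2 : ℝ)) := by gcongr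
    _ = _ := by rw [← mul_assoc]; norm_num

/-- Fubini moves the time integral to the frequency side, exhibiting the adjoint of evaluation along
the curve. -/
lemma integral_mul_invFT_along_curve {f k : ℝ → ℂ} (hf : IsAnnular f) (hk : Integrable k)
    {X : ℝ → ℝ} (hX : Measurable X) :
    ∫ t, k t * invFT (fun ξ => airySymbol (1 / 4) t ξ * f ξ) (X t) =
      ((Real.sqrt (2 * Real.pi) : ℝ) : ℂ)⁻¹ * ∫ ξ, f ξ * (((|ξ| ^ (1 / 4 : ℝ) : ℝ) : ℂ) *
        ∫ t, k t * Complex.exp (Complex.I * (t * ξ ^ 3 + X t * ξ : ℝ))) := by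
  have hw : Integrable fun ξ => f ξ * ((|ξ| ^ (1 / 4 : ℝ) : ℝ) : ℂ) := by
    refine (hf.airySymbol_mul (1 / 4) 0).integrable.congr (Eventually.of_forall fun ξ => ?_)
    simp [airySymbol, mul_comm]
  have hint : Integrable (fun z : ℝ × ℝ =>
      Complex.exp (Complex.I * (z.1 * z.2 ^ 3 + X z.1 * z.2 : ℝ)) *
        (k z.1 * (f z.2 * ((|z.2| ^ (1 / 4 : ℝ) : ℝ) : ℂ)))) (volume.prod volume) := by
    refine (hk.mul_prod hw).bdd_mul (c := 1) ?_ (Eventually.of_forall fun z => ?_)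
    · exact Measurable.aestronglyMeasurable (by fun_prop)
    · rw [mul_comm, Complex.norm_exp_ofReal_mul_I]
  have e1 : ∀ t, k t * invFT (fun ξ => airySymbol (1 / 4) t ξ * f ξ) (X t) =
      ((Real.sqrt (2 * Real.pi) : ℝ) : ℂ)⁻¹ * ∫ ξ : ℝ,
        Complex.exp (Complex.I * (t * ξ ^ 3 + X t * ξ : ℝ)) *
        (k t * (f ξ * ((|ξ| ^ (1 / 4 : ℝ) : ℝ) : ℂ))) := by
    intro t
    rw [invFT, mul_left_comm, ← integral_const_mul]
    congr 2; ext ξ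
    rw [airySymbol, show Complex.I * ((t * ξ ^ 3 + X t * ξ : ℝ) : ℂ) =
      Complex.I * t * ξ ^ 3 + Complex.I * ξ * X t by push_cast; ring, Complex.exp_add]
    ring
  have e2 : ∀ ξ, f ξ * (((|ξ| ^ (1 / 4 : ℝ) : ℝ) : ℂ) *
        ∫ t, k t * Complex.exp (Complex.I * (t * ξ ^ 3 + X t * ξ : ℝ))) =
      ∫ t : ℝ, Complex.exp (Complex.I * (t * ξ ^ 3 + X t * ξ : ℝ)) *
        (k t * (f ξ * ((|ξ| ^ (1 / 4 : ℝ) : ℝ) : ℂ))) := by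
    intro ξ
    rw [← mul_assoc, ← integral_const_mul]
    congr 1; ext t; ring
  simp_rw [e1, e2, integral_const_mul]
  congr 1
  exact integral_integral_swap hint

/-- After passing to the adjoint, this is Cauchy–Schwarz in frequency against the dual estimate. -/
lemma enorm_integral_mul_invFT_along_curve_le {f k : ℝ → ℂ} (hf : IsAnnular f)
    (hk : Integrable k) (hkm : Measurable k) {X : ℝ → ℝ} (hX : Measurable X) :
    ‖∫ t, k t * invFT (fun ξ => airySymbol (1 / 4) t ξ * f ξ) (X t)‖ₑ ≤
      (∫⁻ ξ, ‖f ξ‖ₑ ^ 2) ^ (1 / 2 : ℝ) *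
        (96 * (∫⁻ t, ‖k t‖ₑ ^ (4 / 3 : ℝ)) ^ (3 / 2 : ℝ)) ^ (1 / 2 : ℝ) := by
  obtain ⟨a, b, ha, hab, hs⟩ := hf.support
  -- The annulus of the dual estimate is open at its inner radius, while f may live on |ξ| = a;
  -- halving a absorbs this.
  have hdual := lintegral_dual_sq_le hk hkm hX (half_pos ha) (by linarith : a / 2 ≤ b)
  set A : Set ℝ := {ξ : ℝ | a / 2 < |ξ| ∧ |ξ| ≤ b} with hA
  have hAm : MeasurableSet A :=
    (measurableSet_lt measurable_const continuous_abs.measurable).inter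
      (measurableSet_le continuous_abs.measurable measurable_const)
  rw [integral_mul_invFT_along_curve hf hk hX]
  set L : ℝ → ℂ := fun ξ => ((|ξ| ^ (1 / 4 : ℝ) : ℝ) : ℂ) *
        ∫ t, k t * Complex.exp (Complex.I * (t * ξ ^ 3 + X t * ξ : ℝ)) with hL
  have hLm : Measurable L := by
    have h : StronglyMeasurable (Function.uncurry fun (ξ : ℝ) (t : ℝ) =>
        k t * Complex.exp (Complex.I * (t * ξ ^ 3 + X t * ξ : ℝ))) :=
      Measurable.stronglyMeasurable (by simp only [Function.uncurry_def]; fun_prop)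
    have h' := (h.integral_prod_right (ν := volume)).measurable
    fun_prop
  have hone : ‖((Real.sqrt (2 * Real.pi) : ℝ) : ℂ)⁻¹‖ₑ ≤ 1 := by
    rw [← ofReal_norm]
    exact ENNReal.ofReal_le_one.2 norm_inv_sqrt_two_pi_le
  calc _ ≤ 1 * ‖∫ ξ, f ξ * L ξ‖ₑ := by rw [enorm_mul]; gcongr
    _ ≤ ∫⁻ ξ, ‖f ξ * L ξ‖ₑ := by rw [one_mul]; exact enorm_integral_le_lintegral_enorm _
    _ = ∫⁻ ξ in A, ‖f ξ‖ₑ * ‖L ξ‖ₑ := by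
        rw [← lintegral_indicator hAm]
        refine lintegral_congr fun ξ => ?_
        by_cases h : f ξ = 0
        · simp [Set.indicator, h]
        · rw [Set.indicator_of_mem, enorm_mul]
          exact ⟨by linarith [(hs ξ h).1], (hs ξ h).2⟩
    _ ≤ (∫⁻ ξ in A, ‖f ξ‖ₑ ^ (2 : ℝ)) ^ (1 / 2 : ℝ) *
          (∫⁻ ξ in A, ‖L ξ‖ₑ ^ (2 : ℝ)) ^ (1 / 2 : ℝ) := by
        exact ENNReal.lintegral_mul_le_Lp_mul_Lq (volume.restrict A)
          ((Real.holderConjugate_iff).2 (by norm_num)) hf.measurable.enorm.aemeasurable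
          hLm.enorm.aemeasurable
    _ ≤ _ := by
        simp only [ENNReal.rpow_ofNat]
        gcongr
        exact Measure.restrict_le_self

/-- Duality between `L^4` and `L^{4/3}`, in the form produced by the `TT*` method. -/
lemma setLIntegral_pow_four_le_of_duality {g : ℝ → ℂ} (hg : Measurable g) {M : ℝ}
    (hM : ∀ t, ‖g t‖ ≤ M) {C F : ℝ≥0∞}
    (hpair : ∀ k : ℝ → ℂ, Integrable k → Measurable k →
      ‖∫ t, k t * g t‖ₑ ≤ F ^ (1 / 2 : ℝ) *
        (C * (∫⁻ t, ‖k t‖ₑ ^ (4 / 3 : ℝ)) ^ (3 / 2 : ℝ)) ^ (1 / 2 : ℝ)) (T : ℝ) :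
    ∫⁻ t in Set.Icc (-T) T, ‖g t‖ₑ ^ 4 ≤ (C * F) ^ 2 := by
  set S : Set ℝ := Set.Icc (-T) T with hS
  have hSm : MeasurableSet S := measurableSet_Icc
  -- With this extremal test function both the pairing and ∫|k|^{4/3} equal B = ∫_S |g|⁴, so the
  -- hypothesis reads B² ≤ F·C·B^{3/2}. Restricting to the bounded set S makes B finite, so that
  -- B^{3/2} can be divided out.
  set k : ℝ → ℂ := S.indicator fun t => conj (g t) * (‖g t‖ ^ 2 : ℝ) with hk
  have hkm0 : Measurable fun t => conj (g t) * ((‖g t‖ ^ 2 : ℝ) : ℂ) := by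
    have := Complex.continuous_conj.measurable.comp hg
    have h2 : Measurable fun t => ((‖g t‖ ^ 2 : ℝ) : ℂ) :=
      Complex.measurable_ofReal.comp (hg.norm.pow_const 2)
    exact this.mul h2
  have hkm : Measurable k := hkm0.indicator hSm
  have hkn : ∀ t, ‖conj (g t) * ((‖g t‖ ^ 2 : ℝ) : ℂ)‖ = ‖g t‖ ^ 3 := by
    intro t
    rw [norm_mul, RCLike.norm_conj, Complex.norm_real, Real.norm_of_nonneg (by positivity)]
    ring
  have hfinS : volume S ≠ ∞ := by simp [hS]
  have hkint : Integrable k := by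
    rw [hk, integrable_indicator_iff hSm]
    refine Measure.integrableOn_of_bounded (M := M ^ 3) hfinS hkm0.aestronglyMeasurable
      (Eventually.of_forall fun t => ?_)
    rw [hkn]
    gcongr
    exact hM t
  set B := ∫⁻ t in S, ‖g t‖ₑ ^ 4 with hB
  have hB1 : B = ‖∫ t, k t * g t‖ₑ := by
    have e : ∀ t, k t * g t = ((S.indicator (fun t => ‖g t‖ ^ 4) t : ℝ) : ℂ) := by
      intro t
      by_cases h : t ∈ S
      · simp only [hk, Set.indicator_of_mem h]
        rw [mul_right_comm, mul_comm (conj _), Complex.mul_conj, Complex.normSq_eq_norm_sq]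
        push_cast; ring
      · simp only [hk, Set.indicator_of_notMem h]
        simp
    simp_rw [e]
    rw [integral_complex_ofReal, integral_indicator hSm, ← ofReal_norm, Complex.norm_real,
      Real.norm_of_nonneg (integral_nonneg fun ξ => by positivity),
      ofReal_integral_eq_lintegral_ofReal _ (Eventually.of_forall fun ξ => by positivity)]
    · refine lintegral_congr fun t => ?_
      rw [ENNReal.ofReal_pow (norm_nonneg _), ofReal_norm]
    · refine Measure.integrableOn_of_bounded (M := M ^ 4) hfinS
        (hg.norm.pow_const 4).aestronglyMeasurable (Eventually.of_forall fun t => ?_)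
      rw [Real.norm_of_nonneg (by positivity)]
      gcongr
      exact hM t
  have hB2 : ∫⁻ t, ‖k t‖ₑ ^ (4 / 3 : ℝ) = B := by
    rw [hB, ← lintegral_indicator hSm]
    refine lintegral_congr fun t => ?_
    by_cases h : t ∈ S
    · simp only [hk, Set.indicator_of_mem h]
      rw [← ofReal_norm, hkn, ENNReal.ofReal_pow (norm_nonneg _), ofReal_norm,
        ← ENNReal.rpow_natCast, ← ENNReal.rpow_mul, ← ENNReal.rpow_natCast]
      norm_num
    · simp only [hk, Set.indicator_of_notMem h]
      simp
  have hBfin : B ≠ ∞ := by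
    rw [hB1]; exact enorm_ne_top
  rcases eq_or_ne B 0 with hB0 | hB0
  · rw [hB0]; exact zero_le
  have h1 := hpair k hkint hkm
  rw [← hB1, hB2, ← ENNReal.mul_rpow_of_nonneg _ _ (by norm_num : (0 : ℝ) ≤ 1 / 2)] at h1
  have h2 : B ^ (2 : ℝ) ≤ F * (C * B ^ (3 / 2 : ℝ)) := by
    have := ENNReal.rpow_le_rpow h1 (by norm_num : (0 : ℝ) ≤ 2)
    rwa [← ENNReal.rpow_mul, show (1 / 2 * 2 : ℝ) = 1 by norm_num, ENNReal.rpow_one] at this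
  have h3 : B ^ (1 / 2 : ℝ) ≤ C * F := by
    have hne : B ^ (3 / 2 : ℝ) ≠ 0 := by
      exact fun h => hB0 ((ENNReal.rpow_eq_zero_iff_of_pos (by norm_num)).1 h)
    have hnt : B ^ (3 / 2 : ℝ) ≠ ∞ := ENNReal.rpow_ne_top_of_nonneg (by norm_num) hBfin
    rw [← ENNReal.mul_le_mul_iff_left hne hnt]
    calc B ^ (1 / 2 : ℝ) * B ^ (3 / 2 : ℝ) = B ^ (2 : ℝ) := by
          rw [← ENNReal.rpow_add _ _ hB0 hBfin]; norm_num
      _ ≤ _ := h2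
      _ = _ := by ring
  have h4 := ENNReal.rpow_le_rpow h3 (by norm_num : (0 : ℝ) ≤ 2)
  rw [← ENNReal.rpow_mul, show (1 / 2 * 2 : ℝ) = 1 by norm_num, ENNReal.rpow_one,
    ENNReal.rpow_ofNat] at h4
  exact h4

lemma exists_norm_invFT_airySymbol_le (f : ℝ → ℂ) (s : ℝ) :
    ∃ M : ℝ, 0 ≤ M ∧ ∀ t x, ‖invFT (fun ξ => airySymbol s t ξ * f ξ) x‖ ≤ M := by
  refine ⟨∫ ξ, |ξ| ^ s * ‖f ξ‖, integral_nonneg fun ξ => by positivity,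
    fun t x => (norm_invFT_le _ _).trans (le_of_eq ?_)⟩
  congr 1; ext ξ
  rw [norm_mul, norm_airySymbol]

lemma measurable_uncurry_invFT_airySymbol {f : ℝ → ℂ} (hf : Measurable f) (s : ℝ) :
    Measurable (Function.uncurry fun t x => invFT (fun ξ => airySymbol s t ξ * f ξ) x) :=
  measurable_uncurry_invFT ((measurable_airySymbol s).mul (hf.comp measurable_snd))

lemma lintegral_along_curve_le {f : ℝ → ℂ} (hf : IsAnnular f) {X : ℝ → ℝ} (hX : Measurable X)
    (T : ℝ) :
    ∫⁻ t in Set.Icc (-T) T, ‖invFT (fun ξ => airySymbol (1 / 4) t ξ * f ξ) (X t)‖ₑ ^ 4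
      ≤ (96 * ∫⁻ ξ, ‖f ξ‖ₑ ^ 2) ^ 2 := by
  obtain ⟨M, -, hM⟩ := exists_norm_invFT_airySymbol_le f (1 / 4)
  exact setLIntegral_pow_four_le_of_duality
    ((measurable_uncurry_invFT_airySymbol hf.measurable _).comp
      (by fun_prop : Measurable fun t => (t, X t))) (fun t => hM t (X t))
    (fun k hk hkm => enorm_integral_mul_invFT_along_curve_le hf hk hkm hX) T

/-- The endpoint (maximal function) Strichartz estimate `L² → L^4_t L^∞_x` for the Airy flow with
`1/4` derivative. -/
lemma exists_sup_bound_airy {f : ℝ → ℂ} (hf : IsAnnular f) :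
    ∃ S : ℝ → ℝ≥0∞, Measurable S ∧ (∀ t, S t ≠ ∞) ∧
      (∀ t x, ‖invFT (fun ξ => airySymbol (1 / 4) t ξ * f ξ) x‖ₑ ≤ S t) ∧
      ∫⁻ t, S t ^ 4 ≤ 16 * (96 * ∫⁻ ξ, ‖f ξ‖ₑ ^ 2) ^ 2 := by
  obtain ⟨M, -, hM⟩ := exists_norm_invFT_airySymbol_le f (1 / 4)
  have hGm := measurable_uncurry_invFT_airySymbol hf.measurable (1 / 4)
  have hcurve := fun (X : ℝ → ℝ) (hX : Measurable X) (T : ℝ) => lintegral_along_curve_le hf hX T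
  have hGc : ∀ t, Continuous (invFT (fun ξ => airySymbol (1 / 4) t ξ * f ξ)) := fun t =>
    continuous_invFT (hf.airySymbol_mul _ t).integrable
  generalize hG : (fun t x => invFT (fun ξ => airySymbol (1 / 4) t ξ * f ξ) x) = G at *
  have hG' : ∀ t x, invFT (fun ξ => airySymbol (1 / 4) t ξ * f ξ) x = G t x := fun t x => by
    rw [← hG]
  have hG'' : ∀ t, invFT (fun ξ => airySymbol (1 / 4) t ξ * f ξ) = G t := fun t => by
    rw [← hG]
  simp only [hG', hG''] at *
  set d : ℕ → ℝ := TopologicalSpace.denseSeq ℝ with hd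
  have hGn : ∀ n, Measurable fun t => ‖G t (d n)‖ₑ := fun n =>
    (hGm.comp (by fun_prop : Measurable fun t : ℝ => (t, d n))).enorm
  set S : ℝ → ℝ≥0∞ := fun t => ⨆ n, ‖G t (d n)‖ₑ with hS
  have hSm : Measurable S := Measurable.iSup hGn
  have hSfin : ∀ t, S t ≠ ∞ := by
    intro t
    refine ((iSup_le fun n => ?_ : S t ≤ ENNReal.ofReal M).trans_lt ENNReal.ofReal_lt_top).ne
    rw [← ofReal_norm]
    exact ENNReal.ofReal_le_ofReal (hM t _)
  refine ⟨S, hSm, hSfin, fun t x => ?_, ?_⟩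
  · have hcl : IsClosed {x | ‖G t x‖ₑ ≤ S t} :=
      isClosed_le (hGc t).enorm continuous_const
    have : Set.range d ⊆ {x | ‖G t x‖ₑ ≤ S t} := by
      rintro _ ⟨n, rfl⟩
      exact le_iSup (fun n => ‖G t (d n)‖ₑ) n
    have h2 := hcl.closure_subset_iff.2 this
    rw [(TopologicalSpace.denseRange_denseSeq ℝ).closure_range] at h2
    exact h2 (Set.mem_univ x)
  -- The sup over x is a sup over a dense sequence. Choosing at each t the first index that attains
  -- half of it gives a measurable curve; the loss of 2 becomes 16 = 2⁴.
  · have hex : ∀ t, ∃ n, S t ≤ 2 * ‖G t (d n)‖ₑ := by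
      intro t
      rcases eq_or_ne (S t) 0 with h0 | h0
      · exact ⟨0, by rw [h0]; exact zero_le⟩
      obtain ⟨n, hn⟩ := lt_iSup_iff.1 (ENNReal.half_lt_self h0 (hSfin t))
      refine ⟨n, ?_⟩
      rw [mul_comm, ← ENNReal.div_le_iff (by norm_num) (by norm_num)]
      exact hn.le
    classical
    have hNm : Measurable fun t => Nat.find (hex t) :=
      measurable_find hex fun n => measurableSet_le hSm ((hGn n).const_mul 2)
    set X : ℝ → ℝ := fun t => d (Nat.find (hex t)) with hX
    have hXm : Measurable X := (measurable_from_nat (f := d)).comp hNm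
    -- The curve estimate does not depend on the time window, so exhausting the line removes the
    -- truncation.
    have hcov : AECover (volume : Measure ℝ) atTop fun n : ℕ => Set.Icc (-(n : ℝ)) n :=
      aecover_Icc (tendsto_neg_atTop_atBot.comp tendsto_natCast_atTop_atTop)
        tendsto_natCast_atTop_atTop
    rw [← hcov.iSup_lintegral_eq_of_countably_generated (hSm.pow_const 4).aemeasurable]
    refine iSup_le fun n => ?_
    calc ∫⁻ t in Set.Icc (-(n : ℝ)) n, S t ^ 4
        ≤ ∫⁻ t in Set.Icc (-(n : ℝ)) n, 16 * ‖G t (X t)‖ₑ ^ 4 := by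
          refine lintegral_mono fun t => ?_
          have := pow_le_pow_left' (Nat.find_spec (hex t)) 4
          refine this.trans (le_of_eq ?_)
          rw [mul_pow]; norm_num [hX]
      _ = 16 * ∫⁻ t in Set.Icc (-(n : ℝ)) n, ‖G t (X t)‖ₑ ^ 4 :=
          lintegral_const_mul' _ _ (by norm_num)
      _ ≤ _ := by
          gcongr
          exact hcurve X hXm n

/-! ### A Gagliardo–Nirenberg inequality by heat-flow truncation -/

/-- The multiplier e^{-rξ²} averages translates of the function against a Gaussian of total mass 1,
so it contracts the sup norm. -/
lemma norm_invFT_gaussian_mul_le {k : ℝ → ℂ} (hk : Integrable k) {N : ℝ}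
    (hN : ∀ x, ‖invFT k x‖ ≤ N) {r : ℝ} (hr : 0 < r) (x : ℝ) :
    ‖invFT (fun ξ => (Real.exp (-(ξ ^ 2 * r)) : ℂ) * k ξ) x‖ ≤ N := by
  set b : ℝ := 1 / (4 * r) with hb
  have hb0 : 0 < b := by positivity
  have hgi : Integrable fun y : ℝ => (Real.exp (-b * y ^ 2) : ℂ) :=
    (integrable_exp_neg_mul_sq hb0).ofReal
  have hgauss : ∀ ξ : ℝ, (Real.exp (-(ξ ^ 2 * r)) : ℂ) =
      ((Real.sqrt (Real.pi / b) : ℝ) : ℂ)⁻¹ *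
        ∫ y : ℝ, Complex.exp (Complex.I * ξ * y) * (Real.exp (-b * y ^ 2) : ℂ) := by
    intro ξ
    have h1 := fourierIntegral_gaussian (b := (b : ℂ)) (by simpa using hb0) (ξ : ℂ)
    have h2 : ((Real.pi : ℂ) / b) ^ (1 / 2 : ℂ) = ((Real.sqrt (Real.pi / b) : ℝ) : ℂ) := by
      rw [Real.sqrt_eq_rpow, Complex.ofReal_cpow (by positivity)]
      push_cast; rfl
    have h3 : ((Real.sqrt (Real.pi / b) : ℝ) : ℂ) ≠ 0 := by
      have : Real.sqrt (Real.pi / b) ≠ 0 := by positivity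
      exact_mod_cast this
    have h4 : ∫ y : ℝ, Complex.exp (Complex.I * ξ * y) * (Real.exp (-b * y ^ 2) : ℂ) =
        ∫ y : ℝ, Complex.exp (Complex.I * ξ * y) * Complex.exp (-b * y ^ 2) := by
      congr 1; ext y; push_cast; rfl
    rw [h4, h1, h2, inv_mul_cancel_left₀ h3]
    push_cast
    congr 1
    rw [hb]
    push_cast
    have : (r : ℂ) ≠ 0 := by exact_mod_cast hr.ne'
    field_simp
  have hint : Integrable (fun z : ℝ × ℝ => Complex.exp (Complex.I * z.1 * (x + z.2 : ℝ)) *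
      (k z.1 * (Real.exp (-b * z.2 ^ 2) : ℂ))) (volume.prod volume) := by
    refine (hk.mul_prod hgi).bdd_mul (c := 1) (by fun_prop) (Eventually.of_forall fun z => ?_)
    rw [norm_exp_I_mul_mul]
  have key : invFT (fun ξ => (Real.exp (-(ξ ^ 2 * r)) : ℂ) * k ξ) x =
      ((Real.sqrt (Real.pi / b) : ℝ) : ℂ)⁻¹ *
        ∫ y : ℝ, (Real.exp (-b * y ^ 2) : ℂ) * invFT k (x + y) := by
    have e1 : ∀ ξ : ℝ, Complex.exp (Complex.I * ξ * x) * ((Real.exp (-(ξ ^ 2 * r)) : ℂ) * k ξ) =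
        ((Real.sqrt (Real.pi / b) : ℝ) : ℂ)⁻¹ * ∫ y : ℝ,
          Complex.exp (Complex.I * ξ * (x + y : ℝ)) * (k ξ * (Real.exp (-b * y ^ 2) : ℂ)) := by
      intro ξ
      have hring : ∀ E c J l : ℂ, E * ((c * J) * l) = c * ((E * l) * J) := by intros; ring
      rw [hgauss, hring, ← integral_const_mul]
      congr 2; ext y
      rw [show Complex.I * ξ * ((x + y : ℝ) : ℂ) = Complex.I * ξ * x + Complex.I * ξ * y by
        push_cast; ring, Complex.exp_add]
      ring
    have e2 : ∀ y : ℝ, (Real.exp (-b * y ^ 2) : ℂ) * invFT k (x + y) =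
        ((Real.sqrt (2 * Real.pi) : ℝ) : ℂ)⁻¹ * ∫ ξ : ℝ,
          Complex.exp (Complex.I * ξ * (x + y : ℝ)) * (k ξ * (Real.exp (-b * y ^ 2) : ℂ)) := by
      intro y
      rw [invFT, mul_left_comm, ← integral_const_mul]
      congr 2; ext ξ; ring
    rw [invFT]
    simp_rw [e1, e2, integral_const_mul]
    rw [integral_integral_swap hint]
    ring
  rw [key, norm_mul, norm_inv, Complex.norm_real, Real.norm_of_nonneg (Real.sqrt_nonneg _)]
  have hs0 : 0 < Real.sqrt (Real.pi / b) := by positivity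
  rw [inv_mul_le_iff₀ hs0, ← integral_gaussian b, ← integral_mul_const]
  refine norm_integral_le_of_norm_le ((integrable_exp_neg_mul_sq hb0).mul_const N)
    (Eventually.of_forall fun y => ?_)
  rw [norm_mul, Complex.norm_real, Real.norm_of_nonneg (Real.exp_nonneg _)]
  gcongr
  exact hN _

/-- The part `r ≤ R` of the multiplier `∫_0^∞ r^{s-1} e^{-rξ²} dr`. -/
def highMult (s R ξ : ℝ) : ℝ := ∫ r in Set.Ioc 0 R, r ^ (s - 1) * Real.exp (-(ξ ^ 2 * r))

/-- The part `r > R` of the multiplier `∫_0^∞ r^{s-1} e^{-rξ²} dr`. -/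
def lowMult (s R ξ : ℝ) : ℝ := ∫ r in Set.Ioi R, r ^ (s - 1) * Real.exp (-(ξ ^ 2 * r))

lemma integrableOn_rpow_mul_exp {s : ℝ} (hs : 0 < s) {ξ : ℝ} (hξ : ξ ≠ 0) :
    IntegrableOn (fun r : ℝ => r ^ (s - 1) * Real.exp (-(ξ ^ 2 * r))) (Set.Ioi 0) := by
  have := integrableOn_rpow_mul_exp_neg_mul_rpow (p := 1) (s := s - 1) (b := ξ ^ 2) (by linarith)
    one_pos (by positivity)
  simpa using this

/-- This is the Gamma integral ∫₀^∞ r^{s-1}e^{-rξ²} dr. It writes fractional integration as a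
superposition of heat operators: small r is controlled in sup norm, large r in `L²`. -/
lemma highMult_add_lowMult {s : ℝ} (hs : 0 < s) {R ξ : ℝ} (hR : 0 ≤ R) (hξ : ξ ≠ 0) :
    highMult s R ξ + lowMult s R ξ = |ξ| ^ (-(2 * s)) * Real.Gamma s := by
  have hi := integrableOn_rpow_mul_exp hs hξ
  rw [highMult, lowMult, ← setIntegral_union (Set.Ioc_disjoint_Ioi le_rfl) measurableSet_Ioi
    (hi.mono_set Set.Ioc_subset_Ioi_self) (hi.mono_set (Set.Ioi_subset_Ioi hR)),
    Set.Ioc_union_Ioi_eq_Ioi hR, Real.integral_rpow_mul_exp_neg_mul_Ioi hs (by positivity)]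
  congr 1
  rw [← sq_abs, one_div, Real.inv_rpow (by positivity), ← Real.rpow_natCast,
    ← Real.rpow_mul (abs_nonneg _), ← Real.rpow_neg (abs_nonneg _)]
  norm_num

lemma highMult_nonneg (s R ξ : ℝ) : 0 ≤ highMult s R ξ :=
  setIntegral_nonneg measurableSet_Ioc fun _ hr =>
    mul_nonneg (Real.rpow_nonneg hr.1.le _) (Real.exp_nonneg _)

lemma lowMult_nonneg (s : ℝ) {R : ℝ} (hR : 0 ≤ R) (ξ : ℝ) : 0 ≤ lowMult s R ξ :=
  setIntegral_nonneg measurableSet_Ioi fun _ hr =>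
    mul_nonneg (Real.rpow_nonneg (hR.trans (le_of_lt hr)) _) (Real.exp_nonneg _)

lemma measurable_uncurry_lowMult (s : ℝ) : Measurable (Function.uncurry (lowMult s)) := by
  have h : StronglyMeasurable (Function.uncurry fun (z : ℝ × ℝ) (r : ℝ) =>
      if z.1 < r then r ^ (s - 1) * Real.exp (-(z.2 ^ 2 * r)) else 0) := by
    refine Measurable.stronglyMeasurable ?_
    refine Measurable.ite (measurableSet_lt ?_ ?_) ?_ measurable_const <;> fun_prop
  have h2 := (h.integral_prod_right (ν := volume)).measurable
  convert h2 using 1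
  ext ⟨R, ξ⟩
  simp only [Function.uncurry, lowMult]
  rw [← integral_indicator measurableSet_Ioi]
  rfl

lemma lowMult_le {s : ℝ} (hs : 0 < s) {R ξ : ℝ} (hR : 0 ≤ R) (hξ : ξ ≠ 0) :
    lowMult s R ξ ≤ |ξ| ^ (-(2 * s)) * Real.Gamma s := by
  rw [← highMult_add_lowMult hs hR hξ]
  linarith [highMult_nonneg s R ξ]

lemma lowMult_le_of_lt {s j : ℝ} (hs : 0 < s) (hj : s < j) {R ξ : ℝ} (hR : 0 < R) (hξ : ξ ≠ 0) :
    lowMult s R ξ ≤ j ^ j / (j - s) * (|ξ| ^ (-(2 * j)) * R ^ (s - j)) := by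
  have hj0 : 0 < j := hs.trans hj
  -- Raise u/j ≤ e^{u/j} to the power j and invert.
  have hexp : ∀ u : ℝ, 0 < u → Real.exp (-u) ≤ j ^ j * u ^ (-j) := by
    intro u hu
    have h1 : u / j ≤ Real.exp (u / j) := by linarith [Real.add_one_le_exp (u / j)]
    have h2 := Real.rpow_le_rpow (by positivity) h1 hj0.le
    rw [← Real.exp_mul, div_mul_cancel₀ _ hj0.ne', Real.div_rpow hu.le hj0.le] at h2
    rw [Real.exp_neg, Real.rpow_neg hu.le, ← div_eq_mul_inv, inv_le_comm₀ (Real.exp_pos _)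
      (by positivity), inv_div]
    exact h2
  have hI : IntegrableOn (fun r : ℝ => j ^ j * |ξ| ^ (-(2 * j)) * r ^ (s - 1 - j)) (Set.Ioi R) :=
    (integrableOn_Ioi_rpow_of_lt (by linarith) hR).const_mul _
  calc lowMult s R ξ ≤ ∫ r in Set.Ioi R, j ^ j * |ξ| ^ (-(2 * j)) * r ^ (s - 1 - j) := by
        refine setIntegral_mono_on ((integrableOn_rpow_mul_exp hs hξ).mono_set
          (Set.Ioi_subset_Ioi hR.le)) hI measurableSet_Ioi fun r hr => ?_
        have hr0 : 0 < r := hR.trans hr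
        have h1 := hexp (ξ ^ 2 * r) (by positivity)
        have h2 : (ξ ^ 2 * r) ^ (-j) = |ξ| ^ (-(2 * j)) * r ^ (-j) := by
          rw [Real.mul_rpow (by positivity) hr0.le, ← sq_abs, ← Real.rpow_natCast,
            ← Real.rpow_mul (abs_nonneg _)]
          norm_num
        calc r ^ (s - 1) * Real.exp (-(ξ ^ 2 * r))
            ≤ r ^ (s - 1) * (j ^ j * (ξ ^ 2 * r) ^ (-j)) := by gcongr
          _ = _ := by
            rw [h2, show s - 1 - j = (s - 1) + (-j) by ring, Real.rpow_add hr0]; ring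
    _ = j ^ j / (j - s) * (|ξ| ^ (-(2 * j)) * R ^ (s - j)) := by
        rw [integral_const_mul, integral_Ioi_rpow_of_lt (by linarith) hR,
          show s - 1 - j + 1 = s - j by ring]
        have : j - s ≠ 0 := by linarith
        have : s - j ≠ 0 := by intro h; apply this; linarith
        field_simp
        ring

/-- Each heat operator contracts the sup norm, and the weight r^{s-1} has mass R^s/s on (0, R]. -/
lemma norm_invFT_highMult_mul_le {k : ℝ → ℂ} (hk : Integrable k) {N : ℝ}
    (hN : ∀ x, ‖invFT k x‖ ≤ N) {s : ℝ} (hs : 0 < s) {R : ℝ} (hR : 0 < R) (x : ℝ) :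
    ‖invFT (fun ξ => (highMult s R ξ : ℂ) * k ξ) x‖ ≤ N * (R ^ s / s) := by
  have hri : IntegrableOn (fun r : ℝ => r ^ (s - 1)) (Set.Ioc 0 R) := by
    rw [integrableOn_Ioc_iff_integrableOn_Ioo]
    exact (intervalIntegral.integrableOn_Ioo_rpow_iff hR).2 (by linarith)
  have hri' : Integrable (fun r : ℝ => ((r ^ (s - 1) : ℝ) : ℂ)) (volume.restrict (Set.Ioc 0 R)) :=
    hri.ofReal
  -- The cutoff 0 < r changes nothing on the domain of integration, but makes the oscillating factor
  -- bounded by 1 everywhere.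
  have hint : Integrable (fun z : ℝ × ℝ => (Complex.exp (Complex.I * z.1 * x) *
      ((if 0 < z.2 then Real.exp (-(z.1 ^ 2 * z.2)) else 0 : ℝ) : ℂ)) *
        (k z.1 * ((z.2 ^ (s - 1) : ℝ) : ℂ)))
      (volume.prod (volume.restrict (Set.Ioc 0 R))) := by
    refine (hk.mul_prod hri').bdd_mul (c := 1) ?_ (Eventually.of_forall fun z => ?_)
    · refine Measurable.aestronglyMeasurable (Measurable.mul (by fun_prop) ?_)
      refine Complex.measurable_ofReal.comp (Measurable.ite (measurableSet_lt ?_ ?_) ?_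
        measurable_const) <;> fun_prop
    · rw [norm_mul, norm_exp_I_mul_mul, one_mul, Complex.norm_real]
      split_ifs with h
      · rw [Real.norm_of_nonneg (Real.exp_nonneg _), Real.exp_le_one_iff]
        have := sq_nonneg z.1
        nlinarith
      · simp
  have key : invFT (fun ξ => (highMult s R ξ : ℂ) * k ξ) x =
      ∫ r in Set.Ioc 0 R, ((r ^ (s - 1) : ℝ) : ℂ) *
        invFT (fun ξ => (Real.exp (-(ξ ^ 2 * r)) : ℂ) * k ξ) x := by
    have e1 : ∀ ξ : ℝ, Complex.exp (Complex.I * ξ * x) * ((highMult s R ξ : ℂ) * k ξ) =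
        ∫ r in Set.Ioc 0 R, (Complex.exp (Complex.I * ξ * x) *
          ((if 0 < r then Real.exp (-(ξ ^ 2 * r)) else 0 : ℝ) : ℂ)) *
            (k ξ * ((r ^ (s - 1) : ℝ) : ℂ)) := by
      intro ξ
      rw [highMult, ← integral_complex_ofReal, ← integral_mul_const, ← integral_const_mul]
      refine setIntegral_congr_fun measurableSet_Ioc fun r hr => ?_
      simp only [if_pos hr.1]
      push_cast; ring
    have e2 : ∀ r ∈ Set.Ioc 0 R, ((r ^ (s - 1) : ℝ) : ℂ) *
        invFT (fun ξ => (Real.exp (-(ξ ^ 2 * r)) : ℂ) * k ξ) x =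
        ((Real.sqrt (2 * Real.pi) : ℝ) : ℂ)⁻¹ * ∫ ξ : ℝ, (Complex.exp (Complex.I * ξ * x) *
          ((if 0 < r then Real.exp (-(ξ ^ 2 * r)) else 0 : ℝ) : ℂ)) *
            (k ξ * ((r ^ (s - 1) : ℝ) : ℂ)) := by
      intro r hr
      rw [invFT, mul_left_comm, ← integral_const_mul]
      congr 2; ext ξ
      rw [if_pos hr.1]; ring
    rw [setIntegral_congr_fun measurableSet_Ioc e2, integral_const_mul, invFT]
    simp_rw [e1]
    rw [integral_integral_swap hint]
  have hval : ∫ r in Set.Ioc 0 R, r ^ (s - 1) * N = N * (R ^ s / s) := by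
    rw [integral_mul_const, ← intervalIntegral.integral_of_le hR.le,
      integral_rpow (Or.inl (by linarith)), sub_add_cancel, Real.zero_rpow hs.ne', sub_zero,
      mul_comm]
  rw [key, ← hval]
  refine norm_integral_le_of_norm_le (hri.mul_const N) ?_
  filter_upwards [ae_restrict_mem measurableSet_Ioc] with r hr
  rw [norm_mul, Complex.norm_real, Real.norm_of_nonneg (Real.rpow_nonneg hr.1.le _)]
  exact mul_le_mul_of_nonneg_left (norm_invFT_gaussian_mul_le hk hN hr.1 x)
    (Real.rpow_nonneg hr.1.le _)

/-- The level-set integral of the low-frequency multiplier. -/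
lemma exists_setLIntegral_lowMult_sq_le {q s c : ℝ} (hq : 2 < q) (hs : 0 < s) (hc : 0 < c) :
    ∃ C : ℝ, 0 ≤ C ∧ ∀ N : ℝ, 0 < N → ∀ ξ : ℝ, ξ ≠ 0 →
      ∫⁻ l in Set.Ioi (0 : ℝ), ENNReal.ofReal (l ^ (q - 3)) *
        ENNReal.ofReal (lowMult s ((c * l / N) ^ (1 / s)) ξ ^ 2)
      ≤ ENNReal.ofReal (C * (N ^ (q - 2) * |ξ| ^ (-(2 * s * q)))) := by
  -- With this j the cutoff raised to the power s − j is (cl/N)^{-q}. The squared low multiplier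
  -- then decays like l^{-2q}, and l^{q-3-2q} is integrable at infinity.
  set j := s * (q + 1) with hj
  have hj0 : 0 < j := by positivity
  have hsj : s < j := by rw [hj]; nlinarith
  have hsj' : 0 < j - s := by linarith
  set D := j ^ j / (j - s) * c ^ (-q) with hD
  have hD0 : 0 ≤ D := by positivity
  have hΓ : 0 < Real.Gamma s := Real.Gamma_pos_of_pos hs
  refine ⟨Real.Gamma s ^ 2 / (q - 2) + D ^ 2 / (q + 2), ?_, fun N hN ξ hξ => ?_⟩
  · have : 0 < q - 2 := by linarith
    positivity
  have hξ0 : 0 < |ξ| := abs_pos.2 hξ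
  set w := |ξ| ^ (-(2 * s)) with hw
  have hw0 : 0 < w := by positivity
  -- Up to constants this is the level at which the trivial bound and the decay bound agree. Below
  -- it only l^{q-3} is integrated, which converges at 0 since q > 2.
  set a := N * w with ha
  have ha0 : 0 < a := by positivity
  have hR : ∀ l : ℝ, 0 < l → 0 < (c * l / N) ^ (1 / s) := fun l hl => by positivity
  have near : ∫⁻ l in Set.Ioo 0 a, ENNReal.ofReal (l ^ (q - 3)) *
        ENNReal.ofReal (lowMult s ((c * l / N) ^ (1 / s)) ξ ^ 2) ≤
      ENNReal.ofReal ((w * Real.Gamma s) ^ 2 * (a ^ (q - 2) / (q - 2))) := by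
    calc _ ≤ ∫⁻ l in Set.Ioo 0 a, ENNReal.ofReal ((w * Real.Gamma s) ^ 2) *
          ENNReal.ofReal (l ^ (q - 3)) := by
          refine setLIntegral_mono' measurableSet_Ioo fun l hl => ?_
          rw [mul_comm]
          gcongr
          · exact lowMult_nonneg s (hR l hl.1).le ξ
          · exact lowMult_le hs (hR l hl.1).le hξ
      _ = _ := by
          rw [lintegral_const_mul' _ _ ENNReal.ofReal_ne_top,
            setLIntegral_Ioo_rpow (by linarith) ha0, ← ENNReal.ofReal_mul (by positivity),
            show q - 3 + 1 = q - 2 by ring]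
  have far : ∫⁻ l in Set.Ioi a, ENNReal.ofReal (l ^ (q - 3)) *
        ENNReal.ofReal (lowMult s ((c * l / N) ^ (1 / s)) ξ ^ 2) ≤
      ENNReal.ofReal ((D * w * a ^ q) ^ 2 * (a ^ (-q - 2) / (q + 2))) := by
    calc _ ≤ ∫⁻ l in Set.Ioi a, ENNReal.ofReal ((D * w * a ^ q) ^ 2) *
          ENNReal.ofReal (l ^ (-q - 3)) := by
          refine setLIntegral_mono' measurableSet_Ioi fun l hl => ?_
          have hl0 : 0 < l := ha0.trans hl
          rw [← ENNReal.ofReal_mul (by positivity), ← ENNReal.ofReal_mul (by positivity)]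
          apply ENNReal.ofReal_le_ofReal
          have h1 := lowMult_le_of_lt hs hsj (hR l hl0) hξ
          have h2 : ((c * l / N) ^ (1 / s)) ^ (s - j) = c ^ (-q) * l ^ (-q) * N ^ q := by
            rw [← Real.rpow_mul (by positivity), show 1 / s * (s - j) = -q by
              rw [hj]; field_simp; ring, Real.div_rpow (by positivity) hN.le,
              Real.mul_rpow hc.le hl0.le, Real.rpow_neg hN.le, div_inv_eq_mul]
          have h3 : |ξ| ^ (-(2 * j)) = w * w ^ q := by
            rw [hw, ← Real.rpow_mul hξ0.le, ← Real.rpow_add hξ0]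
            congr 1; rw [hj]; ring
          have h4 : a ^ q = N ^ q * w ^ q := by rw [ha, Real.mul_rpow hN.le hw0.le]
          have h5 : lowMult s ((c * l / N) ^ (1 / s)) ξ ≤ D * w * a ^ q * l ^ (-q) := by
            refine h1.trans (le_of_eq ?_)
            rw [h2, h3, h4, hD]; ring
          have h6 := pow_le_pow_left₀ (lowMult_nonneg s (hR l hl0).le ξ) h5 2
          have h7 : l ^ (-q - 3) = l ^ (q - 3) * (l ^ (-q)) ^ 2 := by
            rw [← Real.rpow_natCast, ← Real.rpow_mul hl0.le, ← Real.rpow_add hl0]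
            congr 1; push_cast; ring
          calc _ ≤ l ^ (q - 3) * (D * w * a ^ q * l ^ (-q)) ^ 2 := by gcongr
            _ = _ := by rw [h7]; ring
      _ = _ := by
          rw [lintegral_const_mul' _ _ ENNReal.ofReal_ne_top,
            setLIntegral_Ioi_rpow (by linarith) ha0, ← ENNReal.ofReal_mul (by positivity),
            show -q - 3 + 1 = -q - 2 by ring]
          congr 2
          rw [show -q - 2 = -(q + 2) by ring, neg_div_neg_eq]
  rw [setLIntegral_congr Ioo_ae_eq_Ioc] at near
  rw [← Set.Ioc_union_Ioi_eq_Ioi ha0.le]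
  refine (lintegral_union_le _ _ _).trans ((add_le_add near far).trans ?_)
  have : 0 < q - 2 := by linarith
  rw [← ENNReal.ofReal_add (by positivity) (by positivity)]
  apply ENNReal.ofReal_le_ofReal
  have g1 : a ^ (q - 2) * w ^ 2 = N ^ (q - 2) * |ξ| ^ (-(2 * s * q)) := by
    rw [ha, Real.mul_rpow hN.le hw0.le, mul_assoc, ← Real.rpow_natCast, ← Real.rpow_add hw0, hw,
      ← Real.rpow_mul hξ0.le]
    congr 2; push_cast; ring
  have g2 : (a ^ q) ^ 2 * a ^ (-q - 2) = a ^ (q - 2) := by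
    rw [← Real.rpow_natCast, ← Real.rpow_mul ha0.le, ← Real.rpow_add ha0]
    congr 1; push_cast; ring
  rw [← g1]
  apply le_of_eq
  calc _ = a ^ (q - 2) * w ^ 2 * (Real.Gamma s ^ 2 / (q - 2)) +
        ((a ^ q) ^ 2 * a ^ (-q - 2)) * w ^ 2 * (D ^ 2 / (q + 2)) := by ring
    _ = _ := by rw [g2]; ring

lemma IsAnnular.ne_zero {f : ℝ → ℂ} (hf : IsAnnular f) {ξ : ℝ} (h : f ξ ≠ 0) : ξ ≠ 0 := by
  obtain ⟨a, b, ha, -, hs⟩ := hf.support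
  exact abs_pos.1 (ha.trans_le (hs ξ h).1)

lemma IsAnnular.rpow_mul {f : ℝ → ℂ} (hf : IsAnnular f) (s : ℝ) :
    IsAnnular (fun ξ => ((|ξ| ^ s : ℝ) : ℂ) * f ξ) := by
  refine hf.mul (by fun_prop) fun a b ha => ?_
  obtain ⟨C, hC⟩ := exists_rpow_bound_annulus s b ha
  refine ⟨C, fun ξ h1 h2 => ?_⟩
  rw [Complex.norm_real, Real.norm_of_nonneg (by positivity)]
  exact hC ξ h1 h2

lemma IsAnnular.lowMult_mul {f : ℝ → ℂ} (hf : IsAnnular f) {s : ℝ} (hs : 0 < s) {R : ℝ}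
    (hR : 0 ≤ R) : IsAnnular (fun ξ => (lowMult s R ξ : ℂ) * f ξ) := by
  refine hf.mul (Complex.measurable_ofReal.comp
    ((measurable_uncurry_lowMult s).comp measurable_prodMk_left)) fun a b ha => ?_
  obtain ⟨C, hC⟩ := exists_rpow_bound_annulus (-(2 * s)) b ha
  refine ⟨C * Real.Gamma s, fun ξ h1 h2 => ?_⟩
  rw [Complex.norm_real, Real.norm_of_nonneg (lowMult_nonneg s hR ξ)]
  have hΓ : 0 < Real.Gamma s := Real.Gamma_pos_of_pos hs
  exact (lowMult_le hs hR (abs_pos.1 (ha.trans_le h1))).trans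
    (mul_le_mul_of_nonneg_right (hC ξ h1 h2) hΓ.le)

/-- The cutoff R is chosen so that the high part, after multiplication by Γ(s), is at most Γ(s)l/2
everywhere. On the level set the low part is thus at least Γ(s)l/2, and Chebyshev with Plancherel
gives the bound. -/
lemma volume_lt_norm_invFT_le {k : ℝ → ℂ} (hk : IsAnnular k) {N : ℝ} (hN0 : 0 < N)
    (hN : ∀ x, ‖invFT k x‖ ≤ N) {s : ℝ} (hs : 0 < s) {l : ℝ} (hl : 0 < l) :
    volume {x | l < ‖invFT (fun ξ => ((|ξ| ^ (-(2 * s)) : ℝ) : ℂ) * k ξ) x‖} ≤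
      ENNReal.ofReal (4 / (Real.Gamma s ^ 2 * l ^ 2)) *
        ∫⁻ ξ, ENNReal.ofReal (lowMult s ((s * Real.Gamma s / 2 * l / N) ^ (1 / s)) ξ ^ 2) *
          ‖k ξ‖ₑ ^ 2 := by
  have hΓ : 0 < Real.Gamma s := Real.Gamma_pos_of_pos hs
  set R := (s * Real.Gamma s / 2 * l / N) ^ (1 / s) with hR
  have hR0 : 0 < R := by positivity
  have hRs : R ^ s = s * Real.Gamma s / 2 * l / N := by
    rw [hR, ← Real.rpow_mul (by positivity), one_div_mul_cancel hs.ne', Real.rpow_one]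
  have hlow := hk.lowMult_mul hs hR0.le
  have hpow := hk.rpow_mul (-(2 * s))
  have hsum : ∀ x, (Real.Gamma s : ℂ) * invFT (fun ξ => ((|ξ| ^ (-(2 * s)) : ℝ) : ℂ) * k ξ) x -
      invFT (fun ξ => (lowMult s R ξ : ℂ) * k ξ) x =
      invFT (fun ξ => (highMult s R ξ : ℂ) * k ξ) x := by
    intro x
    have h1 : (Real.Gamma s : ℂ) * invFT (fun ξ => ((|ξ| ^ (-(2 * s)) : ℝ) : ℂ) * k ξ) x =
        invFT (fun ξ => (Real.Gamma s : ℂ) * (((|ξ| ^ (-(2 * s)) : ℝ) : ℂ) * k ξ)) x := by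
      rw [invFT, invFT, mul_left_comm, ← integral_const_mul]
      congr 2; ext ξ; ring
    rw [h1, ← invFT_sub (hpow.integrable.const_mul _) hlow.integrable]
    congr 1; ext ξ
    by_cases h : k ξ = 0
    · simp [h]
    · have := highMult_add_lowMult hs hR0.le (hk.ne_zero h)
      rw [show highMult s R ξ = |ξ| ^ (-(2 * s)) * Real.Gamma s - lowMult s R ξ by linarith]
      push_cast; ring
  have hsub : {x | l < ‖invFT (fun ξ => ((|ξ| ^ (-(2 * s)) : ℝ) : ℂ) * k ξ) x‖} ⊆
      {x | ENNReal.ofReal ((Real.Gamma s * l / 2) ^ 2) ≤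
        ‖invFT (fun ξ => (lowMult s R ξ : ℂ) * k ξ) x‖ₑ ^ 2} := by
    intro x hx
    change l < _ at hx
    have h1 := norm_invFT_highMult_mul_le hk.integrable hN hs hR0 x
    rw [← hsum] at h1
    have h2 := norm_sub_norm_le ((Real.Gamma s : ℂ) *
      invFT (fun ξ => ((|ξ| ^ (-(2 * s)) : ℝ) : ℂ) * k ξ) x)
      (invFT (fun ξ => (lowMult s R ξ : ℂ) * k ξ) x)
    rw [norm_mul, Complex.norm_real, Real.norm_of_nonneg hΓ.le] at h2
    have h3 : N * (R ^ s / s) = Real.Gamma s * l / 2 := by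
      rw [hRs]; field_simp
    have h4 := mul_lt_mul_of_pos_left hx hΓ
    change ENNReal.ofReal ((Real.Gamma s * l / 2) ^ 2) ≤ _
    rw [← ofReal_norm, ← ENNReal.ofReal_pow (norm_nonneg _)]
    apply ENNReal.ofReal_le_ofReal
    exact pow_le_pow_left₀ (by positivity) (by linarith) 2
  refine (measure_mono hsub).trans ?_
  have hε : ENNReal.ofReal ((Real.Gamma s * l / 2) ^ 2) ≠ 0 := by
    rw [Ne, ENNReal.ofReal_eq_zero, not_le]; positivity
  refine (meas_ge_le_lintegral_div
    ((continuous_invFT hlow.integrable).measurable.enorm.pow_const 2).aemeasurable hε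
    ENNReal.ofReal_ne_top).trans (le_of_eq ?_)
  rw [lintegral_invFT_sq hlow.integrable hlow.memLp, ENNReal.div_eq_inv_mul]
  congr 1
  · rw [← ENNReal.ofReal_inv_of_pos (by positivity)]
    congr 1; field_simp; norm_num
  · refine lintegral_congr fun ξ => ?_
    rw [enorm_mul, mul_pow]
    congr 1
    rw [← ofReal_norm, ← ENNReal.ofReal_pow (norm_nonneg _), Complex.norm_real,
      Real.norm_eq_abs, sq_abs]

/-- A Gagliardo–Nirenberg inequality with an `L^∞` and an `L²` endpoint. -/
lemma exists_gagliardoNirenberg {q : ℝ} (hq : 2 < q) :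
    ∃ C : ℝ, 0 ≤ C ∧ ∀ (k : ℝ → ℂ) (N : ℝ), IsAnnular k → 0 < N → (∀ x, ‖invFT k x‖ ≤ N) →
      ∫⁻ x, ‖invFT (fun ξ => ((|ξ| ^ (-(1 / (2 * q))) : ℝ) : ℂ) * k ξ) x‖ₑ ^ q ≤
        ENNReal.ofReal (C * N ^ (q - 2)) *
          ∫⁻ ξ, ENNReal.ofReal (|ξ| ^ (-(1 / 2) : ℝ)) * ‖k ξ‖ₑ ^ 2 := by
  -- This makes 2s = 1/(2q), the order of the fractional integration, and 2sq = 1/2, the exponent of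
  -- the resulting weight.
  set s := 1 / (4 * q) with hs
  have hs0 : 0 < s := by positivity
  have hs2 : 1 / (2 * q) = 2 * s := by rw [hs]; field_simp; norm_num
  have hsq : 2 * s * q = 1 / 2 := by rw [hs]; field_simp; norm_num
  have hΓ : 0 < Real.Gamma s := Real.Gamma_pos_of_pos hs0
  obtain ⟨C, hC0, hC⟩ := exists_setLIntegral_lowMult_sq_le hq hs0
    (show 0 < s * Real.Gamma s / 2 by positivity)
  rw [hsq] at hC
  refine ⟨q * (4 / Real.Gamma s ^ 2) * C, by positivity, fun k N hk hN0 hN => ?_⟩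
  rw [hs2]
  set F := invFT (fun ξ => ((|ξ| ^ (-(2 * s)) : ℝ) : ℂ) * k ξ) with hF
  have hFc : Continuous F := continuous_invFT (hk.rpow_mul _).integrable
  set m : ℝ → ℝ → ℝ≥0∞ := fun l ξ =>
    ENNReal.ofReal (lowMult s ((s * Real.Gamma s / 2 * l / N) ^ (1 / s)) ξ ^ 2) with hm
  have hmm : Measurable (Function.uncurry m) := by
    refine ENNReal.measurable_ofReal.comp (Measurable.pow_const ?_ 2)
    exact (measurable_uncurry_lowMult s).comp
      (by fun_prop : Measurable fun z : ℝ × ℝ =>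
        ((s * Real.Gamma s / 2 * z.1 / N) ^ (1 / s), z.2))
  have hkm : Measurable fun ξ => ‖k ξ‖ₑ ^ 2 := hk.measurable.enorm.pow_const 2
  have hjm : Measurable (Function.uncurry fun (l ξ : ℝ) =>
      ENNReal.ofReal (4 / Real.Gamma s ^ 2 * l ^ (q - 3)) * (m l ξ * ‖k ξ‖ₑ ^ 2)) := by
    refine Measurable.mul (by fun_prop)
      (hmm.mul (hkm.comp measurable_snd))
  have e1 : ∫⁻ x, ‖F x‖ₑ ^ q = ∫⁻ x, ENNReal.ofReal (‖F x‖ ^ q) := by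
    refine lintegral_congr fun x => ?_
    rw [← ofReal_norm, ENNReal.ofReal_rpow_of_nonneg (norm_nonneg _) (by linarith)]
  rw [e1, lintegral_rpow_eq_lintegral_meas_lt_mul volume
    (Eventually.of_forall fun x => norm_nonneg _) hFc.norm.measurable.aemeasurable (by linarith)]
  -- Layer cake with a cutoff depending on the level; Tonelli then leaves, for each frequency, the
  -- level integral bounded above.
  calc ENNReal.ofReal q * ∫⁻ l in Set.Ioi 0, volume {x | l < ‖F x‖} * ENNReal.ofReal (l ^ (q - 1))
      ≤ ENNReal.ofReal q * ∫⁻ l in Set.Ioi 0, ∫⁻ ξ,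
          ENNReal.ofReal (4 / Real.Gamma s ^ 2 * l ^ (q - 3)) * (m l ξ * ‖k ξ‖ₑ ^ 2) := by
        gcongr ENNReal.ofReal q * ?_
        refine setLIntegral_mono' measurableSet_Ioi fun l hl => ?_
        have hl0 : 0 < l := hl
        rw [lintegral_const_mul' _ _ ENNReal.ofReal_ne_top]
        calc _ ≤ (ENNReal.ofReal (4 / (Real.Gamma s ^ 2 * l ^ 2)) * ∫⁻ ξ, m l ξ * ‖k ξ‖ₑ ^ 2) *
              ENNReal.ofReal (l ^ (q - 1)) :=
              mul_le_mul_left (volume_lt_norm_invFT_le hk hN0 hN hs0 hl0) _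
          _ = _ := by
              rw [mul_right_comm, ← ENNReal.ofReal_mul (by positivity)]
              congr 2
              rw [show q - 1 = (q - 3) + (2 : ℕ) by push_cast; ring, Real.rpow_add hl0,
                Real.rpow_natCast]
              field_simp
    _ = ENNReal.ofReal q * ∫⁻ ξ, ∫⁻ l in Set.Ioi 0,
          ENNReal.ofReal (4 / Real.Gamma s ^ 2 * l ^ (q - 3)) * (m l ξ * ‖k ξ‖ₑ ^ 2) := by
        rw [lintegral_lintegral_swap hjm.aemeasurable]
    _ ≤ ENNReal.ofReal q * ∫⁻ ξ, ENNReal.ofReal (4 / Real.Gamma s ^ 2 * C * N ^ (q - 2)) *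
          (ENNReal.ofReal (|ξ| ^ (-(1 / 2) : ℝ)) * ‖k ξ‖ₑ ^ 2) := by
        gcongr ENNReal.ofReal q * ?_
        refine lintegral_mono fun ξ => ?_
        by_cases h : k ξ = 0
        · simp [h]
        have hCC := hC N hN0 ξ (hk.ne_zero h)
        have e2 : ∀ l : ℝ, ENNReal.ofReal (4 / Real.Gamma s ^ 2 * l ^ (q - 3)) *
            (m l ξ * ‖k ξ‖ₑ ^ 2) = (ENNReal.ofReal (4 / Real.Gamma s ^ 2) * ‖k ξ‖ₑ ^ 2) *
              (ENNReal.ofReal (l ^ (q - 3)) * m l ξ) := by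
          intro l
          rw [ENNReal.ofReal_mul (by positivity)]; ring
        simp_rw [e2]
        rw [lintegral_const_mul' _ _ (ENNReal.mul_ne_top ENNReal.ofReal_ne_top (by simp))]
        refine (mul_le_mul_right hCC _).trans (le_of_eq ?_)
        rw [mul_right_comm, ← ENNReal.ofReal_mul (by positivity),
          ← mul_assoc (ENNReal.ofReal (4 / Real.Gamma s ^ 2 * C * N ^ (q - 2))),
          ← ENNReal.ofReal_mul (by positivity)]
        congr 2; ring
    _ = _ := by
        rw [lintegral_const_mul' _ _ ENNReal.ofReal_ne_top, ← mul_assoc,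
          ← ENNReal.ofReal_mul (by linarith)]
        congr 2; ring

/-! ### Strichartz estimate for annular Airy data -/

/-- Strichartz exponents: `4 < p` and `2/p + 1/q = 1/2` force `2 < q`. -/
lemma two_lt_of_admissible {p q : ℝ} (hp : 4 < p) (hpq : 2 / p + 1 / q = 1 / 2) : 2 < q := by
  have h1 : 0 < 1 / q := by
    have : 2 / p < 1 / 2 := by rw [div_lt_div_iff₀ (by linarith) (by norm_num)]; linarith
    linarith
  have hq : 0 < q := one_div_pos.1 h1
  have h2 : 1 / q < 1 / 2 := by
    have : 0 < 2 / p := by positivity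
    linarith
  exact (one_div_lt_one_div hq (by norm_num)).1 h2

/-- Gagliardo–Nirenberg is applied to k = |ξ|^{1/4}e^{itξ³}f. Admissibility says 1/p = 1/4 − 1/(2q),
and the weight |ξ|^{-1/2} exactly cancels the factor |ξ|^{1/2} in |k|². -/
lemma lintegral_invFT_airySymbol_le {p q : ℝ} (hp : 4 < p) (hpq : 2 / p + 1 / q = 1 / 2) :
    ∃ C : ℝ, 0 ≤ C ∧ ∀ (f : ℝ → ℂ), IsAnnular f → ∀ (t : ℝ) (S : ℝ≥0∞), S ≠ ∞ →
      (∀ x, ‖invFT (fun ξ => airySymbol (1 / 4) t ξ * f ξ) x‖ₑ ≤ S) →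
      ∫⁻ x, ‖invFT (fun ξ => airySymbol (1 / p) t ξ * f ξ) x‖ₑ ^ q ≤
        ENNReal.ofReal C * S ^ (q - 2) * ∫⁻ ξ, ‖f ξ‖ₑ ^ 2 := by
  have hq := two_lt_of_admissible hp hpq
  obtain ⟨C, hC0, hC⟩ := exists_gagliardoNirenberg hq
  refine ⟨C, hC0, fun f hf t S hS hfS => ?_⟩
  have hk := hf.airySymbol_mul (1 / 4) t
  have e1 : (fun ξ => airySymbol (1 / p) t ξ * f ξ) = fun ξ =>
      ((|ξ| ^ (-(1 / (2 * q))) : ℝ) : ℂ) * (airySymbol (1 / 4) t ξ * f ξ) := by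
    ext ξ
    by_cases h : f ξ = 0
    · simp [h]
    · have hξ : 0 < |ξ| := abs_pos.2 (hf.ne_zero h)
      have hexp : 1 / p = -(1 / (2 * q)) + 1 / 4 := by
        have : 1 / (2 * q) = (1 / 2) * (1 / q) := by field_simp
        have h2 : 2 / p = 2 * (1 / p) := by ring
        rw [this]; linarith
      rw [airySymbol, airySymbol, hexp, Real.rpow_add hξ]
      push_cast; ring
  have e2 : ∫⁻ ξ, ENNReal.ofReal (|ξ| ^ (-(1 / 2) : ℝ)) * ‖airySymbol (1 / 4) t ξ * f ξ‖ₑ ^ 2 =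
      ∫⁻ ξ, ‖f ξ‖ₑ ^ 2 := by
    refine lintegral_congr fun ξ => ?_
    by_cases h : f ξ = 0
    · simp [h]
    · have hξ : 0 < |ξ| := abs_pos.2 (hf.ne_zero h)
      rw [enorm_mul, mul_pow, ← mul_assoc, ← ofReal_norm (airySymbol (1 / 4) t ξ), norm_airySymbol,
        ← ENNReal.ofReal_pow (by positivity), ← ENNReal.ofReal_mul (by positivity),
        ← Real.rpow_natCast, ← Real.rpow_mul hξ.le, ← Real.rpow_add hξ]
      norm_num
  -- The interpolation inequality needs N > 0, whereas S may vanish; hence a bound for every N > S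
  -- followed by N ↓ S.
  have key : ∀ N : ℝ, S.toReal < N → ∫⁻ x, ‖invFT (fun ξ => airySymbol (1 / p) t ξ * f ξ) x‖ₑ ^ q ≤
      ENNReal.ofReal (C * N ^ (q - 2)) * ∫⁻ ξ, ‖f ξ‖ₑ ^ 2 := by
    intro N hN
    rw [e1, ← e2]
    refine hC _ N hk (ENNReal.toReal_nonneg.trans_lt hN) fun x => ?_
    have := ENNReal.toReal_mono hS (hfS x)
    rw [toReal_enorm] at this
    linarith
  have hlim : Tendsto (fun N : ℝ => ENNReal.ofReal (C * N ^ (q - 2)) * ∫⁻ ξ, ‖f ξ‖ₑ ^ 2)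
      (𝓝[>] S.toReal) (𝓝 (ENNReal.ofReal (C * S.toReal ^ (q - 2)) * ∫⁻ ξ, ‖f ξ‖ₑ ^ 2)) := by
    refine ENNReal.Tendsto.mul_const ?_ (Or.inr ?_)
    · refine (ENNReal.continuous_ofReal.tendsto _).comp ?_
      have : Continuous fun N : ℝ => C * N ^ (q - 2) :=
        continuous_const.mul (Real.continuous_rpow_const (by linarith))
      exact (this.tendsto _).mono_left nhdsWithin_le_nhds
    · rw [← eLpNorm_two_sq]
      exact ENNReal.pow_ne_top hf.memLp.eLpNorm_ne_top
  have := ge_of_tendsto hlim (by filter_upwards [self_mem_nhdsWithin] with N hN using key N hN)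
  rwa [ENNReal.ofReal_mul hC0, ← ENNReal.ofReal_rpow_of_nonneg ENNReal.toReal_nonneg (by linarith),
    ENNReal.ofReal_toReal hS] at this

/-- The Strichartz estimate for the Airy flow, on a dense class. -/
lemma exists_strichartz_airy_annular {p q : ℝ} (hp : 4 < p) (hpq : 2 / p + 1 / q = 1 / 2) :
    ∃ C : ℝ≥0∞, C ≠ ∞ ∧ ∀ f : ℝ → ℂ, IsAnnular f →
      mixedEnergy p q (fun t x => invFT (fun ξ => airySymbol (1 / p) t ξ * f ξ) x) ≤
        C * (∫⁻ ξ, ‖f ξ‖ₑ ^ 2) ^ (p / 2) := by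
  have hq := two_lt_of_admissible hp hpq
  obtain ⟨C, hC0, hC⟩ := lintegral_invFT_airySymbol_le hp hpq
  have hr : 0 ≤ p / q := by positivity
  -- After raising to the power p/q the sup norm appears exactly to the fourth power, which the
  -- endpoint estimate integrates in time.
  have hr2 : (q - 2) * (p / q) = 4 := by
    have h1 : p / q = p * (1 / q) := by ring
    have h2 : 1 / q = 1 / 2 - 2 / p := by linarith
    have hp0 : p ≠ 0 := by linarith
    have hq0 : q ≠ 0 := by linarith
    have h3 : q * (p * (1 / q)) = p := by field_simp
    have h4 : p * (1 / q) = p / 2 - 2 := by rw [h2]; field_simp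
    rw [h1, sub_mul, h3, h4]; ring
  have hr3 : p / q + 2 = p / 2 := by
    have h2 : 1 / q = 1 / 2 - 2 / p := by linarith
    have hp0 : p ≠ 0 := by linarith
    rw [show p / q = p * (1 / q) by ring, h2]; field_simp; ring
  refine ⟨ENNReal.ofReal C ^ (p / q) * (16 * 96 ^ 2), ?_, fun f hf => ?_⟩
  · exact ENNReal.mul_ne_top (ENNReal.rpow_ne_top_of_nonneg hr ENNReal.ofReal_ne_top)
      (ENNReal.mul_ne_top (by norm_num) (by norm_num))
  obtain ⟨S, hSm, hSfin, hS, hS4⟩ := exists_sup_bound_airy hf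
  set F := ∫⁻ ξ, ‖f ξ‖ₑ ^ 2 with hF
  have hFt : F ≠ ∞ := by
    rw [hF, ← eLpNorm_two_sq]
    exact ENNReal.pow_ne_top hf.memLp.eLpNorm_ne_top
  calc _ ≤ ∫⁻ t, (ENNReal.ofReal C * F) ^ (p / q) * S t ^ 4 := by
        refine lintegral_mono fun t => ?_
        refine (ENNReal.rpow_le_rpow (hC f hf t (S t) (hSfin t) (hS t)) hr).trans (le_of_eq ?_)
        rw [mul_right_comm, ENNReal.mul_rpow_of_nonneg _ _ hr, ← ENNReal.rpow_mul, hr2,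
          ENNReal.rpow_ofNat]
    _ = (ENNReal.ofReal C * F) ^ (p / q) * ∫⁻ t, S t ^ 4 :=
        lintegral_const_mul _ (hSm.pow_const 4)
    _ ≤ (ENNReal.ofReal C * F) ^ (p / q) * (16 * (96 * F) ^ 2) := by gcongr
    _ = _ := by
        rw [← hr3, ENNReal.rpow_add_of_nonneg _ _ hr (by norm_num),
          ENNReal.mul_rpow_of_nonneg _ _ hr, ENNReal.rpow_ofNat]
        ring

/-! ### Flows of L² data, mixed norms and extension by density -/

/-- `F` is a version of the flow with symbol `σ` and frequency-side datum `f`. -/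
def IsFlow (σ : ℝ → ℝ → ℂ) (f : ℝ → ℂ) (F : ℝ → ℝ → ℂ) : Prop :=
  Measurable (Function.uncurry F) ∧
    ∀ᵐ t : ℝ, ∀ φ : 𝓢(ℝ, ℂ),
      Integrable (fun x : ℝ => F t x * φ x) ∧
        ∫ x : ℝ, F t x * φ x = ∫ ξ : ℝ, σ t ξ * f ξ * invHat φ ξ

/-- Measurable symbols of at most linear growth. -/
structure IsSymbol (σ : ℝ → ℝ → ℂ) : Prop where
  measurable : Measurable (Function.uncurry σ)
  norm_le : ∀ t ξ, ‖σ t ξ‖ ≤ 1 + |ξ|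

lemma IsFlow.congr_ae {σ : ℝ → ℝ → ℂ} {f g : ℝ → ℂ} {F : ℝ → ℝ → ℂ} (h : IsFlow σ f F)
    (hfg : f =ᵐ[volume] g) : IsFlow σ g F := by
  refine ⟨h.1, ?_⟩
  filter_upwards [h.2] with t ht φ
  refine ⟨(ht φ).1, (ht φ).2.trans (integral_congr_ae ?_)⟩
  filter_upwards [hfg] with ξ hξ
  rw [hξ]

lemma IsFlow.ae_eq {σ : ℝ → ℝ → ℂ} {f : ℝ → ℂ} {F G : ℝ → ℝ → ℂ} (hF : IsFlow σ f F)
    (hG : IsFlow σ f G) : ∀ᵐ t, F t =ᵐ[volume] G t := by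
  filter_upwards [hF.2, hG.2] with t h1 h2
  exact ae_eq_of_forall_integral_mul_schwartz (fun φ => (h1 φ).1) (fun φ => (h2 φ).1)
    fun φ => (h1 φ).2.trans (h2 φ).2.symm

lemma mixedEnergy_congr {p q : ℝ} {F G : ℝ → ℝ → ℂ} (h : ∀ᵐ t, F t =ᵐ[volume] G t) :
    mixedEnergy p q F = mixedEnergy p q G := by
  refine lintegral_congr_ae ?_
  filter_upwards [h] with t ht
  congr 1
  refine lintegral_congr_ae ?_
  filter_upwards [ht] with x hx
  rw [hx]

/-- The weight absorbs symbols of linear growth, so that σ·f pairs with the transform of a Schwartz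
function by Cauchy–Schwarz for every f in `L²`. -/
lemma memLp_weight_mul_invHat (φ : 𝓢(ℝ, ℂ)) :
    MemLp (fun ξ => ((1 + |ξ| : ℝ) : ℂ) * invHat φ ξ) 2 := by
  set ψ : 𝓢(ℝ, ℂ) := 𝓕⁻ φ with hψ
  have hπ : (2 * Real.pi) ≠ 0 := by positivity
  have h1 : MemLp (fun η : ℝ => ((1 + |2 * Real.pi * η| : ℝ) : ℂ) * ψ η) 2 := by
    have hm : Continuous fun η : ℝ => ((1 + |2 * Real.pi * η| : ℝ) : ℂ) * ψ η := by
      have := ψ.continuous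
      fun_prop
    rw [memLp_two_iff_integrable_sq_norm hm.aestronglyMeasurable]
    obtain ⟨C, hC⟩ := ψ.decay 0 0
    have hC0 := hC.1.le
    have hC' : ∀ η, ‖ψ η‖ ≤ C := fun η => by simpa using hC.2 η
    have hint : Integrable fun η : ℝ => C * (2 * (‖η‖ ^ 0 * ‖ψ η‖) +
        2 * (2 * Real.pi) ^ 2 * (‖η‖ ^ 2 * ‖ψ η‖)) :=
      (((ψ.integrable_pow_mul volume 0).const_mul 2).add
        ((ψ.integrable_pow_mul volume 2).const_mul _)).const_mul C
    refine hint.mono' (hm.norm.pow 2).aestronglyMeasurable (Eventually.of_forall fun η => ?_)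
    rw [Real.norm_of_nonneg (by positivity), norm_mul, Complex.norm_real,
      Real.norm_of_nonneg (by positivity), abs_mul, abs_of_pos (by positivity : 0 < 2 * Real.pi),
      Real.norm_eq_abs]
    have hn := norm_nonneg (ψ η)
    have hb := hC' η
    have h2 : (1 + 2 * Real.pi * |η|) ^ 2 ≤ 2 + 2 * (2 * Real.pi) ^ 2 * |η| ^ 2 := by
      nlinarith [sq_nonneg (1 - 2 * Real.pi * |η|)]
    calc ((1 + 2 * Real.pi * |η|) * ‖ψ η‖) ^ 2 = ‖ψ η‖ * ((1 + 2 * Real.pi * |η|) ^ 2 * ‖ψ η‖) := by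
          ring
      _ ≤ C * ((2 + 2 * (2 * Real.pi) ^ 2 * |η| ^ 2) * ‖ψ η‖) := by gcongr
      _ = _ := by ring
  have h2 := (memLp_affine h1 (inv_ne_zero hπ) 0).const_mul ((Real.sqrt (2 * Real.pi) : ℝ) : ℂ)⁻¹
  refine h2.ae_eq (Eventually.of_forall fun ξ => ?_)
  simp only [add_zero]
  rw [invHat_eq_invFT, invFT_eq_fourierInv, hψ, SchwartzMap.fourierInv_coe,
    mul_inv_cancel_left₀ hπ, div_eq_inv_mul]
  ring

lemma IsSymbol.memLp_mul_invHat {σ : ℝ → ℝ → ℂ} (hσ : IsSymbol σ) (t : ℝ) (φ : 𝓢(ℝ, ℂ)) :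
    MemLp (fun ξ => σ t ξ * invHat φ ξ) 2 := by
  refine (memLp_weight_mul_invHat φ).of_le ?_ (Eventually.of_forall fun ξ => ?_)
  · refine ((hσ.measurable.comp measurable_prodMk_left).mul ?_).aestronglyMeasurable
    exact (continuous_invFT φ.integrable).measurable
  · rw [norm_mul, norm_mul, Complex.norm_real, Real.norm_of_nonneg (by positivity)]
    gcongr
    exact hσ.norm_le t ξ

lemma IsSymbol.integrable_mul {σ : ℝ → ℝ → ℂ} (hσ : IsSymbol σ) {f : ℝ → ℂ} (hf : MemLp f 2)
    (t : ℝ) (φ : 𝓢(ℝ, ℂ)) : Integrable (fun ξ => σ t ξ * f ξ * invHat φ ξ) := by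
  refine (hf.integrable_mul (hσ.memLp_mul_invHat t φ)).congr (Eventually.of_forall fun ξ => ?_)
  simp only [Pi.mul_apply]; ring

lemma IsFlow.sub {σ : ℝ → ℝ → ℂ} (hσ : IsSymbol σ) {f g : ℝ → ℂ} (hf : MemLp f 2)
    (hg : MemLp g 2) {F G : ℝ → ℝ → ℂ} (hF : IsFlow σ f F) (hG : IsFlow σ g G) :
    IsFlow σ (fun ξ => f ξ - g ξ) (fun t x => F t x - G t x) := by
  refine ⟨hF.1.sub hG.1, ?_⟩
  filter_upwards [hF.2, hG.2] with t h1 h2 φ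
  simp only [sub_mul, mul_sub]
  refine ⟨(h1 φ).1.sub (h2 φ).1, ?_⟩
  rw [integral_sub (h1 φ).1 (h2 φ).1, integral_sub (hσ.integrable_mul hf t φ)
    (hσ.integrable_mul hg t φ), (h1 φ).2, (h2 φ).2]

lemma isFlow_invFT {σ : ℝ → ℝ → ℂ} (hσ : Measurable (Function.uncurry σ)) {f : ℝ → ℂ}
    (hf : Measurable f) (hint : ∀ t, Integrable fun ξ => σ t ξ * f ξ) :
    IsFlow σ f (fun t x => invFT (fun ξ => σ t ξ * f ξ) x) := by
  refine ⟨measurable_uncurry_invFT (hσ.mul (hf.comp measurable_snd)), ?_⟩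
  refine Eventually.of_forall fun t φ => ⟨?_, integral_invFT_mul (hint t) φ.integrable⟩
  exact φ.integrable.bdd_mul (continuous_invFT (hint t)).aestronglyMeasurable
    (Eventually.of_forall fun x => norm_invFT_le _ _)

lemma isSymbol_airySymbol {s : ℝ} (hs0 : 0 ≤ s) (hs1 : s ≤ 1) : IsSymbol (airySymbol s) := by
  refine ⟨measurable_airySymbol s, fun t ξ => ?_⟩
  rw [norm_airySymbol]
  rcases le_total |ξ| 1 with h | h
  · have := Real.rpow_le_one (abs_nonneg ξ) h hs0
    linarith [abs_nonneg ξ]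
  · have := Real.rpow_le_rpow_of_exponent_le h hs1
    rw [Real.rpow_one] at this
    linarith

lemma measurable_inner_lintegral {q : ℝ} {F : ℝ → ℝ → ℂ} (hF : Measurable (Function.uncurry F)) :
    Measurable fun t => ∫⁻ x, ‖F t x‖ₑ ^ q := by
  have : Measurable fun z : ℝ × ℝ => ‖F z.1 z.2‖ₑ ^ q := hF.enorm.pow_const q
  exact this.lintegral_prod_right'

/-- The triangle inequality for the norm of `L^p_t L^q_x`. -/
lemma mixedEnergy_rpow_le_add {p q : ℝ} (hp : 1 ≤ p) (hq : 1 ≤ q) {F G H : ℝ → ℝ → ℂ}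
    (hF : Measurable (Function.uncurry F)) (hG : Measurable (Function.uncurry G))
    (hH : ∀ t x, ‖H t x‖ ≤ ‖F t x‖ + ‖G t x‖) :
    mixedEnergy p q H ^ (1 / p) ≤ mixedEnergy p q F ^ (1 / p) + mixedEnergy p q G ^ (1 / p) := by
  have hp0 : 0 < p := by linarith
  have hq0 : 0 < q := by linarith
  have hpow : ∀ a : ℝ≥0∞, a ^ (p / q) = (a ^ (1 / q)) ^ p := fun a => by
    rw [← ENNReal.rpow_mul]; congr 1; ring
  have hinner : ∀ t, (∫⁻ x, ‖H t x‖ₑ ^ q) ^ (1 / q) ≤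
      (∫⁻ x, ‖F t x‖ₑ ^ q) ^ (1 / q) + (∫⁻ x, ‖G t x‖ₑ ^ q) ^ (1 / q) := by
    intro t
    have hFt : Measurable (F t) := hF.comp measurable_prodMk_left
    have hGt : Measurable (G t) := hG.comp measurable_prodMk_left
    refine le_trans ?_ (ENNReal.lintegral_Lp_add_le (μ := volume) hFt.enorm.aemeasurable
      hGt.enorm.aemeasurable hq)
    gcongr with x
    rw [Pi.add_apply, ← ofReal_norm, ← ofReal_norm, ← ofReal_norm,
      ← ENNReal.ofReal_add (norm_nonneg _) (norm_nonneg _)]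
    exact ENNReal.ofReal_le_ofReal (hH t x)
  simp only [mixedEnergy, hpow]
  refine le_trans ?_ (ENNReal.lintegral_Lp_add_le (μ := volume)
    ((measurable_inner_lintegral hF).pow_const (1 / q)).aemeasurable
    ((measurable_inner_lintegral hG).pow_const (1 / q)).aemeasurable hp)
  gcongr with t
  exact hinner t

lemma measurable_mixedEnergy_integrand {p q : ℝ} {F : ℝ → ℝ → ℂ}
    (hF : Measurable (Function.uncurry F)) :
    Measurable fun t => (∫⁻ x, ‖F t x‖ₑ ^ q) ^ (p / q) :=
  (measurable_inner_lintegral hF).pow_const _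

/-- Fatou's lemma for the mixed norm. -/
lemma mixedEnergy_le_liminf {p q : ℝ} (hp : 0 ≤ p) (hq : 0 < q) {F : ℕ → ℝ → ℝ → ℂ}
    {G : ℝ → ℝ → ℂ} (hF : ∀ n, Measurable (Function.uncurry (F n)))
    (h : ∀ᵐ t, ∀ᵐ x, Tendsto (fun n => F n t x) atTop (𝓝 (G t x))) :
    mixedEnergy p q G ≤ liminf (fun n => mixedEnergy p q (F n)) atTop := by
  have hr : 0 ≤ p / q := by positivity
  calc mixedEnergy p q G ≤ ∫⁻ t, liminf (fun n => (∫⁻ x, ‖F n t x‖ₑ ^ q) ^ (p / q)) atTop := by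
        refine lintegral_mono_ae ?_
        filter_upwards [h] with t ht
        have h1 : ∫⁻ x, ‖G t x‖ₑ ^ q ≤ liminf (fun n => ∫⁻ x, ‖F n t x‖ₑ ^ q) atTop := by
          refine le_trans (le_of_eq ?_) (lintegral_liminf_le fun n => ?_)
          · refine lintegral_congr_ae ?_
            filter_upwards [ht] with x hx
            exact (((ENNReal.continuous_rpow_const.tendsto _).comp hx.enorm).liminf_eq).symm
          · exact ((hF n).comp measurable_prodMk_left).enorm.pow_const q
        refine (ENNReal.rpow_le_rpow h1 hr).trans (le_of_eq ?_)
        exact (ENNReal.monotone_rpow_of_nonneg hr).map_liminf_of_continuousAt _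
          ENNReal.continuous_rpow_const.continuousAt
    _ ≤ _ := lintegral_liminf_le fun n => measurable_mixedEnergy_integrand (hF n)

lemma eLpNorm_ofReal_eq {q : ℝ} (hq : 0 < q) (f : ℝ → ℂ) :
    eLpNorm f (ENNReal.ofReal q) = (∫⁻ x, ‖f x‖ₑ ^ q) ^ (1 / q) := by
  rw [eLpNorm_eq_lintegral_rpow_enorm_toReal (by simpa using hq) ENNReal.ofReal_ne_top,
    ENNReal.toReal_ofReal hq.le]

lemma mixedEnergy_eq_lintegral_eLpNorm {p q : ℝ} (hq : 0 < q) (F : ℝ → ℝ → ℂ) :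
    mixedEnergy p q F = ∫⁻ t, eLpNorm (F t) (ENNReal.ofReal q) ^ p := by
  simp only [mixedEnergy, eLpNorm_ofReal_eq hq]
  refine lintegral_congr fun t => ?_
  rw [← ENNReal.rpow_mul]
  congr 1; ring

lemma eLpNorm_sub_add_le_of_geometric {Q K : ℝ≥0∞} (hQ : 1 ≤ Q) {u : ℕ → ℝ → ℂ}
    (hu : ∀ n, AEStronglyMeasurable (u n) volume)
    (hK : ∀ n, eLpNorm (u (n + 1) - u n) Q ≤ K * (2⁻¹) ^ n) (d : ℕ) :
    ∀ n, eLpNorm (u n - u (n + d)) Q ≤ 2 * K * (2⁻¹) ^ n := by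
  induction d with
  | zero => intro n; simp
  | succ d ih =>
    intro n
    have h1 : u n - u (n + (d + 1)) = (u n - u (n + 1)) + (u (n + 1) - u (n + 1 + d)) := by
      rw [show n + (d + 1) = n + 1 + d by ring]; abel
    rw [h1]
    refine (eLpNorm_add_le ((hu _).sub (hu _)) ((hu _).sub (hu _)) hQ).trans ?_
    rw [eLpNorm_sub_comm]
    refine (add_le_add (hK n) (ih (n + 1))).trans (le_of_eq ?_)
    have h2 : (2 : ℝ≥0∞) * 2⁻¹ = 1 := ENNReal.mul_inv_cancel (by norm_num) (by norm_num)
    calc K * 2⁻¹ ^ n + 2 * K * 2⁻¹ ^ (n + 1) = K * 2⁻¹ ^ n + (2 * 2⁻¹) * (K * 2⁻¹ ^ n) := by ring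
      _ = 2 * K * 2⁻¹ ^ n := by rw [h2]; ring

/-- Telescoping gives 2K·2^{-M}; the extra 1 makes the inequality strict, as the completeness
criterion demands, even for K = 0. -/
lemma eLpNorm_sub_lt_of_geometric {Q K : ℝ≥0∞} (hQ : 1 ≤ Q) (hKt : K ≠ ∞) {u : ℕ → ℝ → ℂ}
    (hu : ∀ n, AEStronglyMeasurable (u n) volume)
    (hK : ∀ n, eLpNorm (u (n + 1) - u n) Q ≤ K * (2⁻¹) ^ n) (M n m : ℕ) (hn : M ≤ n)
    (hm : M ≤ m) : eLpNorm (u n - u m) Q < (2 * K + 1) * (2⁻¹) ^ M := by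
  have key : ∀ a b : ℕ, M ≤ a → a ≤ b → eLpNorm (u a - u b) Q < (2 * K + 1) * (2⁻¹) ^ M := by
    intro a b ha hab
    obtain ⟨d, rfl⟩ := Nat.exists_eq_add_of_le hab
    refine (eLpNorm_sub_add_le_of_geometric hQ hu hK d a).trans_lt ?_
    have h1 : (2⁻¹ : ℝ≥0∞) ^ a ≤ 2⁻¹ ^ M :=
      pow_le_pow_right_of_le_one' (ENNReal.inv_le_one.2 (by norm_num)) ha
    have h2 : (2⁻¹ : ℝ≥0∞) ^ M ≠ 0 := by simp
    have h3 : (2⁻¹ : ℝ≥0∞) ^ M ≠ ∞ := by simp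
    calc 2 * K * 2⁻¹ ^ a ≤ 2 * K * 2⁻¹ ^ M := by gcongr
      _ < (2 * K + 1) * 2⁻¹ ^ M := by
        refine (ENNReal.mul_lt_mul_iff_left h2 h3).2 ?_
        exact ENNReal.lt_add_right (ENNReal.mul_ne_top (by norm_num) hKt) one_ne_zero
  rcases le_total n m with h | h
  · exact key n m hn h
  · rw [eLpNorm_sub_comm]; exact key m n hm h

/-- Hölder controls the difference in `L¹`. The limit v is not assumed to lie in the Q-space: vφ is
integrable because it differs from some u_nφ by an integrable function. -/
lemma tendsto_integral_mul_of_eLpNorm {Q Q' : ℝ≥0∞} [ENNReal.HolderTriple Q Q' 1] {u : ℕ → ℝ → ℂ}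
    {v φ : ℝ → ℂ} (hu : ∀ n, AEStronglyMeasurable (u n) volume)
    (hv : AEStronglyMeasurable v volume) (hφ : MemLp φ Q')
    (huφ : ∀ n, Integrable fun x => u n x * φ x)
    (h : Tendsto (fun n => eLpNorm (u n - v) Q) atTop (𝓝 0)) :
    Integrable (fun x => v x * φ x) ∧
      Tendsto (fun n => ∫ x, u n x * φ x) atTop (𝓝 (∫ x, v x * φ x)) := by
  have hle : ∀ n, eLpNorm (u n * φ - v * φ) 1 volume ≤ eLpNorm (u n - v) Q * eLpNorm φ Q' := by
    intro n
    have h1 := eLpNorm_smul_le_mul_eLpNorm (p := Q) (q := Q') (r := 1) hφ.1 ((hu n).sub hv)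
    rwa [← sub_mul]
  have hlim : Tendsto (fun n => eLpNorm (u n * φ - v * φ) 1 volume) atTop (𝓝 0) := by
    have hb : eLpNorm φ Q' volume ≠ ∞ := hφ.2.ne
    have h0 : Tendsto (fun n => eLpNorm (u n - v) Q volume * eLpNorm φ Q' volume) atTop
        (𝓝 (0 * eLpNorm φ Q' volume)) := ENNReal.Tendsto.mul_const h (Or.inr hb)
    rw [zero_mul] at h0
    exact tendsto_of_tendsto_of_tendsto_of_le_of_le tendsto_const_nhds h0 (fun _ => bot_le) hle
  have hint : Integrable (v * φ) := by
    obtain ⟨n, hn⟩ := (h.eventually_lt_const ENNReal.zero_lt_top).exists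
    have h1 : MemLp (u n - v) Q := ⟨(hu n).sub hv, hn⟩
    have h2 : Integrable (u n * φ) := huφ n
    have h3 : Integrable ((u n - v) * φ) := h1.integrable_mul hφ
    have h4 := h2.sub h3
    rwa [← sub_mul, sub_sub_cancel] at h4
  exact ⟨hint, tendsto_integral_of_L1' (v * φ) hint.1 (Eventually.of_forall huφ) hlim⟩

/-- Summability in the mixed norm gives geometric decay for almost every time. -/
lemma ae_geometric_of_mixed {p : ℝ} (hp : 1 ≤ p) {D : ℕ → ℝ → ℝ≥0∞} (hDm : ∀ n, Measurable (D n))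
    {C : ℝ≥0∞} (hC : C ≠ ∞) (hDint : ∀ n, ∫⁻ t, D n t ^ p ≤ C * (2 * 4⁻¹ ^ n) ^ p) :
    ∀ᵐ t, ∃ K : ℝ≥0∞, K ≠ ∞ ∧ ∀ n, D n t ≤ K * 2⁻¹ ^ n := by
  have hp0 : 0 < p := by linarith
  -- The weights 2^n turn differences of size 4^{-n} in the mixed norm into a convergent series of
  -- integrals. Wherever Y is finite, D n t ≤ Y(t)^{1/p} 2^{-n}.
  set Y : ℝ → ℝ≥0∞ := fun t => ∑' n : ℕ, (2 ^ n * D n t) ^ p with hY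
  have hYm : Measurable Y :=
    Measurable.tsum fun n => ((hDm n).const_mul _).pow_const _
  have hYint : ∫⁻ t, Y t ≠ ∞ := by
    simp only [hY]
    rw [lintegral_tsum fun n => (((hDm n).const_mul _).pow_const _).aemeasurable]
    have hterm : ∀ n : ℕ, ∫⁻ t, (2 ^ n * D n t) ^ p ≤ C * 2 ^ p * (2⁻¹) ^ n := by
      intro n
      calc ∫⁻ t, (2 ^ n * D n t) ^ p = ((2 : ℝ≥0∞) ^ n) ^ p * ∫⁻ t, D n t ^ p := by
            rw [← lintegral_const_mul _ ((hDm n).pow_const p)]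
            refine lintegral_congr fun t => ?_
            rw [ENNReal.mul_rpow_of_nonneg _ _ hp0.le]
        _ ≤ ((2 : ℝ≥0∞) ^ n) ^ p * (C * (2 * 4⁻¹ ^ n) ^ p) := by gcongr; exact hDint n
        _ = C * 2 ^ p * ((2 ^ n * 4⁻¹ ^ n : ℝ≥0∞)) ^ p := by
            rw [ENNReal.mul_rpow_of_nonneg _ _ hp0.le, ENNReal.mul_rpow_of_nonneg _ _ hp0.le]
            ring
        _ = C * 2 ^ p * (2⁻¹ ^ n : ℝ≥0∞) ^ p := by
            rw [← mul_pow, show (4 : ℝ≥0∞) = 2 * 2 by norm_num,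
              ENNReal.mul_inv (by norm_num) (by norm_num), ← mul_assoc,
              ENNReal.mul_inv_cancel (by norm_num) (by norm_num), one_mul]
        _ ≤ C * 2 ^ p * 2⁻¹ ^ n := by
            gcongr
            exact ENNReal.rpow_le_self_of_le_one
              (pow_le_one' (ENNReal.inv_le_one.2 (by norm_num)) n) hp
    refine ((ENNReal.tsum_le_tsum hterm).trans_lt ?_).ne
    rw [ENNReal.tsum_mul_left, ENNReal.tsum_geometric]
    refine ENNReal.mul_lt_top (ENNReal.mul_lt_top hC.lt_top
      (ENNReal.rpow_lt_top_of_nonneg hp0.le (by norm_num))) ?_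
    rw [ENNReal.one_sub_inv_two, inv_inv]
    norm_num
  filter_upwards [ae_lt_top hYm hYint] with t ht
  refine ⟨Y t ^ (1 / p), ENNReal.rpow_ne_top_of_nonneg (by positivity) ht.ne, fun n => ?_⟩
  have h1 : (2 ^ n * D n t) ^ p ≤ Y t := ENNReal.le_tsum n
  have h2 := ENNReal.rpow_le_rpow h1 (show 0 ≤ 1 / p by positivity)
  rw [← ENNReal.rpow_mul, mul_one_div_cancel hp0.ne', ENNReal.rpow_one] at h2
  have h3 : (2 : ℝ≥0∞) ^ n * 2⁻¹ ^ n = 1 := by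
    rw [← mul_pow, ENNReal.mul_inv_cancel (by norm_num) (by norm_num), one_pow]
  calc D n t = (2 ^ n * D n t) * 2⁻¹ ^ n := by
        rw [mul_right_comm, h3, one_mul]
    _ ≤ _ := by gcongr

/-- Completeness of the mixed-norm space, for fast Cauchy sequences. -/
lemma exists_limit_of_ae_geometric {Q : ℝ≥0∞} (hQ : 1 ≤ Q) {F : ℕ → ℝ → ℝ → ℂ}
    (hFm : ∀ n, Measurable (Function.uncurry (F n)))
    (hgeom : ∀ᵐ t, ∃ K : ℝ≥0∞, K ≠ ∞ ∧ ∀ n, eLpNorm (F (n + 1) t - F n t) Q ≤ K * 2⁻¹ ^ n) :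
    ∃ G : ℝ → ℝ → ℂ, Measurable (Function.uncurry G) ∧
      (∀ᵐ t, ∀ᵐ x, Tendsto (fun n => F n t x) atTop (𝓝 (G t x))) ∧
      ∀ᵐ t, Tendsto (fun n => eLpNorm (F n t - G t) Q) atTop (𝓝 0) := by
  have hFtm : ∀ n t, Measurable (F n t) := fun n t => (hFm n).comp measurable_prodMk_left
  have hB : ∀ K : ℝ≥0∞, K ≠ ∞ → ∑' n : ℕ, (2 * K + 1) * (2⁻¹ : ℝ≥0∞) ^ n ≠ ∞ := by
    intro K hK
    rw [ENNReal.tsum_mul_left, ENNReal.tsum_geometric, ENNReal.one_sub_inv_two, inv_inv]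
    exact ENNReal.mul_ne_top (ENNReal.add_ne_top.2
      ⟨ENNReal.mul_ne_top (by norm_num) hK, by norm_num⟩) (by norm_num)
  have hconv : ∀ᵐ t, ∀ᵐ x, ∃ c, Tendsto (fun n => F n t x) atTop (𝓝 c) := by
    filter_upwards [hgeom] with t ⟨K, hK, hKn⟩
    exact Lp.ae_tendsto_of_cauchy_eLpNorm (fun n => (hFtm n t).aestronglyMeasurable) hQ (hB K hK)
      (eLpNorm_sub_lt_of_geometric hQ hK (fun n => (hFtm n t).aestronglyMeasurable) hKn)
  -- The set of convergence is jointly measurable, so almost everywhere convergence on slices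
  -- becomes convergence on the product, and one jointly measurable limit serves all times.
  have hconv' : ∀ᵐ z : ℝ × ℝ ∂(volume.prod volume),
      ∃ c, Tendsto (fun n => F n z.1 z.2) atTop (𝓝 c) :=
    (Measure.ae_prod_iff_ae_ae (measurableSet_exists_tendsto hFm)).2 hconv
  obtain ⟨G, hGm, hG⟩ := measurable_limit_of_tendsto_metrizable_ae
    (f := fun n => Function.uncurry (F n)) (fun n => (hFm n).aemeasurable) hconv'
  have hG' : ∀ᵐ t, ∀ᵐ x, Tendsto (fun n => F n t x) atTop (𝓝 (G (t, x))) :=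
    Measure.ae_ae_of_ae_prod hG
  refine ⟨fun t x => G (t, x), hGm, hG', ?_⟩
  filter_upwards [hgeom, hG'] with t ⟨K, hK, hKn⟩ hGt
  exact Lp.cauchy_tendsto_of_tendsto (fun n => (hFtm n t).aestronglyMeasurable)
    (fun x => G (t, x)) (hB K hK) (eLpNorm_sub_lt_of_geometric hQ hK
      (fun n => (hFtm n t).aestronglyMeasurable) hKn) hGt

/-- The limit of flows represents the flow of the limit, at a fixed time. -/
lemma pairing_of_tendsto {q : ℝ} (hq : 1 < q) {σ : ℝ → ℝ → ℂ} (hσ : IsSymbol σ) {f : ℝ → ℂ}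
    (hf : MemLp f 2) {g : ℕ → ℝ → ℂ} (hg : ∀ n, MemLp (g n) 2) (t : ℝ)
    (hgi : ∀ n, Integrable fun ξ => σ t ξ * g n ξ)
    (hgf : Tendsto (fun n => eLpNorm (g n - f) 2) atTop (𝓝 0)) {G : ℝ → ℂ} (hGtm : Measurable G)
    (hlim : Tendsto (fun n => eLpNorm ((fun x => invFT (fun ξ => σ t ξ * g n ξ) x) - G)
      (ENNReal.ofReal q)) atTop (𝓝 0)) (φ : 𝓢(ℝ, ℂ)) :
      Integrable (fun x : ℝ => G x * φ x) ∧
        ∫ x : ℝ, G x * φ x = ∫ ξ : ℝ, σ t ξ * f ξ * invHat φ ξ := by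
  obtain ⟨F, hF⟩ : ∃ F : ℕ → ℝ → ℂ, F = fun n => invFT fun ξ => σ t ξ * g n ξ := ⟨_, rfl⟩
  have hF' : ∀ n, F n = invFT (fun ξ => σ t ξ * g n ξ) := fun n => by rw [hF]
  have hFtm : ∀ n, AEStronglyMeasurable (F n) volume :=
    fun n => by rw [hF']; exact (continuous_invFT (hgi n)).aestronglyMeasurable
  replace hlim : Tendsto (fun n => eLpNorm (F n - G) (ENNReal.ofReal q)) atTop (𝓝 0) := by
    rw [hF]; exact hlim
  have hconj := (Real.HolderConjugate.conjExponent hq).ennrealOfReal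
  have hFφ : ∀ n, Integrable fun x => F n x * φ x := fun n =>
    φ.integrable.bdd_mul (hFtm n) (Eventually.of_forall fun x => by
      rw [hF']; exact norm_invFT_le _ _)
  have h1 := tendsto_integral_mul_of_eLpNorm (Q := ENNReal.ofReal q)
    (Q' := ENNReal.ofReal (Real.conjExponent q)) (hFtm)
    hGtm.aestronglyMeasurable (φ.memLp _) hFφ hlim
  refine ⟨h1.1, tendsto_nhds_unique h1.2 ?_⟩
  have hσφ := hσ.memLp_mul_invHat t φ
  have h2 := tendsto_integral_mul_of_eLpNorm (Q := 2) (Q' := 2)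
    (fun n => (hg n).1) hf.1 hσφ
    (fun n => (hg n).integrable_mul hσφ) hgf
  have e : ∀ n, ∫ x, F n x * φ x = ∫ ξ, g n ξ * (σ t ξ * invHat φ ξ) := by
    intro n
    rw [hF', integral_invFT_mul (hgi n) φ.integrable]
    congr 1; ext ξ
    rw [invHat_eq_invFT]; ring
  simp only [e]
  convert h2.2 using 2
  congr 1; ext ξ; ring

lemma liminf_mul_rpow_le {p : ℝ} {C A : ℝ≥0∞} (hC : C ≠ ∞) {a b : ℕ → ℝ≥0∞}
    (hb : Tendsto b atTop (𝓝 0)) (ha : ∀ n, a n ≤ C * (A + b n) ^ p) :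
    liminf a atTop ≤ C * A ^ p := by
  have h1 : Tendsto (fun n : ℕ => A + b n) atTop (𝓝 A) := by
    have := hb.const_add A
    rwa [add_zero] at this
  have h2 : Tendsto (fun n : ℕ => (A + b n) ^ p) atTop (𝓝 (A ^ p)) :=
    (ENNReal.continuous_rpow_const.tendsto A).comp h1
  have h3 : Tendsto (fun n : ℕ => C * (A + b n) ^ p) atTop (𝓝 (C * A ^ p)) :=
    ENNReal.Tendsto.const_mul h2 (Or.inr hC)
  rw [← h3.liminf_eq]
  exact liminf_le_liminf (Eventually.of_forall ha)

lemma liminf_le_of_eLpNorm {p : ℝ} (hp : 0 < p) {C : ℝ≥0∞} (hC : C ≠ ∞) {f : ℝ → ℂ}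
    (hf : MemLp f 2) {g : ℕ → ℝ → ℂ} (hg : ∀ n, MemLp (g n) 2)
    (hgf : Tendsto (fun n => eLpNorm (g n - f) 2) atTop (𝓝 0)) {a : ℕ → ℝ≥0∞}
    (ha : ∀ n, a n ≤ C * eLpNorm (g n) 2 ^ p) : liminf a atTop ≤ C * eLpNorm f 2 ^ p := by
  refine liminf_mul_rpow_le hC hgf fun n => (ha n).trans ?_
  have h1 : eLpNorm (g n) 2 ≤ eLpNorm f 2 + eLpNorm (g n - f) 2 := by
    have := eLpNorm_add_le (μ := volume) (p := 2) hf.1 ((hg n).1.sub hf.1) (by norm_num)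
    rwa [add_sub_cancel] at this
  exact mul_le_mul_right (ENNReal.rpow_le_rpow h1 hp.le) _

lemma exists_limit_of_mixedEnergy {p q : ℝ} (hp : 1 ≤ p) (hq : 1 < q) {F : ℕ → ℝ → ℝ → ℂ}
    (hFm : ∀ n, Measurable (Function.uncurry (F n))) {C : ℝ≥0∞} (hC : C ≠ ∞)
    (hF : ∀ n, mixedEnergy p q (fun t x => F (n + 1) t x - F n t x) ≤ C * (2 * 4⁻¹ ^ n) ^ p) :
    ∃ G : ℝ → ℝ → ℂ, Measurable (Function.uncurry G) ∧
      (∀ᵐ t, ∀ᵐ x, Tendsto (fun n => F n t x) atTop (𝓝 (G t x))) ∧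
      ∀ᵐ t, Tendsto (fun n => eLpNorm (F n t - G t) (ENNReal.ofReal q)) atTop (𝓝 0) := by
  have hq0 : 0 < q := by linarith
  have hQ : 1 ≤ ENNReal.ofReal q := by rw [ENNReal.one_le_ofReal]; exact hq.le
  have hDm : ∀ n, Measurable fun t => eLpNorm (F (n + 1) t - F n t) (ENNReal.ofReal q) := by
    intro n
    simp only [eLpNorm_ofReal_eq hq0, Pi.sub_apply]
    exact (measurable_inner_lintegral (F := fun t x => F (n + 1) t x - F n t x)
      ((hFm (n + 1)).sub (hFm n))).pow_const _
  refine exists_limit_of_ae_geometric hQ hFm (ae_geometric_of_mixed hp hDm hC fun n => ?_)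
  have h1 := hF n
  rwa [mixedEnergy_eq_lintegral_eLpNorm hq0] at h1

/-- Accuracy 4^{-n} leaves room for the weights 2^n used to pass from mixed norms to almost every
time. -/
lemma exists_approx_seq {N : (ℝ → ℂ) → Prop} (hNm : ∀ g, N g → MemLp g 2)
    (hNd : ∀ f : ℝ → ℂ, MemLp f 2 → ∀ δ : ℝ≥0∞, δ ≠ 0 → ∃ g, N g ∧ eLpNorm (f - g) 2 ≤ δ)
    {f : ℝ → ℂ} (hf : MemLp f 2) :
    ∃ g : ℕ → ℝ → ℂ, (∀ n, N (g n)) ∧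
      (∀ n, eLpNorm (fun ξ => g (n + 1) ξ - g n ξ) 2 ≤ 2 * 4⁻¹ ^ n) ∧
      Tendsto (fun n => eLpNorm (g n - f) 2) atTop (𝓝 0) := by
  have h4 : ∀ n : ℕ, ((4⁻¹ : ℝ≥0∞)) ^ n ≠ 0 := fun n => by simp
  choose g hgN hg using fun n : ℕ => hNd f hf (4⁻¹ ^ n) (h4 n)
  refine ⟨g, hgN, fun n => ?_, ?_⟩
  · have h1 : (fun ξ => g (n + 1) ξ - g n ξ) = (f - g n) - (f - g (n + 1)) := by
      ext ξ; simp
    rw [h1]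
    refine (eLpNorm_sub_le (hf.1.sub (hNm _ (hgN n)).1) (hf.1.sub (hNm _ (hgN (n + 1))).1)
      (by norm_num)).trans ?_
    rw [two_mul]
    refine add_le_add (hg n) ((hg (n + 1)).trans ?_)
    exact pow_le_pow_right_of_le_one' (ENNReal.inv_le_one.2 (by norm_num)) (Nat.le_succ n)
  · refine tendsto_of_tendsto_of_tendsto_of_le_of_le tendsto_const_nhds
      (ENNReal.tendsto_pow_atTop_nhds_zero_of_lt_one (r := 4⁻¹) ?_) (fun _ => bot_le) fun n => ?_
    · exact ENNReal.inv_lt_one.2 (by norm_num)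
    · rw [eLpNorm_sub_comm]; exact hg n

/-- Extension by density of a Strichartz estimate, together with existence of the flow. -/
lemma exists_isFlow_of_dense {p q : ℝ} (hp : 1 ≤ p) (hq : 1 < q) {σ : ℝ → ℝ → ℂ}
    (hσ : IsSymbol σ) {N : (ℝ → ℂ) → Prop} (hNm : ∀ g, N g → Measurable g ∧ MemLp g 2)
    (hNi : ∀ g, N g → ∀ t, Integrable fun ξ => σ t ξ * g ξ)
    (hNs : ∀ f g, N f → N g → N (fun ξ => f ξ - g ξ))
    (hNd : ∀ f : ℝ → ℂ, MemLp f 2 → ∀ δ : ℝ≥0∞, δ ≠ 0 → ∃ g, N g ∧ eLpNorm (f - g) 2 ≤ δ)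
    {C : ℝ≥0∞} (hC : C ≠ ∞)
    (hS : ∀ g, N g → mixedEnergy p q (fun t x => invFT (fun ξ => σ t ξ * g ξ) x) ≤
      C * eLpNorm g 2 ^ p) {f : ℝ → ℂ} (hf : MemLp f 2) :
    ∃ F, IsFlow σ f F ∧ mixedEnergy p q F ≤ C * eLpNorm f 2 ^ p := by
  have hp0 : 0 < p := by linarith
  have hq0 : 0 < q := by linarith
  obtain ⟨g, hgN, hdiff, hgf⟩ := exists_approx_seq (fun g hg => (hNm g hg).2) hNd hf
  have hFm : ∀ n, Measurable (Function.uncurry fun t x => invFT (fun ξ => σ t ξ * g n ξ) x) :=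
    fun n => measurable_uncurry_invFT (hσ.measurable.mul ((hNm _ (hgN n)).1.comp measurable_snd))
  -- The class is closed under differences, so the estimate applies to consecutive approximants and
  -- their flows form a fast Cauchy sequence.
  obtain ⟨G, hGm, hG', hGlim⟩ := exists_limit_of_mixedEnergy hp hq hFm hC fun n => by
    have h1 := hS _ (hNs _ _ (hgN (n + 1)) (hgN n))
    have h2 : ∀ t x, invFT (fun ξ => σ t ξ * (g (n + 1) ξ - g n ξ)) x =
        invFT (fun ξ => σ t ξ * g (n + 1) ξ) x - invFT (fun ξ => σ t ξ * g n ξ) x := by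
      intro t x
      simp only [mul_sub]
      exact invFT_sub (hNi _ (hgN (n + 1)) t) (hNi _ (hgN n) t) x
    simp only [h2] at h1
    exact h1.trans (mul_le_mul_right (ENNReal.rpow_le_rpow (hdiff n) hp0.le) _)
  refine ⟨G, ⟨hGm, ?_⟩, ?_⟩
  · filter_upwards [hGlim] with t hlim
    exact pairing_of_tendsto hq hσ hf (fun n => (hNm _ (hgN n)).2) t (fun n => hNi _ (hgN n) t) hgf
      (hGm.comp measurable_prodMk_left) hlim
  · refine (mixedEnergy_le_liminf hp0.le hq0 hFm hG').trans ?_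
    exact liminf_le_of_eLpNorm hp0 hC hf (fun n => (hNm _ (hgN n)).2) hgf fun n => hS _ (hgN n)

/-- Annular functions are dense in `L²`. -/
lemma exists_isAnnular_eLpNorm_sub_le {f : ℝ → ℂ} (hf : MemLp f 2) {δ : ℝ≥0∞} (hδ : δ ≠ 0) :
    ∃ g, IsAnnular g ∧ eLpNorm (f - g) 2 ≤ δ := by
  set f' := hf.1.mk f with hf'
  have hm : Measurable f' := hf.1.stronglyMeasurable_mk.measurable
  have hff' : f =ᵐ[volume] f' := hf.1.ae_eq_mk
  -- Truncation to these annuli, which exhaust the nonzero frequencies; dominated convergence does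
  -- the rest.
  set A : ℕ → Set ℝ := fun n => {ξ | 1 / ((n : ℝ) + 1) ≤ |ξ| ∧ |ξ| ≤ n + 1} with hA
  have hAm : ∀ n, MeasurableSet (A n) := fun n =>
    (measurableSet_le measurable_const measurable_id.abs).inter
      (measurableSet_le measurable_id.abs measurable_const)
  set g : ℕ → ℝ → ℂ := fun n => (A n).indicator f' with hg
  have hgA : ∀ n, IsAnnular (g n) := by
    intro n
    refine ⟨hm.indicator (hAm n), (hf.ae_eq hff').indicator (hAm n), 1 / ((n : ℝ) + 1), n + 1,
      by positivity, ?_, fun ξ h => ?_⟩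
    · rw [div_le_iff₀ (by positivity)]
      nlinarith [(n.cast_nonneg : (0 : ℝ) ≤ n)]
    · have h' : ξ ∈ A n := Set.mem_of_indicator_ne_zero h
      exact h'
  have hlim : Tendsto (fun n => ∫⁻ ξ, ‖(f - g n) ξ‖ₑ ^ 2) atTop (𝓝 (∫⁻ _ : ℝ, (0 : ℝ≥0∞))) := by
    refine tendsto_lintegral_of_dominated_convergence' (fun ξ => ‖f ξ‖ₑ ^ 2) (fun n => ?_)
      (fun n => ?_) ?_ ?_
    · exact ((hf.1.sub (hgA n).memLp.1).enorm.pow_const 2)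
    · filter_upwards [hff'] with ξ hξ
      by_cases h : ξ ∈ A n
      · simp [hg, h, hξ]
      · simp [hg, h]
    · rw [← eLpNorm_two_sq]; exact ENNReal.pow_ne_top hf.eLpNorm_ne_top
    · have h0 : ∀ᵐ ξ : ℝ, ξ ≠ 0 := by simp [ae_iff]
      filter_upwards [hff', h0] with ξ hξ hξ0
      have hpos : 0 < |ξ| := abs_pos.2 hξ0
      obtain ⟨n₁, h1⟩ := exists_nat_one_div_lt hpos
      obtain ⟨n₂, h2⟩ := exists_nat_ge |ξ|
      refine tendsto_const_nhds.congr' ?_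
      filter_upwards [eventually_ge_atTop (max n₁ n₂)] with n hn
      have hn1 : (n₁ : ℝ) ≤ n := by exact_mod_cast (le_max_left _ _).trans hn
      have hn2 : (n₂ : ℝ) ≤ n := by exact_mod_cast (le_max_right _ _).trans hn
      have hmem : ξ ∈ A n :=
        ⟨(one_div_le_one_div_of_le (by positivity) (by linarith)).trans h1.le, by linarith⟩
      simp [hg, hmem, hξ]
  rw [lintegral_zero] at hlim
  obtain ⟨n, hn⟩ := (hlim.eventually_lt_const
    (pos_iff_ne_zero.2 (pow_ne_zero 2 hδ))).exists
  refine ⟨g n, hgA n, ?_⟩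
  rw [← eLpNorm_two_sq] at hn
  exact le_of_not_gt fun h => hn.not_ge (pow_le_pow_left' h.le 2)

lemma IsAnnular.sub {f g : ℝ → ℂ} (hf : IsAnnular f) (hg : IsAnnular g) :
    IsAnnular fun ξ => f ξ - g ξ := by
  obtain ⟨a, b, ha, hab, hs⟩ := hf.support
  obtain ⟨a', b', ha', hab', hs'⟩ := hg.support
  refine ⟨hf.measurable.sub hg.measurable, hf.memLp.sub hg.memLp, min a a', max b b',
    lt_min ha ha', (min_le_left _ _).trans (hab.trans (le_max_left _ _)), fun ξ h => ?_⟩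
  by_cases h1 : f ξ = 0
  · have h2 : g ξ ≠ 0 := by rintro h2; simp [h1, h2] at h
    exact ⟨(min_le_right _ _).trans (hs' ξ h2).1, (hs' ξ h2).2.trans (le_max_right _ _)⟩
  · exact ⟨(min_le_left _ _).trans (hs ξ h1).1, (hs ξ h1).2.trans (le_max_left _ _)⟩

lemma lintegral_sq_rpow_half (f : ℝ → ℂ) (p : ℝ) :
    (∫⁻ ξ, ‖f ξ‖ₑ ^ 2) ^ (p / 2) = eLpNorm f 2 ^ p := by
  rw [← eLpNorm_two_sq, ← ENNReal.rpow_ofNat, ← ENNReal.rpow_mul]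
  congr 1; ring

/-- The Strichartz estimate for the Airy flow. -/
lemma exists_strichartz_airy {p q : ℝ} (hp : 4 < p) (hpq : 2 / p + 1 / q = 1 / 2) :
    ∃ C : ℝ≥0∞, C ≠ ∞ ∧ ∀ f : ℝ → ℂ, MemLp f 2 →
      (∃ F, IsFlow (airySymbol (1 / p)) f F) ∧
      ∀ F, IsFlow (airySymbol (1 / p)) f F → mixedEnergy p q F ≤ C * eLpNorm f 2 ^ p := by
  have hq := two_lt_of_admissible hp hpq
  obtain ⟨C, hC, hS⟩ := exists_strichartz_airy_annular hp hpq
  have hσ : IsSymbol (airySymbol (1 / p)) :=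
    isSymbol_airySymbol (by positivity) (by rw [div_le_one (by linarith)]; linarith)
  refine ⟨C, hC, fun f hf => ?_⟩
  obtain ⟨F, hF, hFC⟩ := exists_isFlow_of_dense (by linarith) (by linarith) hσ (N := IsAnnular)
    (fun g hg => ⟨hg.measurable, hg.memLp⟩) (fun g hg t => (hg.airySymbol_mul (1 / p) t).integrable)
    (fun f g hf hg => hf.sub hg)
    (fun f hf δ hδ => exists_isAnnular_eLpNorm_sub_le hf hδ) hC
    (fun g hg => (hS g hg).trans (by rw [lintegral_sq_rpow_half])) hf
  refine ⟨⟨F, hF⟩, fun G hG => ?_⟩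
  rwa [mixedEnergy_congr (hG.ae_eq hF)]

lemma isAiryFlow_iff {p : ℝ} {u : L2} {Ψ : ℝ → ℝ → ℂ} :
    IsAiryFlow p u Ψ ↔ IsFlow (airySymbol (1 / p)) (hat u) Ψ := Iff.rfl

/-! ### Rescaling a frequency bubble -/

/-- Anisotropic scaling with a Galilean shift. -/
lemma mixedEnergy_scale {p q : ℝ} (hp : 0 < p) (hq : 0 < q) (hpq : 2 / p + 1 / q = 1 / 2)
    {ε : ℝ} (hε : 0 < ε) (H : ℝ → ℝ → ℂ) :
    mixedEnergy p q (fun t x => (ε : ℂ) * H (ε ^ 2 * t) (ε * x + 3 * ε * t)) =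
      ENNReal.ofReal ε ^ (p / 2) * mixedEnergy p q H := by
  have hr : 0 ≤ p / q := by positivity
  set e := ENNReal.ofReal ε with he
  have he0 : e ≠ 0 := by simpa [he] using hε
  have het : e ≠ ∞ := ENNReal.ofReal_ne_top
  have hei : ENNReal.ofReal |ε⁻¹| = e⁻¹ := by
    rw [abs_of_pos (by positivity), ENNReal.ofReal_inv_of_pos hε]
  have hei2 : ENNReal.ofReal |(ε ^ 2)⁻¹| = e⁻¹ ^ 2 := by
    rw [abs_of_pos (by positivity), ← inv_pow, ENNReal.ofReal_pow (by positivity),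
      ENNReal.ofReal_inv_of_pos hε]
  have h1 : ∀ t, (∫⁻ x, ‖(ε : ℂ) * H (ε ^ 2 * t) (ε * x + 3 * ε * t)‖ₑ ^ q) ^ (p / q) =
      (e ^ q * e⁻¹) ^ (p / q) * (∫⁻ x, ‖H (ε ^ 2 * t + 0) x‖ₑ ^ q) ^ (p / q) := by
    intro t
    rw [← ENNReal.mul_rpow_of_nonneg _ _ hr]
    congr 1
    have h2 : ∀ x, ‖(ε : ℂ) * H (ε ^ 2 * t) (ε * x + 3 * ε * t)‖ₑ ^ q =
        e ^ q * ‖H (ε ^ 2 * t) (ε * x + 3 * ε * t)‖ₑ ^ q := by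
      intro x
      rw [enorm_mul, ENNReal.mul_rpow_of_nonneg _ _ hq.le, ← ofReal_norm (ε : ℂ),
        Complex.norm_real, Real.norm_of_nonneg hε.le]
    simp only [h2]
    rw [lintegral_const_mul' _ _ (ENNReal.rpow_ne_top_of_nonneg hq.le het),
      lintegral_comp_affine (fun x => ‖H (ε ^ 2 * t) x‖ₑ ^ q) hε.ne' (3 * ε * t), hei, mul_assoc,
      add_zero]
  have het' : e⁻¹ ≠ ∞ := ENNReal.inv_ne_top.2 he0
  simp only [mixedEnergy, h1]
  rw [lintegral_const_mul' _ _ (ENNReal.rpow_ne_top_of_nonneg hr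
      (ENNReal.mul_ne_top (ENNReal.rpow_ne_top_of_nonneg hq.le het) het')),
    lintegral_comp_affine (fun t => (∫⁻ x, ‖H t x‖ₑ ^ q) ^ (p / q)) (pow_pos hε 2).ne' 0, hei2,
    ← mul_assoc]
  congr 1
  rw [← ENNReal.rpow_neg_one, ← ENNReal.rpow_add _ _ he0 het, ← ENNReal.rpow_mul,
    ← ENNReal.rpow_ofNat, ← ENNReal.rpow_mul, ← ENNReal.rpow_add _ _ he0 het]
  congr 1
  -- Exponent count: the amplitude and dx give p(1 − 1/q), dt gives −2, and admissibility turns the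
  -- sum into p/2.
  have h3 : 1 / q = 1 / 2 - 2 / p := by linarith
  have h4 : (q + -1) * (p / q) = p * (1 - 1 / q) := by field_simp; ring
  rw [h4, h3]
  have : p * (2 / p) = 2 := by field_simp
  norm_num
  linarith

lemma integral_comp_sub_div {E : Type*} [NormedAddCommGroup E] [NormedSpace ℝ E] (F : ℝ → E)
    (c : ℝ) {ε : ℝ} (hε : 0 < ε) : ∫ ξ, F ((ξ - c) / ε) = ε • ∫ η, F η := by
  have h1 := integral_sub_right_eq_self (μ := volume) (fun ξ => F (ξ / ε)) c
  rw [h1, Measure.integral_comp_div, abs_of_pos hε]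

/-- The symbol of the rescaled Airy flow near a frequency bubble. -/
def profileSymbol (s ε T η : ℝ) : ℂ :=
  ((|1 + ε * η| ^ s : ℝ) : ℂ) * Complex.exp (Complex.I * (T * (3 * η ^ 2 + ε * η ^ 3) : ℝ))

/-- The rescaled Airy flow of a frequency bubble with profile `g`. -/
def profile (s : ℝ) (g : ℝ → ℂ) (ε T X : ℝ) : ℂ := invFT (fun η => profileSymbol s ε T η * g η) X

/-- The two-bubble datum on the Fourier side. -/
def twoBubble (g : ℝ → ℂ) (ε ξ : ℝ) : ℂ := g ((ξ - 1) / ε) + conj (g (-((ξ + 1) / ε)))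

/-- Substitute ξ = 1 + εη and expand the cube: the constant terms give the carrier, the linear terms
the moving coordinate, and the rest the profile symbol at time ε²t. The prefactor ε is the Jacobian.
-/
lemma invFT_airySymbol_bubble (s : ℝ) (g : ℝ → ℂ) {ε : ℝ} (hε : 0 < ε) (t x : ℝ) :
    invFT (fun ξ => airySymbol s t ξ * g ((ξ - 1) / ε)) x =
      ε * (Complex.exp (Complex.I * (x + t : ℝ)) *
        profile s g ε (ε ^ 2 * t) (ε * x + 3 * ε * t)) := by
  have h1 : ∀ ξ : ℝ, Complex.exp (Complex.I * ξ * x) * (airySymbol s t ξ * g ((ξ - 1) / ε)) =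
      (fun η : ℝ => Complex.exp (Complex.I * (x + t : ℝ)) *
        (Complex.exp (Complex.I * η * ((ε * x + 3 * ε * t : ℝ) : ℂ)) *
          (profileSymbol s ε (ε ^ 2 * t) η * g η))) ((ξ - 1) / ε) := by
    intro ξ
    have hξ : 1 + ε * ((ξ - 1) / ε) = ξ := by field_simp; ring
    have he : Complex.exp (Complex.I * ξ * x) * Complex.exp (Complex.I * t * (ξ : ℂ) ^ 3) =
        Complex.exp (Complex.I * (x + t : ℝ)) *
        Complex.exp (Complex.I * ((ξ - 1) / ε : ℝ) * ((ε * x + 3 * ε * t : ℝ) : ℂ)) *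
        Complex.exp (Complex.I * (ε ^ 2 * t * (3 * ((ξ - 1) / ε) ^ 2 +
          ε * ((ξ - 1) / ε) ^ 3) : ℝ)) := by
      rw [← Complex.exp_add, ← Complex.exp_add, ← Complex.exp_add]
      congr 1
      have hε' : (ε : ℂ) ≠ 0 := by exact_mod_cast hε.ne'
      push_cast
      field_simp
      ring
    simp only [airySymbol, profileSymbol, hξ]
    linear_combination ((|ξ| ^ s : ℝ) : ℂ) * g ((ξ - 1) / ε) * he
  rw [invFT, profile, invFT]
  have h2 := integral_comp_sub_div (fun η : ℝ => Complex.exp (Complex.I * (x + t : ℝ)) *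
    (Complex.exp (Complex.I * η * ((ε * x + 3 * ε * t : ℝ) : ℂ)) *
      (profileSymbol s ε (ε ^ 2 * t) η * g η))) 1 hε
  rw [integral_congr_ae (Eventually.of_forall h1), h2, integral_const_mul, Complex.real_smul]
  ring

lemma conj_exp_I_mul_mul (a b : ℝ) :
    conj (Complex.exp (Complex.I * a * b)) = Complex.exp (Complex.I * (-a : ℝ) * b) := by
  rw [← Complex.exp_conj]
  congr 1
  simp

lemma invFT_conj_neg (k : ℝ → ℂ) (x : ℝ) :
    invFT (fun ξ => conj (k (-ξ))) x = conj (invFT k x) := by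
  simp only [invFT]
  rw [map_mul, ← integral_conj, ← integral_neg_eq_self (fun ξ : ℝ => conj _)]
  congr 1
  · simp
  · refine integral_congr_ae (Eventually.of_forall fun ξ => ?_)
    simp only [map_mul, conj_exp_I_mul_mul, neg_neg]

lemma conj_airySymbol_neg (s t ξ : ℝ) : conj (airySymbol s t (-ξ)) = airySymbol s t ξ := by
  simp only [airySymbol, map_mul, ← Complex.exp_conj, abs_neg]
  congr 2
  · simp
  · simp only [map_pow, Complex.conj_I, Complex.conj_ofReal]
    push_cast
    ring

/-- Reflecting ξ and conjugating fixes the Airy symbol, the equation being real; so the bubble at −1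
evolves as the conjugate of the one at 1. -/
lemma invFT_airySymbol_bubble_conj (s : ℝ) (g : ℝ → ℂ) (ε t x : ℝ) :
    invFT (fun ξ => airySymbol s t ξ * conj (g (-((ξ + 1) / ε)))) x =
      conj (invFT (fun ξ => airySymbol s t ξ * g ((ξ - 1) / ε)) x) := by
  rw [← invFT_conj_neg]
  congr 1; ext ξ
  rw [map_mul, conj_airySymbol_neg, show (-ξ - 1) / ε = -((ξ + 1) / ε) by ring]

lemma profile_zero (s : ℝ) (g : ℝ → ℂ) (T X : ℝ) :
    profile s g 0 T X = invFT (fun η => Complex.exp (3 * Complex.I * T * η ^ 2) * g η) X := by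
  rw [profile]
  congr 1; ext η
  simp only [profileSymbol, zero_mul, add_zero, abs_one, Real.one_rpow, Complex.ofReal_one, one_mul]
  congr 2
  push_cast
  ring

/-! ### Dispersion at unit frequency, uniform bounds for profiles -/

lemma norm_inv_sqrt_mul_le (z : ℂ) : ‖((Real.sqrt (2 * Real.pi) : ℝ) : ℂ)⁻¹ * z‖ ≤ ‖z‖ := by
  rw [norm_mul]
  exact mul_le_of_le_one_left (norm_nonneg _) norm_inv_sqrt_two_pi_le

lemma hasDerivAt_airyKer (t x a b : ℝ) : HasDerivAt (fun ξ => airyKer t x a ξ)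
    ((Real.sqrt b : ℂ) * Complex.exp (Complex.I * (t * b ^ 3 + x * b : ℝ))) b := by
  have hc := continuous_airyKer_integrand t x
  exact intervalIntegral.integral_hasDerivAt_right (hc.intervalIntegrable _ _)
    (hc.stronglyMeasurableAtFilter _ _) hc.continuousAt

lemma rpow_le_two_of_half_le {c ξ : ℝ} (hc : -1 ≤ c) (hc0 : c ≤ 0) (hξ : 1 / 2 ≤ ξ) :
    ξ ^ c ≤ 2 := by
  calc ξ ^ c ≤ (1 / 2 : ℝ) ^ c := Real.rpow_le_rpow_of_nonpos (by norm_num) hξ hc0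
    _ ≤ (1 / 2 : ℝ) ^ (-1 : ℝ) := Real.rpow_le_rpow_of_exponent_ge (by norm_num) (by norm_num) hc
    _ = 2 := by rw [Real.rpow_neg_one]; norm_num

/-- Dispersive estimate for the Airy flow of data at unit frequency. -/
lemma norm_invFT_airySymbol_le {h : ℝ → ℂ} (hh : ContDiff ℝ 1 h)
    (hs : ∀ ξ, h ξ ≠ 0 → 1 / 2 < ξ ∧ ξ < 3 / 2) {s : ℝ} (hs0 : 0 ≤ s) (hs1 : s ≤ 1 / 2) {t : ℝ}
    (ht : t ≠ 0) (x : ℝ) :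
    ‖invFT (fun ξ => airySymbol s t ξ * h ξ) x‖ ≤
      4 / Real.sqrt |t| * (2 * (∫ ξ, ‖h ξ‖) + 2 * ∫ ξ, ‖deriv h ξ‖) := by
  have hcs : HasCompactSupport h := by
    refine HasCompactSupport.intro (K := Set.Icc (1 / 2) (3 / 2)) isCompact_Icc fun ξ hξ => ?_
    by_contra h0
    exact hξ ⟨(hs ξ h0).1.le, (hs ξ h0).2.le⟩
  have hint : Integrable h := hh.continuous.integrable_of_hasCompactSupport hcs
  have hdc : Continuous (deriv h) := hh.continuous_deriv le_rfl
  have hdint : Integrable (deriv h) := hdc.integrable_of_hasCompactSupport hcs.deriv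
  -- Write ξ^s = ξ^c √ξ. The factor √ξ e^{i(tξ³ + xξ)} has the truncated Airy kernel as primitive,
  -- bounded by 4|t|^{-1/2}, so one integration by parts puts the derivative on ξ^c h. The boundary
  -- terms vanish by the support condition, and on [1/2, 3/2] the powers of ξ are bounded by 2.
  set c := s - 1 / 2 with hc
  set u : ℝ → ℂ := fun ξ => ((ξ ^ c : ℝ) : ℂ) * h ξ with hu
  set u' : ℝ → ℂ := fun ξ => ((c * ξ ^ (c - 1) : ℝ) : ℂ) * h ξ + ((ξ ^ c : ℝ) : ℂ) * deriv h ξ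
    with hu'
  set v' : ℝ → ℂ := fun ξ => (Real.sqrt ξ : ℂ) * Complex.exp (Complex.I * (t * ξ ^ 3 + x * ξ : ℝ))
    with hv'
  have hpos : ∀ ξ ∈ Set.uIcc (1 / 2 : ℝ) (3 / 2), 1 / 2 ≤ ξ := by
    intro ξ hξ
    rw [Set.uIcc_of_le (by norm_num)] at hξ
    exact hξ.1
  have hude : ∀ ξ ∈ Set.uIcc (1 / 2 : ℝ) (3 / 2), HasDerivAt u (u' ξ) ξ := by
    intro ξ hξ
    have h0 : ξ ≠ 0 := by have := hpos ξ hξ; linarith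
    exact (Real.hasDerivAt_rpow_const (Or.inl h0)).ofReal_comp.mul
      ((hh.differentiable one_ne_zero).differentiableAt.hasDerivAt)
  have hu'c : ContinuousOn u' (Set.uIcc (1 / 2 : ℝ) (3 / 2)) := by
    have hr : ∀ d : ℝ, ContinuousOn (fun ξ : ℝ => ((ξ ^ d : ℝ) : ℂ))
        (Set.uIcc (1 / 2 : ℝ) (3 / 2)) := fun d =>
      Complex.continuous_ofReal.comp_continuousOn (continuousOn_id.rpow_const fun ξ hξ =>
        Or.inl (by have := hpos ξ hξ; simp only [id]; linarith))
    have := ((continuousOn_const (c := (c : ℂ))).mul (hr (c - 1))).mul hh.continuous.continuousOn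
    refine (this.add ((hr c).mul hdc.continuousOn)).congr fun ξ _ => ?_
    simp [hu']
  have hv'c : Continuous v' := continuous_airyKer_integrand t x
  have hend : ∀ ξ, ¬ (1 / 2 < ξ ∧ ξ < 3 / 2) → h ξ = 0 := fun ξ => not_imp_comm.1 (hs ξ)
  have e1 : ∫ ξ : ℝ, Complex.exp (Complex.I * ξ * x) * (airySymbol s t ξ * h ξ) =
      ∫ ξ in (1 / 2 : ℝ)..(3 / 2), u ξ * v' ξ := by
    rw [← intervalIntegral.integral_eq_integral_of_support_subset (a := 1 / 2) (b := 3 / 2)]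
    · refine intervalIntegral.integral_congr fun ξ hξ => ?_
      have hξ0 : 0 < ξ := by have := hpos ξ hξ; linarith
      have h2 : ξ ^ s = ξ ^ c * Real.sqrt ξ := by
        rw [Real.sqrt_eq_rpow, ← Real.rpow_add hξ0, hc]; congr 1; ring
      have h3 : Complex.exp (Complex.I * (t * ξ ^ 3 + x * ξ : ℝ)) =
          Complex.exp (Complex.I * ξ * x) * Complex.exp (Complex.I * t * (ξ : ℂ) ^ 3) := by
        rw [← Complex.exp_add]; congr 1; push_cast; ring
      simp only [airySymbol, hu, hv', abs_of_pos hξ0, h2, h3]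
      push_cast; ring
    · intro ξ hξ
      have h0 : h ξ ≠ 0 := fun h0 => hξ (by simp [h0])
      exact ⟨(hs ξ h0).1, (hs ξ h0).2.le⟩
  have e2 := intervalIntegral.integral_mul_deriv_eq_deriv_mul hude
    (fun ξ _ => hasDerivAt_airyKer t x (1 / 2) ξ) hu'c.intervalIntegrable
    (hv'c.intervalIntegrable _ _)
  have hu1 : u (3 / 2) = 0 := by simp only [hu]; rw [hend _ (by norm_num), mul_zero]
  have hu2 : u (1 / 2) = 0 := by simp only [hu]; rw [hend _ (by norm_num), mul_zero]
  have hbound : ∀ ξ ∈ Set.Icc (1 / 2 : ℝ) (3 / 2), ‖u' ξ * airyKer t x (1 / 2) ξ‖ ≤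
      4 / Real.sqrt |t| * (2 * ‖h ξ‖ + 2 * ‖deriv h ξ‖) := by
    intro ξ hξ
    rw [norm_mul, mul_comm]
    have hξ0 : 0 < ξ := by linarith [hξ.1]
    refine mul_le_mul (norm_airyKer_le x ht (by norm_num) hξ.1) ?_ (norm_nonneg _) (by positivity)
    refine (norm_add_le _ _).trans (add_le_add ?_ ?_)
    · rw [norm_mul, Complex.norm_real]
      gcongr
      have h1 : ξ ^ (c - 1) = ξ ^ c * ξ⁻¹ := by rw [Real.rpow_sub_one hξ0.ne', div_eq_mul_inv]
      have h2 : ξ ^ c ≤ 2 := rpow_le_two_of_half_le (by linarith) (by linarith) hξ.1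
      have h3 : ξ⁻¹ ≤ 2 := by
        rw [inv_le_comm₀ hξ0 (by norm_num)]; linarith [hξ.1]
      rw [Real.norm_eq_abs, abs_mul, h1, abs_of_pos (mul_pos (Real.rpow_pos_of_pos hξ0 c)
        (inv_pos.2 hξ0))]
      have h4 : |c| ≤ 1 / 2 := by rw [abs_le]; constructor <;> linarith
      calc |c| * (ξ ^ c * ξ⁻¹) ≤ 1 / 2 * (2 * 2) := by gcongr
        _ = 2 := by norm_num
    · rw [norm_mul, Complex.norm_real, Real.norm_of_nonneg (by positivity)]
      gcongr
      exact rpow_le_two_of_half_le (by linarith) (by linarith) hξ.1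
  have hdom : Integrable fun ξ => 4 / Real.sqrt |t| * (2 * ‖h ξ‖ + 2 * ‖deriv h ξ‖) :=
    ((hint.norm.const_mul 2).add (hdint.norm.const_mul 2)).const_mul _
  refine (norm_inv_sqrt_mul_le _).trans ?_
  rw [e1, e2, hu1, hu2]
  simp only [zero_mul, sub_zero, zero_sub, norm_neg]
  calc _ ≤ ∫ ξ in (1 / 2 : ℝ)..(3 / 2), 4 / Real.sqrt |t| * (2 * ‖h ξ‖ + 2 * ‖deriv h ξ‖) := by
        refine intervalIntegral.norm_integral_le_of_norm_le (by norm_num)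
          (Eventually.of_forall fun ξ hξ => hbound ξ ⟨hξ.1.le, hξ.2⟩) ?_
        exact hdom.intervalIntegrable
    _ ≤ ∫ ξ, 4 / Real.sqrt |t| * (2 * ‖h ξ‖ + 2 * ‖deriv h ξ‖) := by
        rw [intervalIntegral.integral_of_le (by norm_num)]
        exact setIntegral_le_integral hdom (Eventually.of_forall fun ξ => by positivity)
    _ = _ := by
        rw [integral_const_mul, integral_add (hint.norm.const_mul 2) (hdint.norm.const_mul 2),
          integral_const_mul, integral_const_mul]

/-- Continuously differentiable functions supported in `(-R, R)`. -/
structure IsBump (g : ℝ → ℂ) (R : ℝ) : Prop where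
  contDiff : ContDiff ℝ 1 g
  pos : 0 < R
  support : ∀ η, g η ≠ 0 → |η| < R

lemma IsBump.hasCompactSupport {g : ℝ → ℂ} {R : ℝ} (hg : IsBump g R) : HasCompactSupport g := by
  refine HasCompactSupport.intro (K := Set.Icc (-R) R) isCompact_Icc fun η hη => ?_
  by_contra h0
  exact hη (abs_le.1 (hg.support η h0).le)

lemma IsBump.integrable {g : ℝ → ℂ} {R : ℝ} (hg : IsBump g R) : Integrable g :=
  hg.contDiff.continuous.integrable_of_hasCompactSupport hg.hasCompactSupport

lemma IsBump.memLp {g : ℝ → ℂ} {R : ℝ} (hg : IsBump g R) : MemLp g 2 :=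
  hg.contDiff.continuous.memLp_of_hasCompactSupport hg.hasCompactSupport

lemma exists_isBump_eLpNorm_sub_le {f : ℝ → ℂ} (hf : MemLp f 2) {δ : ℝ≥0∞} (hδ : δ ≠ 0) :
    ∃ g, (∃ R, IsBump g R) ∧ eLpNorm (f - g) 2 ≤ δ := by
  obtain ⟨δ', hδ', hδδ⟩ : ∃ δ' : ℝ, 0 < δ' ∧ ENNReal.ofReal δ' ≤ δ := by
    by_cases ht : δ = ∞
    · exact ⟨1, one_pos, by simp [ht]⟩
    · exact ⟨δ.toReal, ENNReal.toReal_pos hδ ht, ENNReal.ofReal_toReal_le⟩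
  obtain ⟨g, hgc, hgd, hg⟩ := hf.exist_eLpNorm_sub_le (by norm_num) (by norm_num) hδ'
  refine ⟨g, ?_, hg.trans hδδ⟩
  obtain ⟨R, hR⟩ := hgc.isCompact.isBounded.subset_ball (0 : ℝ)
  refine ⟨max R 1, hgd.of_le (by exact_mod_cast le_top), by positivity, fun η hη => ?_⟩
  have := hR (subset_tsupport g hη)
  rw [mem_ball_zero_iff, Real.norm_eq_abs] at this
  exact this.trans_le (le_max_left _ _)

lemma IsBump.sub {f g : ℝ → ℂ} {R S : ℝ} (hf : IsBump f R) (hg : IsBump g S) :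
    IsBump (fun η => f η - g η) (max R S) := by
  refine ⟨hf.contDiff.sub hg.contDiff, lt_max_of_lt_left hf.pos, fun η h => ?_⟩
  by_cases h1 : f η = 0
  · have h2 : g η ≠ 0 := by rintro h2; simp [h1, h2] at h
    exact (hg.support η h2).trans_le (le_max_right _ _)
  · exact (hf.support η h1).trans_le (le_max_left _ _)

lemma norm_profileSymbol (s ε T η : ℝ) : ‖profileSymbol s ε T η‖ = |1 + ε * η| ^ s := by
  rw [profileSymbol, norm_mul, mul_comm Complex.I, Complex.norm_exp_ofReal_mul_I, mul_one,
    Complex.norm_real, Real.norm_of_nonneg (by positivity)]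

lemma measurable_profileSymbol (s ε : ℝ) :
    Measurable (Function.uncurry fun T η => profileSymbol s ε T η) := by
  simp only [profileSymbol, Function.uncurry_def]
  fun_prop

/-- For ε ≤ 1/(2R) the bubble stays within 1/2 of its center, hence away from the singularity of
|ξ|^s at 0 and disjoint from the other bubble. -/
lemma IsBump.abs_mul_lt {g : ℝ → ℂ} {R : ℝ} (hg : IsBump g R) {ε : ℝ} (hε0 : 0 ≤ ε)
    (hε : ε ≤ 1 / (2 * R)) {η : ℝ} (hη : g η ≠ 0) : |ε * η| < 1 / 2 := by
  have hR := hg.pos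
  rcases hε0.eq_or_lt with rfl | h0
  · norm_num
  rw [abs_mul, abs_of_pos h0]
  calc ε * |η| < ε * R := by gcongr; exact hg.support η hη
    _ ≤ 1 / (2 * R) * R := by gcongr
    _ = 1 / 2 := by field_simp

lemma IsBump.norm_profileSymbol_mul_le {g : ℝ → ℂ} {R : ℝ} (hg : IsBump g R) {s : ℝ} (hs0 : 0 ≤ s)
    (hs1 : s ≤ 1) {ε : ℝ} (hε0 : 0 ≤ ε) (hε : ε ≤ 1 / (2 * R)) (T η : ℝ) :
    ‖profileSymbol s ε T η * g η‖ ≤ 2 * ‖g η‖ := by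
  by_cases hη : g η = 0
  · simp [hη]
  have h1 := abs_lt.1 (hg.abs_mul_lt hε0 hε hη)
  rw [norm_mul, norm_profileSymbol]
  gcongr
  calc |1 + ε * η| ^ s ≤ 2 ^ s := by
        refine Real.rpow_le_rpow (abs_nonneg _) ?_ hs0
        rw [abs_le]; constructor <;> linarith [h1.1, h1.2]
    _ ≤ 2 ^ (1 : ℝ) := Real.rpow_le_rpow_of_exponent_le (by norm_num) hs1
    _ = 2 := Real.rpow_one 2

lemma IsBump.measurable_profileSymbol_mul {g : ℝ → ℂ} {R : ℝ} (hg : IsBump g R) (s ε T : ℝ) :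
    Measurable fun η => profileSymbol s ε T η * g η :=
  ((measurable_profileSymbol s ε).comp measurable_prodMk_left).mul hg.contDiff.continuous.measurable

lemma IsBump.integrable_profileSymbol_mul {g : ℝ → ℂ} {R : ℝ} (hg : IsBump g R) {s : ℝ}
    (hs0 : 0 ≤ s) (hs1 : s ≤ 1) {ε : ℝ} (hε0 : 0 ≤ ε) (hε : ε ≤ 1 / (2 * R)) (T : ℝ) :
    Integrable fun η => profileSymbol s ε T η * g η :=
  (hg.integrable.norm.const_mul 2).mono' (hg.measurable_profileSymbol_mul s ε T).aestronglyMeasurable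
    (Eventually.of_forall (hg.norm_profileSymbol_mul_le hs0 hs1 hε0 hε T))

lemma IsBump.memLp_profileSymbol_mul {g : ℝ → ℂ} {R : ℝ} (hg : IsBump g R) {s : ℝ}
    (hs0 : 0 ≤ s) (hs1 : s ≤ 1) {ε : ℝ} (hε0 : 0 ≤ ε) (hε : ε ≤ 1 / (2 * R)) (T : ℝ) :
    MemLp (fun η => profileSymbol s ε T η * g η) 2 :=
  hg.memLp.of_le_mul (hg.measurable_profileSymbol_mul s ε T).aestronglyMeasurable
    (Eventually.of_forall (hg.norm_profileSymbol_mul_le hs0 hs1 hε0 hε T))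

lemma IsBump.measurable_uncurry_profile {g : ℝ → ℂ} {R : ℝ} (hg : IsBump g R) (s ε : ℝ) :
    Measurable (Function.uncurry fun T X => profile s g ε T X) :=
  measurable_uncurry_invFT ((measurable_profileSymbol s ε).mul
    (hg.contDiff.continuous.measurable.comp measurable_snd))

lemma tendsto_profileSymbol {s : ℝ} (hs0 : 0 ≤ s) (T η : ℝ) :
    Tendsto (fun ε => profileSymbol s ε T η) (𝓝[>] 0) (𝓝 (profileSymbol s 0 T η)) := by
  have : Continuous fun ε : ℝ => profileSymbol s ε T η := by
    have h1 : Continuous fun ε : ℝ => |1 + ε * η| ^ s :=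
      (by fun_prop : Continuous fun ε : ℝ => |1 + ε * η|).rpow_const fun _ => Or.inr hs0
    simp only [profileSymbol]
    fun_prop
  exact (this.tendsto 0).mono_left nhdsWithin_le_nhds

/-- Interpolation between the sup norm and Plancherel's identity. -/
lemma lintegral_invFT_rpow_le {q : ℝ} (hq : 2 ≤ q) {k : ℝ → ℂ} (hk : Integrable k)
    (hk2 : MemLp k 2) {S : ℝ≥0∞} (hS : ∀ x, ‖invFT k x‖ₑ ≤ S) :
    ∫⁻ x, ‖invFT k x‖ₑ ^ q ≤ S ^ (q - 2) * ∫⁻ ξ, ‖k ξ‖ₑ ^ 2 := by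
  have hm : Measurable fun x => ‖invFT k x‖ₑ ^ 2 :=
    (continuous_invFT hk).measurable.enorm.pow_const 2
  rw [← lintegral_invFT_sq hk hk2, ← lintegral_const_mul _ hm]
  refine lintegral_mono fun x => ?_
  calc ‖invFT k x‖ₑ ^ q = ‖invFT k x‖ₑ ^ (q - 2) * ‖invFT k x‖ₑ ^ 2 := by
        rw [← ENNReal.rpow_ofNat, ← ENNReal.rpow_add_of_nonneg _ _ (by linarith) (by norm_num)]
        congr 1; ring
    _ ≤ S ^ (q - 2) * ‖invFT k x‖ₑ ^ 2 := by
        exact mul_le_mul_left (ENNReal.rpow_le_rpow (hS x) (by linarith)) _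

lemma eventually_small {R : ℝ} (hR : 0 < R) : ∀ᶠ ε : ℝ in 𝓝[>] 0, 0 < ε ∧ ε ≤ 1 / (2 * R) := by
  have h1 : (0 : ℝ) < 1 / (2 * R) := by positivity
  filter_upwards [self_mem_nhdsWithin, mem_nhdsWithin_of_mem_nhds (Iic_mem_nhds h1)] with ε h2 h3
  exact ⟨h2, h3⟩

/-- Dominated convergence on the frequency side. The case r = 1 controls the sup norm of the
difference of profiles and r = 2 its `L²` norm; together they give every q > 2. -/
lemma IsBump.tendsto_lintegral_profileSymbol_sub {g : ℝ → ℂ} {R : ℝ} (hg : IsBump g R) {s : ℝ}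
    (hs0 : 0 ≤ s) (hs1 : s ≤ 1) (T : ℝ) {r : ℝ} (hr : 0 < r)
    (hgr : ∫⁻ η, ‖g η‖ₑ ^ r ≠ ∞) :
    Tendsto (fun ε => ∫⁻ η, ‖profileSymbol s ε T η * g η - profileSymbol s 0 T η * g η‖ₑ ^ r)
      (𝓝[>] 0) (𝓝 0) := by
  have h0 : ∫⁻ _ : ℝ, (0 : ℝ≥0∞) = 0 := lintegral_zero
  rw [← h0]
  refine tendsto_lintegral_filter_of_dominated_convergence (fun η => (4 * ‖g η‖ₑ) ^ r)
    (Eventually.of_forall fun ε => ?_) ?_ ?_ ?_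
  · exact ((hg.measurable_profileSymbol_mul s ε T).sub
      (hg.measurable_profileSymbol_mul s 0 T)).enorm.pow_const r
  · filter_upwards [eventually_small hg.pos] with ε ⟨h1, h2⟩
    refine Eventually.of_forall fun η => ENNReal.rpow_le_rpow ?_ hr.le
    rw [← ofReal_norm, ← ofReal_norm, show (4 : ℝ≥0∞) = ENNReal.ofReal 4 by simp,
      ← ENNReal.ofReal_mul (by norm_num)]
    refine ENNReal.ofReal_le_ofReal ((norm_sub_le _ _).trans ?_)
    have := hg.norm_profileSymbol_mul_le hs0 hs1 h1.le h2 T η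
    have := hg.norm_profileSymbol_mul_le hs0 hs1 le_rfl (h1.le.trans h2) T η
    linarith
  · simp only [ENNReal.mul_rpow_of_nonneg _ _ hr.le]
    rw [lintegral_const_mul' _ _ (ENNReal.rpow_ne_top_of_nonneg hr.le (by norm_num))]
    exact ENNReal.mul_ne_top (ENNReal.rpow_ne_top_of_nonneg hr.le (by norm_num)) hgr
  · refine Eventually.of_forall fun η => ?_
    have h1 := ((tendsto_profileSymbol hs0 T η).mul_const (g η)).sub_const
      (profileSymbol s 0 T η * g η)
    rw [sub_self] at h1
    have h2 := (ENNReal.continuous_rpow_const (y := r)).tendsto _ |>.comp h1.enorm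
    rwa [enorm_zero, ENNReal.zero_rpow_of_pos hr] at h2

lemma IsBump.profile_sub {g : ℝ → ℂ} {R : ℝ} (hg : IsBump g R) {s : ℝ}
    (hs0 : 0 ≤ s) (hs1 : s ≤ 1) {ε : ℝ} (hε0 : 0 ≤ ε) (hε : ε ≤ 1 / (2 * R)) (T X : ℝ) :
    profile s g ε T X - profile s g 0 T X =
      invFT (fun η => profileSymbol s ε T η * g η - profileSymbol s 0 T η * g η) X :=
  (invFT_sub (hg.integrable_profileSymbol_mul hs0 hs1 hε0 hε T)
    (hg.integrable_profileSymbol_mul hs0 hs1 le_rfl (hε0.trans hε) T) X).symm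

lemma enorm_invFT_le (k : ℝ → ℂ) (hk : Integrable k) (x : ℝ) : ‖invFT k x‖ₑ ≤ ∫⁻ ξ, ‖k ξ‖ₑ := by
  rw [← ofReal_integral_norm_eq_lintegral_enorm hk, ← ofReal_norm]
  exact ENNReal.ofReal_le_ofReal (norm_invFT_le k x)

/-- Convergence of the rescaled flows in `L^q` at a fixed time. -/
lemma IsBump.tendsto_profile {g : ℝ → ℂ} {R : ℝ} (hg : IsBump g R) {s : ℝ}
    (hs0 : 0 ≤ s) (hs1 : s ≤ 1) {q : ℝ} (hq : 2 < q) (T : ℝ) :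
    Tendsto (fun ε => ∫⁻ X, ‖profile s g ε T X - profile s g 0 T X‖ₑ ^ q) (𝓝[>] 0) (𝓝 0) := by
  have hA := hg.tendsto_lintegral_profileSymbol_sub hs0 hs1 T (r := 1) one_pos
    (by simpa using hg.integrable.2.ne)
  have hB := hg.tendsto_lintegral_profileSymbol_sub hs0 hs1 T (r := 2) two_pos
    (by
      have := ENNReal.pow_ne_top (n := 2) hg.memLp.eLpNorm_ne_top
      rw [eLpNorm_two_sq] at this
      simpa only [ENNReal.rpow_ofNat] using this)
  have hA' := ((ENNReal.continuous_rpow_const (y := q - 2)).tendsto 0).comp hA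
  rw [ENNReal.zero_rpow_of_pos (by linarith)] at hA'
  have hAB := ENNReal.Tendsto.mul hA' (Or.inr (by simp)) hB (Or.inr (by simp))
  rw [zero_mul] at hAB
  refine tendsto_of_tendsto_of_tendsto_of_le_of_le' tendsto_const_nhds hAB
    (Eventually.of_forall fun _ => bot_le) ?_
  filter_upwards [eventually_small hg.pos] with ε ⟨h1, h2⟩
  simp only [hg.profile_sub hs0 hs1 h1.le h2]
  have i1 : Integrable fun η => profileSymbol s ε T η * g η - profileSymbol s 0 T η * g η :=
    (hg.integrable_profileSymbol_mul hs0 hs1 h1.le h2 T).sub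
    (hg.integrable_profileSymbol_mul hs0 hs1 le_rfl (h1.le.trans h2) T)
  have i2 : MemLp (fun η => profileSymbol s ε T η * g η - profileSymbol s 0 T η * g η) 2 :=
    (hg.memLp_profileSymbol_mul hs0 hs1 h1.le h2 T).sub
    (hg.memLp_profileSymbol_mul hs0 hs1 le_rfl (h1.le.trans h2) T)
  have := lintegral_invFT_rpow_le hq.le i1 i2 (enorm_invFT_le _ i1)
  simpa using this

lemma IsBump.tendsto_profile_pointwise {g : ℝ → ℂ} {R : ℝ} (hg : IsBump g R) {s : ℝ}
    (hs0 : 0 ≤ s) (hs1 : s ≤ 1) (T X : ℝ) :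
    Tendsto (fun ε => profile s g ε T X) (𝓝[>] 0) (𝓝 (profile s g 0 T X)) := by
  have hA := hg.tendsto_lintegral_profileSymbol_sub hs0 hs1 T (r := 1) one_pos
    (by simpa using hg.integrable.2.ne)
  rw [tendsto_iff_edist_tendsto_0]
  refine tendsto_of_tendsto_of_tendsto_of_le_of_le' tendsto_const_nhds hA
    (Eventually.of_forall fun _ => bot_le) ?_
  filter_upwards [eventually_small hg.pos] with ε ⟨h1, h2⟩
  rw [edist_eq_enorm_sub, hg.profile_sub hs0 hs1 h1.le h2]
  have i1 : Integrable fun η => profileSymbol s ε T η * g η - profileSymbol s 0 T η * g η :=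
    (hg.integrable_profileSymbol_mul hs0 hs1 h1.le h2 T).sub
    (hg.integrable_profileSymbol_mul hs0 hs1 le_rfl (h1.le.trans h2) T)
  simpa using enorm_invFT_le _ i1 X

lemma IsBump.norm_profile_le {g : ℝ → ℂ} {R : ℝ} (hg : IsBump g R) {s : ℝ} (hs0 : 0 ≤ s)
    (hs1 : s ≤ 1) {ε : ℝ} (hε0 : 0 ≤ ε) (hε : ε ≤ 1 / (2 * R)) (T X : ℝ) :
    ‖profile s g ε T X‖ ≤ 2 * ∫ η, ‖g η‖ := by
  refine (norm_invFT_le _ _).trans ?_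
  rw [← integral_const_mul]
  exact integral_mono (hg.integrable_profileSymbol_mul hs0 hs1 hε0 hε T).norm
    (hg.integrable.norm.const_mul 2) (hg.norm_profileSymbol_mul_le hs0 hs1 hε0 hε T)

/-- Dispersive estimate for the rescaled flow, uniform in the scale. -/
lemma IsBump.norm_profile_le_dispersive {g : ℝ → ℂ} {R : ℝ} (hg : IsBump g R) {s : ℝ}
    (hs0 : 0 ≤ s) (hs1 : s ≤ 1 / 2) {ε : ℝ} (hε0 : 0 < ε) (hε : ε ≤ 1 / (2 * R)) (hε1 : ε ≤ 1)
    {T : ℝ} (hT : T ≠ 0) (X : ℝ) :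
    ‖profile s g ε T X‖ ≤ 8 * ((∫ η, ‖g η‖) + ∫ η, ‖deriv g η‖) / Real.sqrt |T| := by
  set h : ℝ → ℂ := fun ξ => g ((ξ - 1) / ε) with hh
  have hd : ContDiff ℝ 1 h := hg.contDiff.comp ((contDiff_id.sub contDiff_const).div_const ε)
  have hsupp : ∀ ξ, h ξ ≠ 0 → 1 / 2 < ξ ∧ ξ < 3 / 2 := by
    intro ξ hξ
    have h1 := abs_lt.1 (hg.abs_mul_lt hε0.le hε hξ)
    rw [mul_div_cancel₀ _ hε0.ne'] at h1
    constructor <;> linarith [h1.1, h1.2]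
  have hderiv : ∀ ξ, deriv h ξ = ((ε⁻¹ : ℝ) : ℂ) * deriv g ((ξ - 1) / ε) := by
    intro ξ
    have h1 : HasDerivAt (fun ξ : ℝ => (ξ - 1) / ε) (ε⁻¹) ξ := by
      simpa using ((hasDerivAt_id ξ).sub_const 1).div_const ε
    have h2 := ((hg.contDiff.differentiable one_ne_zero).differentiableAt
      (x := (ξ - 1) / ε)).hasDerivAt.scomp ξ h1
    rw [← Complex.real_smul]
    exact h2.deriv
  have i1 : ∫ ξ, ‖h ξ‖ ≤ ∫ η, ‖g η‖ := by
    rw [integral_comp_sub_div (fun η => ‖g η‖) 1 hε0, smul_eq_mul]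
    exact mul_le_of_le_one_left (integral_nonneg fun _ => norm_nonneg _) hε1
  have i2 : ∫ ξ, ‖deriv h ξ‖ = ∫ η, ‖deriv g η‖ := by
    simp only [hderiv, norm_mul]
    rw [integral_const_mul, integral_comp_sub_div (fun η => ‖deriv g η‖) 1 hε0, smul_eq_mul,
      Complex.norm_real, Real.norm_of_nonneg (by positivity), inv_mul_cancel_left₀ hε0.ne']
  have ht : T / ε ^ 2 ≠ 0 := div_ne_zero hT (pow_ne_zero 2 hε0.ne')
  -- The scaling is undone with t = T/ε², x = X/ε − 3t. The factor ε in |t|^{-1/2} = ε|T|^{-1/2}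
  -- cancels the prefactor of the bubble, while the `L¹` norm of the derivative is scale invariant
  -- and that of h shrinks for ε ≤ 1.
  have key := norm_invFT_airySymbol_le hd hsupp hs0 hs1 ht (X / ε - 3 * (T / ε ^ 2))
  have e1 : ε ^ 2 * (T / ε ^ 2) = T := by field_simp
  have e2 : ε * (X / ε - 3 * (T / ε ^ 2)) + 3 * ε * (T / ε ^ 2) = X := by field_simp; ring
  rw [hh, invFT_airySymbol_bubble s g hε0, e1, e2, norm_mul, norm_mul, mul_comm Complex.I,
    Complex.norm_exp_ofReal_mul_I, one_mul, Complex.norm_real, Real.norm_of_nonneg hε0.le] at key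
  have hsq : Real.sqrt |T / ε ^ 2| = Real.sqrt |T| / ε := by
    rw [abs_div, abs_of_pos (pow_pos hε0 2), Real.sqrt_div (abs_nonneg T), Real.sqrt_sq hε0.le]
  rw [hsq] at key
  have hT' : 0 < Real.sqrt |T| := Real.sqrt_pos.2 (abs_pos.2 hT)
  have key2 : ε * ‖profile s g ε T X‖ ≤
      ε * (8 * ((∫ η, ‖g η‖) + ∫ η, ‖deriv g η‖) / Real.sqrt |T|) := by
    refine key.trans ?_
    have h3 : (2 * (∫ ξ, ‖h ξ‖) + 2 * ∫ ξ, ‖deriv h ξ‖) ≤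
        2 * (∫ ξ, ‖g ξ‖) + 2 * ∫ ξ, ‖deriv g ξ‖ := by rw [i2]; gcongr
    calc _ ≤ 4 / (Real.sqrt |T| / ε) * (2 * (∫ ξ, ‖g ξ‖) + 2 * ∫ ξ, ‖deriv g ξ‖) := by gcongr
      _ = _ := by field_simp; ring
  exact le_of_mul_le_mul_left key2 hε0

/-- The trivial bound controls z⁴ and the dispersive one z⁴T²; adding them gives decay (1 + T²)^{-1}
for z⁴, with no singularity at T = 0. -/
lemma IsBump.exists_sup_bound {g : ℝ → ℂ} {R : ℝ} (hg : IsBump g R) {s : ℝ}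
    (hs0 : 0 ≤ s) (hs1 : s ≤ 1 / 2) :
    ∃ K : ℝ, 0 ≤ K ∧ ∀ ε, 0 < ε → ε ≤ 1 / (2 * R) → ε ≤ 1 → ∀ T X,
      ‖profile s g ε T X‖ ≤ (K * (1 + T ^ 2)⁻¹) ^ (1 / 4 : ℝ) := by
  set a := 2 * ∫ η, ‖g η‖ with ha
  set b := 8 * ((∫ η, ‖g η‖) + ∫ η, ‖deriv g η‖) with hb
  refine ⟨a ^ 4 + b ^ 4, by positivity, fun ε hε0 hε hε1 T X => ?_⟩
  set z := ‖profile s g ε T X‖ with hz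
  have hz0 : 0 ≤ z := norm_nonneg _
  have h1 : z ≤ a := hg.norm_profile_le hs0 (by linarith) hε0.le hε T X
  have h2 : z ^ 4 * T ^ 2 ≤ b ^ 4 := by
    rcases eq_or_ne T 0 with rfl | hT
    · simp only [ne_eq, OfNat.ofNat_ne_zero, not_false_eq_true, zero_pow, mul_zero]; positivity
    · have h3 := hg.norm_profile_le_dispersive hs0 hs1 hε0 hε hε1 hT X
      have hT' : 0 < Real.sqrt |T| := Real.sqrt_pos.2 (abs_pos.2 hT)
      rw [le_div_iff₀ hT'] at h3
      have h4 : Real.sqrt |T| ^ 4 = T ^ 2 := by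
        rw [show 4 = 2 * 2 by norm_num, pow_mul, Real.sq_sqrt (abs_nonneg T), sq_abs]
      rw [← h4, ← mul_pow]
      exact pow_le_pow_left₀ (by positivity) h3 4
  have h3 : z ^ 4 ≤ a ^ 4 := pow_le_pow_left₀ hz0 h1 4
  have h4 : z ^ 4 ≤ (a ^ 4 + b ^ 4) * (1 + T ^ 2)⁻¹ := by
    rw [← div_eq_mul_inv, le_div_iff₀ (by positivity)]; linarith
  calc z = (z ^ 4) ^ (1 / 4 : ℝ) := by
        rw [← Real.rpow_natCast, ← Real.rpow_mul hz0]; norm_num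
    _ ≤ _ := Real.rpow_le_rpow (by positivity) h4 (by norm_num)

lemma admissible_identity {p q : ℝ} (hp : 4 < p) (hpq : 2 / p + 1 / q = 1 / 2) :
    (q - 2) * (p / q) = 4 := by
  have hq := two_lt_of_admissible hp hpq
  have h1 : p / q = p * (1 / q) := by ring
  have h2 : 1 / q = 1 / 2 - 2 / p := by linarith
  have hp0 : p ≠ 0 := by linarith
  have hq0 : q ≠ 0 := by linarith
  have h3 : q * (p * (1 / q)) = p := by field_simp
  have h4 : p * (1 / q) = p / 2 - 2 := by rw [h2]; field_simp
  rw [h1, sub_mul, h3, h4]; ring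

/-- An integrable majorant in time for the rescaled flows, uniform in the scale. -/
lemma IsBump.exists_time_majorant {p q : ℝ} (hp : 4 < p) (hpq : 2 / p + 1 / q = 1 / 2)
    {g : ℝ → ℂ} {R : ℝ} (hg : IsBump g R) :
    ∃ B : ℝ → ℝ≥0∞, ∫⁻ T, B T ≠ ∞ ∧ ∀ ε, 0 < ε → ε ≤ 1 / (2 * R) → ε ≤ 1 → ∀ T,
      (∫⁻ X, ‖profile (1 / p) g ε T X‖ₑ ^ q) ^ (p / q) ≤ B T := by
  have hq := two_lt_of_admissible hp hpq
  have hr : 0 ≤ p / q := by positivity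
  have hs0 : 0 ≤ 1 / p := by positivity
  have hs1 : 1 / p ≤ 1 / 2 := one_div_le_one_div_of_le (by norm_num) (by linarith)
  obtain ⟨K, hK, hKb⟩ := hg.exists_sup_bound hs0 hs1
  set M : ℝ≥0∞ := ∫⁻ η, (2 * ‖g η‖ₑ) ^ 2 with hM
  have hMt : M ≠ ∞ := by
    rw [hM]
    simp only [mul_pow]
    rw [lintegral_const_mul' _ _ (by norm_num), ← eLpNorm_two_sq]
    exact ENNReal.mul_ne_top (by norm_num) (ENNReal.pow_ne_top hg.memLp.eLpNorm_ne_top)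
  refine ⟨fun T => ENNReal.ofReal (K * (1 + T ^ 2)⁻¹) * M ^ (p / q), ?_, ?_⟩
  · rw [lintegral_mul_const' _ _ (ENNReal.rpow_ne_top_of_nonneg hr hMt)]
    refine ENNReal.mul_ne_top ?_ (ENNReal.rpow_ne_top_of_nonneg hr hMt)
    exact (integrable_inv_one_add_sq.const_mul K).lintegral_lt_top.ne
  · intro ε hε0 hε hε1 T
    have hD : 0 ≤ K * (1 + T ^ 2)⁻¹ := by positivity
    -- Interpolation with Plancherel yields S^{(q−2)p/q} = S⁴, which is integrable in time.
    set S : ℝ≥0∞ := ENNReal.ofReal (K * (1 + T ^ 2)⁻¹) ^ (1 / 4 : ℝ) with hS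
    have hsup : ∀ X, ‖profile (1 / p) g ε T X‖ₑ ≤ S := by
      intro X
      rw [hS, ENNReal.ofReal_rpow_of_nonneg hD (by norm_num), ← ofReal_norm]
      exact ENNReal.ofReal_le_ofReal (hKb ε hε0 hε hε1 T X)
    have h1 := lintegral_invFT_rpow_le hq.le
      (hg.integrable_profileSymbol_mul hs0 (by linarith) hε0.le hε T)
      (hg.memLp_profileSymbol_mul hs0 (by linarith) hε0.le hε T) hsup
    have h2 : ∫⁻ η, ‖profileSymbol (1 / p) ε T η * g η‖ₑ ^ 2 ≤ M := by
      refine lintegral_mono fun η => pow_le_pow_left' ?_ 2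
      rw [← ofReal_norm, ← ofReal_norm, show (2 : ℝ≥0∞) = ENNReal.ofReal 2 by simp,
        ← ENNReal.ofReal_mul (by norm_num)]
      exact ENNReal.ofReal_le_ofReal
        (hg.norm_profileSymbol_mul_le hs0 (by linarith) hε0.le hε T η)
    calc _ ≤ (S ^ (q - 2) * M) ^ (p / q) :=
          ENNReal.rpow_le_rpow (h1.trans (mul_le_mul_right h2 _)) hr
      _ = _ := by
          rw [ENNReal.mul_rpow_of_nonneg _ _ hr, ← ENNReal.rpow_mul, admissible_identity hp hpq, hS,
            ← ENNReal.rpow_mul]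
          norm_num

/-! ### Schrödinger Strichartz as a limit of the Airy estimate -/

lemma eLpNorm_comp_sub_div {f : ℝ → ℂ} (c : ℝ) {ε : ℝ} (hε : 0 < ε) :
    eLpNorm (fun ξ => f ((ξ - c) / ε)) 2 = ENNReal.ofReal ε ^ (1 / 2 : ℝ) * eLpNorm f 2 := by
  have h1 : eLpNorm (fun ξ => f ((ξ - c) / ε)) 2 ^ 2 =
      (ENNReal.ofReal ε ^ (1 / 2 : ℝ) * eLpNorm f 2) ^ 2 := by
    rw [mul_pow, eLpNorm_two_sq, eLpNorm_two_sq, ← ENNReal.rpow_natCast, ← ENNReal.rpow_mul]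
    have h2 := lintegral_comp_affine (fun η => ‖f η‖ₑ ^ 2) (inv_ne_zero hε.ne') (-(c / ε))
    have h3 : ∀ ξ : ℝ, ε⁻¹ * ξ + -(c / ε) = (ξ - c) / ε := fun ξ => by ring
    simp only [h3, inv_inv, abs_of_pos hε] at h2
    rw [h2]
    norm_num
  have := congrArg (fun z : ℝ≥0∞ => z ^ (1 / 2 : ℝ)) h1
  simp only [← ENNReal.rpow_natCast, ← ENNReal.rpow_mul] at this
  simpa using this

lemma isSymbol_schrodinger : IsSymbol fun t ξ => Complex.exp (3 * Complex.I * t * ξ ^ 2) := by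
  refine ⟨by simp only [Function.uncurry_def]; fun_prop, fun t ξ => ?_⟩
  rw [show 3 * Complex.I * (t : ℂ) * (ξ : ℂ) ^ 2 = ((3 * t * ξ ^ 2 : ℝ) : ℂ) * Complex.I by
    push_cast; ring, Complex.norm_exp_ofReal_mul_I]
  linarith [abs_nonneg ξ]

lemma memLp_comp_sub_div {f : ℝ → ℂ} (hf : MemLp f 2) {ε : ℝ} (hε : 0 < ε) :
    MemLp (fun ξ => f ((ξ - 1) / ε)) 2 := by
  refine (memLp_affine hf (inv_ne_zero hε.ne') (-(1 / ε))).ae_eq (Eventually.of_forall fun ξ => ?_)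
  congr 1; ring

lemma IsBump.isAnnular_pos {g : ℝ → ℂ} {R : ℝ} (hg : IsBump g R) {ε : ℝ} (hε0 : 0 < ε)
    (hε : ε ≤ 1 / (2 * R)) : IsAnnular fun ξ => g ((ξ - 1) / ε) := by
  refine ⟨(hg.contDiff.continuous.comp (by fun_prop : Continuous fun ξ : ℝ =>
    (ξ - 1) / ε)).measurable, memLp_comp_sub_div hg.memLp hε0, 1 / 2, 3 / 2, by norm_num,
    by norm_num, fun ξ h => ?_⟩
  have h3 := abs_lt.1 (hg.abs_mul_lt hε0.le hε h)
  rw [mul_div_cancel₀ _ hε0.ne'] at h3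
  rw [abs_of_pos (by linarith [h3.1])]
  constructor <;> linarith [h3.1, h3.2]

/-- The Airy estimate is applied to a single bubble. The carrier is unimodular, and both sides scale
like ε^{p/2}, so ε drops out. -/
lemma mixedEnergy_profile_le {p q : ℝ} (hp : 4 < p) (hpq : 2 / p + 1 / q = 1 / 2)
    {C : ℝ≥0∞} (hC : ∀ f : ℝ → ℂ, MemLp f 2 →
      ∀ F, IsFlow (airySymbol (1 / p)) f F → mixedEnergy p q F ≤ C * eLpNorm f 2 ^ p)
    {g : ℝ → ℂ} {R : ℝ} (hg : IsBump g R) {ε : ℝ} (hε0 : 0 < ε) (hε : ε ≤ 1 / (2 * R)) :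
    mixedEnergy p q (profile (1 / p) g ε) ≤ C * eLpNorm g 2 ^ p := by
  have hq := two_lt_of_admissible hp hpq
  have hann := hg.isAnnular_pos hε0 hε
  have h1 := hC _ hann.memLp _ (isFlow_invFT (measurable_airySymbol (1 / p)) hann.measurable
    fun t => (hann.airySymbol_mul (1 / p) t).integrable)
  rw [eLpNorm_comp_sub_div 1 hε0, ENNReal.mul_rpow_of_nonneg _ _ (by linarith),
    ← ENNReal.rpow_mul] at h1
  set H : ℝ → ℝ → ℂ := fun T X => Complex.exp (Complex.I * (X / ε - 2 * T / ε ^ 2 : ℝ)) *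
    profile (1 / p) g ε T X with hH
  have e1 : (fun t x => invFT (fun ξ => airySymbol (1 / p) t ξ * g ((ξ - 1) / ε)) x) =
      fun t x => (ε : ℂ) * H (ε ^ 2 * t) (ε * x + 3 * ε * t) := by
    ext t x
    rw [invFT_airySymbol_bubble _ _ hε0]
    simp only [hH]
    congr 4
    field_simp
    ring_nf
  have e2 : mixedEnergy p q H = mixedEnergy p q (profile (1 / p) g ε) := by
    simp only [mixedEnergy, hH, enorm_mul]
    have : ∀ a : ℝ, ‖Complex.exp (Complex.I * a)‖ₑ = 1 := fun a => by
      rw [← ofReal_norm, mul_comm, Complex.norm_exp_ofReal_mul_I, ENNReal.ofReal_one]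
    simp only [this, one_mul]
  rw [e1, mixedEnergy_scale (by linarith) (by linarith) hpq hε0, e2,
    show 1 / 2 * p = p / 2 by ring, mul_left_comm] at h1
  exact (ENNReal.mul_le_mul_iff_right (by positivity)
    (ENNReal.rpow_ne_top_of_nonneg (by linarith) ENNReal.ofReal_ne_top)).1 h1

/-- The bound for profiles is uniform in ε and the profiles converge pointwise, so Fatou passes it
to the Schrödinger flow. -/
lemma mixedEnergy_profile_zero_le {p q : ℝ} (hp : 4 < p) (hpq : 2 / p + 1 / q = 1 / 2)
    {C : ℝ≥0∞} (hC : ∀ f : ℝ → ℂ, MemLp f 2 →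
      ∀ F, IsFlow (airySymbol (1 / p)) f F → mixedEnergy p q F ≤ C * eLpNorm f 2 ^ p)
    {g : ℝ → ℂ} {R : ℝ} (hg : IsBump g R) :
    mixedEnergy p q (fun T X => profile (1 / p) g 0 T X) ≤ C * eLpNorm g 2 ^ p := by
  have hq := two_lt_of_admissible hp hpq
  have hs1 : 1 / p ≤ 1 := by rw [div_le_one (by linarith)]; linarith
  obtain ⟨u, hu, hu'⟩ := exists_seq_forall_of_frequently (eventually_small hg.pos).frequently
  have h1 := mixedEnergy_le_liminf (p := p) (q := q) (by linarith) (by linarith)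
    (F := fun n => profile (1 / p) g (u n)) (G := profile (1 / p) g 0)
    (fun n => hg.measurable_uncurry_profile (1 / p) (u n))
    (Eventually.of_forall fun T => Eventually.of_forall fun X =>
      (hg.tendsto_profile_pointwise (by positivity) hs1 T X).comp hu)
  refine h1.trans (liminf_le_of_frequently_le' (Frequently.of_forall fun n => ?_))
  exact mixedEnergy_profile_le hp hpq hC hg (hu' n).1 (hu' n).2

/-- The Strichartz estimate for the Schrödinger flow. -/
lemma exists_strichartz_schrodinger {p q : ℝ} (hp : 4 < p) (hpq : 2 / p + 1 / q = 1 / 2) :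
    ∃ C : ℝ≥0∞, C ≠ ∞ ∧ ∀ f : ℝ → ℂ, MemLp f 2 →
      (∃ F, IsFlow (fun t ξ => Complex.exp (3 * Complex.I * t * ξ ^ 2)) f F) ∧
      ∀ F, IsFlow (fun t ξ => Complex.exp (3 * Complex.I * t * ξ ^ 2)) f F →
        mixedEnergy p q F ≤ C * eLpNorm f 2 ^ p := by
  have hq := two_lt_of_admissible hp hpq
  have hs0 : 0 ≤ 1 / p := by positivity
  have hs1 : 1 / p ≤ 1 := by rw [div_le_one (by linarith)]; linarith
  obtain ⟨C, hC, hS⟩ := exists_strichartz_airy hp hpq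
  refine ⟨C, hC, fun f hf => ?_⟩
  obtain ⟨F, hF, hFC⟩ := exists_isFlow_of_dense (p := p) (q := q) (by linarith) (by linarith)
    isSymbol_schrodinger
    (N := fun g => ∃ R, IsBump g R)
    (fun g ⟨R, hg⟩ => ⟨hg.contDiff.continuous.measurable, hg.memLp⟩)
    (fun g ⟨R, hg⟩ t => by
      have hm : Measurable fun ξ : ℝ => Complex.exp (3 * Complex.I * t * ξ ^ 2) * g ξ :=
        (by fun_prop : Measurable fun ξ : ℝ => Complex.exp (3 * Complex.I * t * ξ ^ 2)).mul
          hg.contDiff.continuous.measurable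
      refine hg.integrable.norm.mono' hm.aestronglyMeasurable (Eventually.of_forall fun ξ => ?_)
      rw [norm_mul, show 3 * Complex.I * (t : ℂ) * (ξ : ℂ) ^ 2 =
        ((3 * t * ξ ^ 2 : ℝ) : ℂ) * Complex.I by push_cast; ring, Complex.norm_exp_ofReal_mul_I,
        one_mul])
    (fun f g ⟨R, hf⟩ ⟨S, hg⟩ => ⟨_, hf.sub hg⟩)
    (fun f hf δ hδ => exists_isBump_eLpNorm_sub_le hf hδ) hC
    (fun g ⟨R, hg⟩ => by
      have := mixedEnergy_profile_zero_le hp hpq (fun f hf => (hS f hf).2) hg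
      simpa only [profile_zero] using this) hf
  refine ⟨⟨F, hF⟩, fun G hG => ?_⟩
  rwa [mixedEnergy_congr (hG.ae_eq hF)]

/-! ### Equidistribution of the carrier and the mean of |cos|^q -/

/-- Riemann–Lebesgue at frequency −n/(2πε), the sign and the 2π matching the kernel e^{-2πixξ}. -/
lemma tendsto_integral_exp_div {h : ℝ → ℂ} {n : ℤ} (hn : n ≠ 0) :
    Tendsto (fun ε : ℝ => ∫ X : ℝ, Complex.exp (Complex.I * (n * (X / ε) : ℝ)) * h X)
      (𝓝[>] 0) (𝓝 0) := by
  have h1 := Real.tendsto_integral_exp_smul_cocompact h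
  have h2 : Tendsto (fun ε : ℝ => -((n : ℝ) / (2 * Real.pi)) * ε⁻¹) (𝓝[>] 0) (cocompact ℝ) := by
    have h3 : Tendsto (fun ε : ℝ => ε⁻¹) (𝓝[>] 0) (cocompact ℝ) :=
      tendsto_inv_nhdsGT_zero.mono_right atTop_le_cocompact
    refine (Homeomorph.mulLeft₀ (-((n : ℝ) / (2 * Real.pi))) ?_).isClosedEmbedding.tendsto_cocompact.comp h3
    have : (n : ℝ) ≠ 0 := by exact_mod_cast hn
    have := Real.pi_ne_zero
    exact neg_ne_zero.2 (by positivity)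
  refine (h1.comp h2).congr fun ε => ?_
  refine integral_congr_ae (Eventually.of_forall fun X => ?_)
  simp only [Circle.smul_def, smul_eq_mul, Real.fourierChar_apply]
  congr 2
  have hpi : (Real.pi : ℂ) ≠ 0 := by exact_mod_cast Real.pi_ne_zero
  push_cast
  field_simp

instance fact_two_pi_pos : Fact (0 < 2 * Real.pi) := ⟨Real.two_pi_pos⟩

/-- Equidistribution of a rapidly rotating phase, tested against an integrable weight. -/
def IsEquidistributed (G : C(AddCircle (2 * Real.pi), ℂ)) : Prop :=
  ∀ (w : ℝ → ℂ) (α c : ℝ → ℝ), Integrable w → Measurable α →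
    Tendsto (fun ε : ℝ => ∫ X : ℝ, w X * G ((X / ε + c ε + α X : ℝ) : AddCircle (2 * Real.pi)))
      (𝓝[>] 0) (𝓝 ((∫ x, G x ∂AddCircle.haarAddCircle) * ∫ X, w X))

lemma integral_haar_fourier {n : ℤ} (hn : n ≠ 0) :
    ∫ x : AddCircle (2 * Real.pi), _root_.fourier n x ∂AddCircle.haarAddCircle = 0 :=
  integral_eq_zero_of_add_right_eq_neg (μ := AddCircle.haarAddCircle)
    (fourier_add_half_inv_index hn Fact.out)

lemma fourier_coe_two_pi (n : ℤ) (x : ℝ) :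
    (_root_.fourier n (x : AddCircle (2 * Real.pi)) : ℂ) = Complex.exp (Complex.I * (n * x : ℝ)) := by
  rw [fourier_coe_apply]
  congr 1
  have hpi : (Real.pi : ℂ) ≠ 0 := by exact_mod_cast Real.pi_ne_zero
  push_cast
  field_simp

/-- For n ≠ 0 the phase c(ε) only contributes a unimodular constant, so it need not converge, while
e^{inα} is absorbed into the weight and Riemann–Lebesgue applies. -/
lemma isEquidistributed_fourier (n : ℤ) : IsEquidistributed (_root_.fourier n) := by
  intro w α c hw hα
  by_cases hn : n = 0
  · subst hn
    simp
  rw [integral_haar_fourier hn, zero_mul]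
  have h1 := tendsto_integral_exp_div (h := fun X => w X * Complex.exp (Complex.I * (n * α X : ℝ))) hn
  rw [tendsto_zero_iff_norm_tendsto_zero] at h1 ⊢
  refine h1.congr fun ε => ?_
  have h2 : ∀ X : ℝ, w X * (_root_.fourier n ((X / ε + c ε + α X : ℝ) : AddCircle (2 * Real.pi)) : ℂ) =
      Complex.exp (Complex.I * (n * c ε : ℝ)) * (Complex.exp (Complex.I * (n * (X / ε) : ℝ)) *
        (w X * Complex.exp (Complex.I * (n * α X : ℝ)))) := by
    intro X
    rw [fourier_coe_two_pi, show Complex.I * ((n * (X / ε + c ε + α X) : ℝ) : ℂ) =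
      Complex.I * (n * c ε : ℝ) + Complex.I * (n * (X / ε) : ℝ) + Complex.I * (n * α X : ℝ) by
        push_cast; ring, Complex.exp_add, Complex.exp_add]
    ring
  rw [integral_congr_ae (Eventually.of_forall h2), integral_const_mul, norm_mul,
    mul_comm Complex.I, Complex.norm_exp_ofReal_mul_I, one_mul]

lemma integrable_circle_mul {w : ℝ → ℂ} (hw : Integrable w) {β : ℝ → ℝ} (hβ : Measurable β)
    (G : C(AddCircle (2 * Real.pi), ℂ)) :
    Integrable fun X => w X * G (β X : AddCircle (2 * Real.pi)) := by
  have hm : Measurable fun X => G (β X : AddCircle (2 * Real.pi)) :=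
    G.continuous.measurable.comp ((AddCircle.measurable_mk').comp hβ)
  refine (hw.norm.mul_const ‖G‖).mono' (hw.1.mul hm.aestronglyMeasurable)
    (Eventually.of_forall fun X => ?_)
  rw [norm_mul]
  gcongr
  exact G.norm_coe_le_norm _

lemma isEquidistributed_of_mem_span {G : C(AddCircle (2 * Real.pi), ℂ)}
    (hG : G ∈ Submodule.span ℂ (Set.range (_root_.fourier (T := 2 * Real.pi)))) : IsEquidistributed G := by
  induction hG using Submodule.span_induction with
  | mem x hx => obtain ⟨n, rfl⟩ := hx; exact isEquidistributed_fourier n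
  | zero => intro w α c hw hα; simp
  | add F G _ _ hF hG =>
    intro w α c hw hα
    have hi : ∀ H : C(AddCircle (2 * Real.pi), ℂ), Integrable H AddCircle.haarAddCircle :=
      fun H => H.continuous.integrable_of_hasCompactSupport (HasCompactSupport.of_compactSpace _)
    have := (hF w α c hw hα).add (hG w α c hw hα)
    rw [← add_mul, ← integral_add (hi F) (hi G)] at this
    refine this.congr fun ε => ?_
    have hβ : Measurable fun X => X / ε + c ε + α X := by fun_prop
    rw [← integral_add (integrable_circle_mul hw hβ F) (integrable_circle_mul hw hβ G)]
    simp only [ContinuousMap.add_apply, mul_add]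
  | smul a F _ hF =>
    intro w α c hw hα
    have := (hF w α c hw hα).const_mul a
    have e : ∫ x, (a • F) x ∂AddCircle.haarAddCircle = a * ∫ x, F x ∂AddCircle.haarAddCircle := by
      rw [← integral_const_mul]; rfl
    rw [e, mul_assoc]
    refine this.congr fun ε => ?_
    rw [← integral_const_mul]
    refine integral_congr_ae (Eventually.of_forall fun X => ?_)
    simp only [ContinuousMap.smul_apply, smul_eq_mul]
    ring

/-- Trigonometric polynomials are uniformly dense in the continuous functions on the circle, and
replacing G by P changes either side by at most the sup distance times ∫|w|, uniformly in ε. -/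
lemma isEquidistributed (G : C(AddCircle (2 * Real.pi), ℂ)) : IsEquidistributed G := by
  intro w α c hw hα
  set W := ∫ X, ‖w X‖ with hW
  have hW0 : 0 ≤ W := integral_nonneg fun _ => norm_nonneg _
  have hi : ∀ H : C(AddCircle (2 * Real.pi), ℂ), Integrable H AddCircle.haarAddCircle :=
    fun H => H.continuous.integrable_of_hasCompactSupport (HasCompactSupport.of_compactSpace _)
  rw [Metric.tendsto_nhds]
  intro δ hδ
  have hdense : G ∈ closure (Submodule.span ℂ (Set.range (_root_.fourier (T := 2 * Real.pi))) :
      Set C(AddCircle (2 * Real.pi), ℂ)) := by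
    rw [← Submodule.topologicalClosure_coe, span_fourier_closure_eq_top]
    trivial
  obtain ⟨P, hP, hGP⟩ := Metric.mem_closure_iff.1 hdense (δ / (4 * (W + 1))) (by positivity)
  rw [dist_eq_norm] at hGP
  have hPt := isEquidistributed_of_mem_span hP w α c hw hα
  have hsmall : δ / (4 * (W + 1)) * W ≤ δ / 4 := by
    rw [div_mul_eq_mul_div, div_le_div_iff₀ (by positivity) (by norm_num)]
    nlinarith
  have key : ∀ β : ℝ → ℝ, Measurable β →
      ‖(∫ X, w X * G (β X : AddCircle (2 * Real.pi))) -
        ∫ X, w X * P (β X : AddCircle (2 * Real.pi))‖ ≤ δ / 4 := by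
    intro β hβ
    rw [← integral_sub (integrable_circle_mul hw hβ G) (integrable_circle_mul hw hβ P)]
    refine le_trans ?_ hsmall
    rw [hW, ← integral_const_mul]
    refine norm_integral_le_of_norm_le (hw.norm.const_mul _) (Eventually.of_forall fun X => ?_)
    rw [← mul_sub, norm_mul, mul_comm]
    gcongr
    exact ((G - P).norm_coe_le_norm _).trans hGP.le
  have key2 : ‖(∫ x, P x ∂AddCircle.haarAddCircle) * (∫ X, w X) -
      (∫ x, G x ∂AddCircle.haarAddCircle) * ∫ X, w X‖ ≤ δ / 4 := by
    rw [← sub_mul, norm_mul, ← integral_sub (hi P) (hi G)]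
    refine le_trans (mul_le_mul ?_ (norm_integral_le_integral_norm _) (norm_nonneg _)
      (by positivity)) hsmall
    have h3 := norm_integral_le_of_norm_le_const (μ := AddCircle.haarAddCircle)
      (f := fun x => P x - G x) (C := δ / (4 * (W + 1))) (Eventually.of_forall fun x => by
        rw [norm_sub_rev]
        exact ((G - P).norm_coe_le_norm x).trans hGP.le)
    simpa using h3
  filter_upwards [Metric.tendsto_nhds.1 hPt (δ / 4) (by positivity)] with ε hε
  have hβ : Measurable fun X => X / ε + c ε + α X := by fun_prop
  rw [dist_eq_norm] at hε ⊢
  have := key _ hβ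
  calc _ = ‖((∫ X, w X * G ((X / ε + c ε + α X : ℝ) : AddCircle (2 * Real.pi))) -
        ∫ X, w X * P ((X / ε + c ε + α X : ℝ) : AddCircle (2 * Real.pi))) +
        ((∫ X, w X * P ((X / ε + c ε + α X : ℝ) : AddCircle (2 * Real.pi))) -
          (∫ x, P x ∂AddCircle.haarAddCircle) * (∫ X, w X)) +
        ((∫ x, P x ∂AddCircle.haarAddCircle) * (∫ X, w X) -
          (∫ x, G x ∂AddCircle.haarAddCircle) * ∫ X, w X)‖ := by congr 1; ring
    _ ≤ _ := norm_add₃_le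
    _ ≤ δ / 4 + δ / 4 + δ / 4 := by gcongr
    _ < δ := by linarith

/-- The mean value of `|cos|^q`. -/
def cosMean (q : ℝ) : ℝ := (2 * Real.pi)⁻¹ * ∫ θ in (-Real.pi)..Real.pi, |Real.cos θ| ^ q

/-- On the circle, |cos|^q is realized as |Re z|^q with z the first character, so continuity and
periodicity come for free. -/
lemma exists_cosPow {q : ℝ} (hq : 0 ≤ q) : ∃ G : C(AddCircle (2 * Real.pi), ℂ),
    (∀ θ : ℝ, G (θ : AddCircle (2 * Real.pi)) = ((|Real.cos θ| ^ q : ℝ) : ℂ)) ∧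
    ∫ x, G x ∂AddCircle.haarAddCircle = cosMean q := by
  have hcont : Continuous fun x : AddCircle (2 * Real.pi) =>
      ((|(_root_.fourier 1 x : ℂ).re| ^ q : ℝ) : ℂ) := by
    refine Complex.continuous_ofReal.comp (Continuous.rpow_const ?_ fun _ => Or.inr hq)
    exact (Complex.continuous_re.comp (_root_.fourier 1).continuous).abs
  refine ⟨⟨_, hcont⟩, ?_, ?_⟩
  · intro θ
    simp only [ContinuousMap.coe_mk]
    rw [fourier_coe_two_pi, mul_comm, Complex.exp_ofReal_mul_I_re]
    simp
  · simp only [ContinuousMap.coe_mk]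
    rw [integral_complex_ofReal, AddCircle.integral_haarAddCircle,
      ← AddCircle.intervalIntegral_preimage _ (-Real.pi), cosMean, smul_eq_mul,
      show -Real.pi + 2 * Real.pi = Real.pi by ring]
    congr 3; ext θ
    rw [fourier_coe_two_pi, mul_comm, Complex.exp_ofReal_mul_I_re]
    simp

/-- Averaging of the fast oscillation in the `L^q` norm. -/
lemma tendsto_lintegral_re {q : ℝ} (hq : 0 < q) {v : ℝ → ℂ} (hv : Measurable v)
    (hvq : ∫⁻ X, ‖v X‖ₑ ^ q ≠ ∞) (c : ℝ → ℝ) :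
    Tendsto (fun ε : ℝ => ∫⁻ X : ℝ, ‖(Complex.exp (Complex.I * (X / ε + c ε : ℝ)) * v X).re‖ₑ ^ q)
      (𝓝[>] 0) (𝓝 (ENNReal.ofReal (cosMean q) * ∫⁻ X, ‖v X‖ₑ ^ q)) := by
  obtain ⟨G, hG, hGm⟩ := exists_cosPow hq.le
  have hmeas : Measurable fun X => ‖v X‖ ^ q := hv.norm.pow_const q
  have hnn : ∀ X, 0 ≤ ‖v X‖ ^ q := fun X => by positivity
  have e0 : ∀ z : ℂ, ‖z‖ₑ ^ q = ENNReal.ofReal (‖z‖ ^ q) := fun z => by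
    rw [← ofReal_norm, ENNReal.ofReal_rpow_of_nonneg (norm_nonneg _) hq.le]
  have hint : Integrable fun X => ‖v X‖ ^ q := by
    refine ⟨hmeas.aestronglyMeasurable, ?_⟩
    rw [hasFiniteIntegral_iff_ofReal (Eventually.of_forall hnn)]
    simp only [e0] at hvq
    exact hvq.lt_top
  -- In polar form Re(e^{iβ}v) = |v| cos(β + arg v), so |v|^q is the weight and arg v the phase
  -- shift; continuity of arg is not needed.
  have key := isEquidistributed G (fun X => ((‖v X‖ ^ q : ℝ) : ℂ)) (fun X => (v X).arg) c
    hint.ofReal (Complex.measurable_arg.comp hv)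
  rw [hGm, integral_complex_ofReal, ← Complex.ofReal_mul] at key
  have key2 := (ENNReal.continuous_ofReal.tendsto _).comp
    ((Complex.continuous_re.tendsto _).comp key)
  rw [Complex.ofReal_re] at key2
  have hm0 : 0 ≤ cosMean q := by
    refine mul_nonneg (by positivity) (intervalIntegral.integral_nonneg
      (by linarith [Real.pi_pos]) fun θ _ => by positivity)
  have e1 : ENNReal.ofReal (cosMean q * ∫ X, ‖v X‖ ^ q) =
      ENNReal.ofReal (cosMean q) * ∫⁻ X, ‖v X‖ₑ ^ q := by
    rw [ENNReal.ofReal_mul hm0, ofReal_integral_eq_lintegral_ofReal hint (Eventually.of_forall hnn)]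
    simp only [e0]
  rw [e1] at key2
  refine key2.congr fun ε => ?_
  have e2 : ∀ X, ((‖v X‖ ^ q : ℝ) : ℂ) *
      G ((X / ε + c ε + (v X).arg : ℝ) : AddCircle (2 * Real.pi)) =
      ((|(Complex.exp (Complex.I * (X / ε + c ε : ℝ)) * v X).re| ^ q : ℝ) : ℂ) := by
    intro X
    rw [hG, ← Complex.ofReal_mul, ← Real.mul_rpow (norm_nonneg _) (abs_nonneg _)]
    congr 2
    have h1 : Complex.exp (Complex.I * (X / ε + c ε : ℝ)) * v X =
        ‖v X‖ * Complex.exp ((X / ε + c ε + (v X).arg : ℝ) * Complex.I) := by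
      conv_lhs => rw [← Complex.norm_mul_exp_arg_mul_I (v X)]
      rw [mul_left_comm, ← Complex.exp_add]
      congr 2
      push_cast; ring
    rw [h1, Complex.re_ofReal_mul, Complex.exp_ofReal_mul_I_re, abs_mul, abs_norm]
  have hmr : Measurable fun X : ℝ => |(Complex.exp (Complex.I * (X / ε + c ε : ℝ)) * v X).re| := by
    have h2 : Measurable fun X : ℝ => Complex.exp (Complex.I * (X / ε + c ε : ℝ)) := by fun_prop
    exact (Complex.measurable_re.comp (h2.mul hv)).abs
  have hint2 : Integrable fun X : ℝ =>
      |(Complex.exp (Complex.I * (X / ε + c ε : ℝ)) * v X).re| ^ q := by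
    refine hint.mono' (hmr.pow_const q).aestronglyMeasurable (Eventually.of_forall fun X => ?_)
    rw [Real.norm_of_nonneg (by positivity)]
    refine Real.rpow_le_rpow (abs_nonneg _) ((Complex.abs_re_le_norm _).trans ?_) hq.le
    rw [norm_mul, mul_comm Complex.I, Complex.norm_exp_ofReal_mul_I, one_mul]
  simp only [Function.comp_apply]
  rw [integral_congr_ae (Eventually.of_forall e2), integral_complex_ofReal, Complex.ofReal_re,
    ofReal_integral_eq_lintegral_ofReal hint2 (Eventually.of_forall fun X => by positivity)]
  refine lintegral_congr fun X => ?_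
  rw [← ofReal_norm, ENNReal.ofReal_rpow_of_nonneg (norm_nonneg _) hq.le, Real.norm_eq_abs]

lemma integral_abs_rpow_mul_exp_neg_sq {q : ℝ} (hq : -1 < q) :
    ∫ x : ℝ, |x| ^ q * Real.exp (-x ^ 2) = Real.Gamma ((q + 1) / 2) := by
  have h1 := integral_comp_abs (f := fun x : ℝ => x ^ q * Real.exp (-x ^ (2 : ℝ)))
  rw [integral_rpow_mul_exp_neg_rpow two_pos hq] at h1
  simp only [Real.rpow_ofNat, sq_abs] at h1
  rw [h1]; ring

/-- The mean value of `|cos|^q`, through the Gaussian integral in polar coordinates. -/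
lemma cosMean_eq {q : ℝ} (hq : 0 < q) :
    cosMean q = Real.Gamma ((q + 1) / 2) / (Real.sqrt Real.pi * Real.Gamma ((q + 2) / 2)) := by
  have h1 := integral_comp_polarCoord_symm
    (fun z : ℝ × ℝ => (|z.1| ^ q * Real.exp (-z.1 ^ 2)) * Real.exp (-z.2 ^ 2))
  have h2 : ∫ z : ℝ × ℝ, (|z.1| ^ q * Real.exp (-z.1 ^ 2)) * Real.exp (-z.2 ^ 2) =
      Real.Gamma ((q + 1) / 2) * Real.sqrt Real.pi := by
    have h3 := integral_prod_mul (μ := (volume : Measure ℝ)) (ν := (volume : Measure ℝ))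
      (fun x : ℝ => |x| ^ q * Real.exp (-x ^ 2)) (fun y : ℝ => Real.exp (-y ^ 2))
    have h4 := integral_gaussian 1
    simp only [neg_mul, one_mul, div_one] at h4
    rw [integral_abs_rpow_mul_exp_neg_sq (by linarith), h4] at h3
    exact h3
  have h5 : ∫ z in polarCoord.target, z.1 • (fun z : ℝ × ℝ =>
        (|z.1| ^ q * Real.exp (-z.1 ^ 2)) * Real.exp (-z.2 ^ 2)) (polarCoord.symm z) =
      1 / 2 * Real.Gamma ((q + 2) / 2) * ∫ θ in (-Real.pi)..Real.pi, |Real.cos θ| ^ q := by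
    have h6 := setIntegral_prod_mul (μ := (volume : Measure ℝ)) (ν := (volume : Measure ℝ))
      (fun r : ℝ => r ^ (q + 1) * Real.exp (-r ^ (2 : ℝ))) (fun θ : ℝ => |Real.cos θ| ^ q)
      (Set.Ioi 0) (Set.Ioo (-Real.pi) Real.pi)
    rw [integral_rpow_mul_exp_neg_rpow two_pos (by linarith),
      ← integral_Ioc_eq_integral_Ioo, ← intervalIntegral.integral_of_le
        (by linarith [Real.pi_pos]), show q + 1 + 1 = q + 2 by ring] at h6
    rw [← h6]
    refine setIntegral_congr_fun (measurableSet_Ioi.prod measurableSet_Ioo) fun z hz => ?_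
    have hz1 : 0 < z.1 := hz.1
    simp only [polarCoord_symm_apply, smul_eq_mul]
    rw [mul_assoc, ← Real.exp_add, abs_mul, abs_of_pos hz1,
      Real.mul_rpow hz1.le (abs_nonneg _), Real.rpow_add_one hz1.ne', Real.rpow_ofNat,
      show -(z.1 * Real.cos z.2) ^ 2 + -(z.1 * Real.sin z.2) ^ 2 = -z.1 ^ 2 by
        linear_combination -z.1 ^ 2 * Real.sin_sq_add_cos_sq z.2]
    ring
  rw [h5, h2] at h1
  have hG : 0 < Real.Gamma ((q + 2) / 2) := Real.Gamma_pos_of_pos (by linarith)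
  have hs : 0 < Real.sqrt Real.pi := Real.sqrt_pos.2 Real.pi_pos
  have hss : Real.sqrt Real.pi ^ 2 = Real.pi := Real.sq_sqrt Real.pi_pos.le
  have h7 : (∫ θ in (-Real.pi)..Real.pi, |Real.cos θ| ^ q) =
      2 * (Real.Gamma ((q + 1) / 2) * Real.sqrt Real.pi) / Real.Gamma ((q + 2) / 2) := by
    rw [eq_div_iff hG.ne']; linarith
  rw [cosMean, h7]
  field_simp
  rw [hss]

lemma cosMean_nonneg (q : ℝ) : 0 ≤ cosMean q :=
  mul_nonneg (by positivity) (intervalIntegral.integral_nonneg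
    (by linarith [Real.pi_pos]) fun θ _ => by positivity)

/-! ### Convergence of rescaled energies for smooth profiles -/

/-- The real part of the modulated profile, i.e. the rescaled two-bubble flow. -/
def realProfile (s : ℝ) (g : ℝ → ℂ) (ε T X : ℝ) : ℂ :=
  ((2 * (Complex.exp (Complex.I * (X / ε + -(2 * T / ε ^ 2) : ℝ)) * profile s g ε T X).re : ℝ) : ℂ)

lemma enorm_ofReal_two_mul_re_le (a : ℝ) (z : ℂ) :
    ‖((2 * (Complex.exp (Complex.I * a) * z).re : ℝ) : ℂ)‖ₑ ≤ 2 * ‖z‖ₑ := by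
  rw [← ofReal_norm, ← ofReal_norm, show (2 : ℝ≥0∞) = ENNReal.ofReal 2 by simp,
    ← ENNReal.ofReal_mul (by norm_num), Complex.norm_real, norm_mul, Real.norm_of_nonneg zero_le_two]
  refine ENNReal.ofReal_le_ofReal (mul_le_mul_of_nonneg_left
    ((Complex.abs_re_le_norm _).trans ?_) zero_le_two)
  rw [norm_mul, mul_comm Complex.I, Complex.norm_exp_ofReal_mul_I, one_mul]

lemma tendsto_eLpNorm_of_sub {Q : ℝ≥0∞} (hQ : 1 ≤ Q) {l : Filter ℝ} {a b : ℝ → ℝ → ℂ}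
    (ha : ∀ ε, AEStronglyMeasurable (a ε) volume) (hb : ∀ ε, AEStronglyMeasurable (b ε) volume)
    {L : ℝ≥0∞} (h1 : Tendsto (fun ε => eLpNorm (b ε) Q volume) l (𝓝 L))
    (h2 : Tendsto (fun ε => eLpNorm (a ε - b ε) Q volume) l (𝓝 0)) :
    Tendsto (fun ε => eLpNorm (a ε) Q volume) l (𝓝 L) := by
  have hup : Tendsto (fun ε => eLpNorm (b ε) Q volume + eLpNorm (a ε - b ε) Q volume) l
      (𝓝 (L + 0)) := h1.add h2
  have hlow : Tendsto (fun ε => eLpNorm (b ε) Q volume - eLpNorm (a ε - b ε) Q volume) l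
      (𝓝 (L - 0)) := ENNReal.Tendsto.sub h1 h2 (Or.inr ENNReal.zero_ne_top)
  rw [add_zero] at hup
  rw [tsub_zero] at hlow
  have hle1 : ∀ ε, eLpNorm (b ε) Q volume - eLpNorm (a ε - b ε) Q volume ≤
      eLpNorm (a ε) Q volume := by
    intro ε
    rw [tsub_le_iff_right]
    have := eLpNorm_sub_le (ha ε) ((ha ε).sub (hb ε)) hQ
    rwa [sub_sub_cancel] at this
  have hle2 : ∀ ε, eLpNorm (a ε) Q volume ≤
      eLpNorm (b ε) Q volume + eLpNorm (a ε - b ε) Q volume := by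
    intro ε
    have := eLpNorm_add_le (hb ε) ((ha ε).sub (hb ε)) hQ
    rwa [add_sub_cancel] at this
  exact tendsto_of_tendsto_of_tendsto_of_le_of_le hlow hup hle1 hle2

/-- The reverse triangle inequality in L^q. The comparison functions may vary with ε, as they keep
the oscillating carrier; only their norms converge. -/
lemma tendsto_rpow_of_sub {q : ℝ} (hq : 1 ≤ q) {l : Filter ℝ} {a b : ℝ → ℝ → ℂ}
    (ha : ∀ ε, Measurable (a ε)) (hb : ∀ ε, Measurable (b ε)) {L : ℝ≥0∞}
    (hbL : Tendsto (fun ε => ∫⁻ X, ‖b ε X‖ₑ ^ q) l (𝓝 L))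
    (hab : Tendsto (fun ε => ∫⁻ X, ‖a ε X - b ε X‖ₑ ^ q) l (𝓝 0)) :
    Tendsto (fun ε => ∫⁻ X, ‖a ε X‖ₑ ^ q) l (𝓝 L) := by
  have hq0 : 0 < q := by linarith
  have hQ : 1 ≤ ENNReal.ofReal q := by rwa [ENNReal.one_le_ofReal]
  have cont : ∀ y : ℝ, Continuous fun z : ℝ≥0∞ => z ^ y := fun y => ENNReal.continuous_rpow_const
  have h1 : Tendsto (fun ε => eLpNorm (b ε) (ENNReal.ofReal q) volume) l (𝓝 (L ^ (1 / q))) := by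
    simp only [eLpNorm_ofReal_eq hq0]
    exact ((cont _).tendsto _).comp hbL
  have h2 : Tendsto (fun ε => eLpNorm (a ε - b ε) (ENNReal.ofReal q) volume) l (𝓝 0) := by
    have := ((cont (1 / q)).tendsto _).comp hab
    rw [ENNReal.zero_rpow_of_pos (by positivity)] at this
    simp only [eLpNorm_ofReal_eq hq0, Pi.sub_apply]
    exact this
  have h3 := tendsto_eLpNorm_of_sub hQ (fun ε => (ha ε).aestronglyMeasurable)
    (fun ε => (hb ε).aestronglyMeasurable) h1 h2
  simp only [eLpNorm_ofReal_eq hq0] at h3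
  have h4 : Tendsto (fun ε => ((∫⁻ X, ‖a ε X‖ₑ ^ q) ^ (1 / q)) ^ q) l (𝓝 ((L ^ (1 / q)) ^ q)) :=
    ((cont q).tendsto _).comp h3
  simpa only [← ENNReal.rpow_mul, one_div_mul_cancel hq0.ne', ENNReal.rpow_one] using h4

lemma IsBump.measurable_profile {g : ℝ → ℂ} {R : ℝ} (hg : IsBump g R) (s ε T : ℝ) :
    Measurable (profile s g ε T) :=
  (hg.measurable_uncurry_profile s ε).of_uncurry_left

lemma IsBump.lintegral_profile_zero_ne_top {g : ℝ → ℂ} {R : ℝ} (hg : IsBump g R) {s : ℝ}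
    (hs0 : 0 ≤ s) (hs1 : s ≤ 1) {q : ℝ} (hq : 2 < q) (T : ℝ) :
    ∫⁻ X, ‖profile s g 0 T X‖ₑ ^ q ≠ ∞ := by
  have hR : (0 : ℝ) ≤ 1 / (2 * R) := by have := hg.pos; positivity
  have i1 := hg.integrable_profileSymbol_mul hs0 hs1 le_rfl hR T
  have i2 := hg.memLp_profileSymbol_mul hs0 hs1 le_rfl hR T
  have h1 := lintegral_invFT_rpow_le hq.le i1 i2 (enorm_invFT_le _ i1)
  refine ne_top_of_le_ne_top (ENNReal.mul_ne_top ?_ ?_) h1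
  · exact ENNReal.rpow_ne_top_of_nonneg (by linarith) i1.2.ne
  · rw [← eLpNorm_two_sq]
    exact ENNReal.pow_ne_top i2.2.ne

/-- Freeze the profile at ε = 0 but keep the carrier. The error is controlled by the L^q convergence
of profiles, and the frozen family by averaging, where −2T/ε² is a phase independent of X. -/
lemma IsBump.tendsto_lintegral_realProfile {g : ℝ → ℂ} {R : ℝ} (hg : IsBump g R) {s : ℝ}
    (hs0 : 0 ≤ s) (hs1 : s ≤ 1) {q : ℝ} (hq : 2 < q) (T : ℝ) :
    Tendsto (fun ε => ∫⁻ X, ‖realProfile s g ε T X‖ₑ ^ q) (𝓝[>] 0)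
      (𝓝 (2 ^ q * (ENNReal.ofReal (cosMean q) * ∫⁻ X, ‖profile s g 0 T X‖ₑ ^ q))) := by
  have hq0 : 0 < q := by linarith
  have hfin := hg.lintegral_profile_zero_ne_top hs0 hs1 hq T
  have h2q : (2 : ℝ≥0∞) ^ q ≠ ∞ := ENNReal.rpow_ne_top_of_nonneg hq0.le (by norm_num)
  have hexp : ∀ ε : ℝ, Measurable fun X : ℝ =>
      Complex.exp (Complex.I * (X / ε + -(2 * T / ε ^ 2) : ℝ)) := fun ε => by fun_prop
  have hmeas : ∀ ε δ : ℝ, Measurable fun X : ℝ => ((2 * (Complex.exp (Complex.I *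
      (X / ε + -(2 * T / ε ^ 2) : ℝ)) * profile s g δ T X).re : ℝ) : ℂ) := fun ε δ =>
    Complex.measurable_ofReal.comp ((Complex.measurable_re.comp
      ((hexp ε).mul (hg.measurable_profile s δ T))).const_mul 2)
  refine tendsto_rpow_of_sub (by linarith) (fun ε => hmeas ε ε) (fun ε => hmeas ε 0) ?_
    ?_
  · have h1 := ENNReal.Tendsto.const_mul (a := 2 ^ q) (tendsto_lintegral_re hq0
      (hg.measurable_profile s 0 T) hfin fun ε => -(2 * T / ε ^ 2)) (Or.inr h2q)
    refine h1.congr fun ε => ?_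
    rw [← lintegral_const_mul' _ _ h2q]
    refine lintegral_congr fun X => ?_
    rw [← ENNReal.mul_rpow_of_nonneg _ _ hq0.le]
    congr 1
    rw [← ofReal_norm (((_ : ℝ) : ℂ)), Complex.norm_real, ofReal_norm, enorm_mul]
    congr 1
    rw [← ofReal_norm]
    simp
  · have h1 := ENNReal.Tendsto.const_mul (a := 2 ^ q) (hg.tendsto_profile hs0 hs1 hq T)
      (Or.inr h2q)
    rw [mul_zero] at h1
    refine tendsto_of_tendsto_of_tendsto_of_le_of_le tendsto_const_nhds h1 (fun _ => bot_le)
      fun ε => ?_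
    simp only
    rw [← lintegral_const_mul' _ _ h2q]
    refine lintegral_mono fun X => ?_
    rw [← ENNReal.mul_rpow_of_nonneg _ _ hq0.le]
    refine ENNReal.rpow_le_rpow (le_trans (le_of_eq ?_) (enorm_ofReal_two_mul_re_le
      (X / ε + -(2 * T / ε ^ 2)) (profile s g ε T X - profile s g 0 T X))) hq0.le
    congr 1
    rw [← Complex.ofReal_sub, mul_sub, Complex.sub_re]
    congr 1; ring

/-- Convergence of the rescaled energies for smooth profiles. -/
lemma IsBump.tendsto_mixedEnergy_realProfile {p q : ℝ} (hp : 4 < p) (hpq : 2 / p + 1 / q = 1 / 2)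
    {g : ℝ → ℂ} {R : ℝ} (hg : IsBump g R) :
    Tendsto (fun ε => mixedEnergy p q (realProfile (1 / p) g ε)) (𝓝[>] 0)
      (𝓝 ((2 ^ q * ENNReal.ofReal (cosMean q)) ^ (p / q) *
        mixedEnergy p q (profile (1 / p) g 0))) := by
  have hq := two_lt_of_admissible hp hpq
  have hq0 : 0 < q := by linarith
  have hr : 0 ≤ p / q := by positivity
  have hs0 : 0 ≤ 1 / p := by positivity
  have hs1 : 1 / p ≤ 1 := by rw [div_le_one (by linarith)]; linarith
  have h2q : (2 : ℝ≥0∞) ^ q ≠ ∞ := ENNReal.rpow_ne_top_of_nonneg hq0.le (by norm_num)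
  obtain ⟨B, hB, hBb⟩ := hg.exists_time_majorant hp hpq
  have e1 : (2 ^ q * ENNReal.ofReal (cosMean q)) ^ (p / q) * mixedEnergy p q (profile (1 / p) g 0) =
      ∫⁻ T, (2 ^ q * (ENNReal.ofReal (cosMean q) *
        ∫⁻ X, ‖profile (1 / p) g 0 T X‖ₑ ^ q)) ^ (p / q) := by
    rw [mixedEnergy, ← lintegral_const_mul' _ _ (ENNReal.rpow_ne_top_of_nonneg hr
      (ENNReal.mul_ne_top h2q ENNReal.ofReal_ne_top))]
    refine lintegral_congr fun T => ?_
    rw [← ENNReal.mul_rpow_of_nonneg _ _ hr, mul_assoc]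
  rw [e1]
  have hm : ∀ ε, Measurable (Function.uncurry (realProfile (1 / p) g ε)) := by
    intro ε
    have h1 : Measurable fun z : ℝ × ℝ =>
        Complex.exp (Complex.I * (z.2 / ε + -(2 * z.1 / ε ^ 2) : ℝ)) := by fun_prop
    exact Complex.measurable_ofReal.comp ((Complex.measurable_re.comp
      (h1.mul (hg.measurable_uncurry_profile (1 / p) ε))).const_mul 2)
  refine tendsto_lintegral_filter_of_dominated_convergence (fun T => 2 ^ p * B T)
    (Eventually.of_forall fun ε => measurable_mixedEnergy_integrand (hm ε)) ?_ ?_ ?_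
  · have h1 : ∀ᶠ ε : ℝ in 𝓝[>] 0, ε ≤ 1 :=
      mem_nhdsWithin_of_mem_nhds (Iic_mem_nhds zero_lt_one)
    filter_upwards [eventually_small hg.pos, h1] with ε ⟨h2, h3⟩ h4
    refine Eventually.of_forall fun T => ?_
    have h5 : ∫⁻ X, ‖realProfile (1 / p) g ε T X‖ₑ ^ q ≤
        2 ^ q * ∫⁻ X, ‖profile (1 / p) g ε T X‖ₑ ^ q := by
      rw [← lintegral_const_mul' _ _ h2q]
      refine lintegral_mono fun X => ?_
      rw [← ENNReal.mul_rpow_of_nonneg _ _ hq0.le]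
      exact ENNReal.rpow_le_rpow (enorm_ofReal_two_mul_re_le _ _) hq0.le
    refine (ENNReal.rpow_le_rpow h5 hr).trans ?_
    rw [ENNReal.mul_rpow_of_nonneg _ _ hr, ← ENNReal.rpow_mul, mul_div_cancel₀ _ hq0.ne']
    exact mul_le_mul_right (hBb ε h2 h3 h4 T) _
  · have h2p : (2 : ℝ≥0∞) ^ p ≠ ∞ := ENNReal.rpow_ne_top_of_nonneg (by linarith) (by norm_num)
    rw [lintegral_const_mul' _ _ h2p]
    exact ENNReal.mul_ne_top h2p hB
  · exact Eventually.of_forall fun T => ((ENNReal.continuous_rpow_const (y := p / q)).tendsto _).comp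
      (hg.tendsto_lintegral_realProfile hs0 hs1 hq T)

/-! ### Passage to general L² data -/

lemma tendsto_of_approx {l : Filter ℝ} {a : ℝ → ℝ≥0∞} {A : ℝ≥0∞} (hA : A ≠ ∞)
    (h : ∀ δ : ℝ≥0∞, δ ≠ 0 → ∃ (b : ℝ → ℝ≥0∞) (B : ℝ≥0∞), Tendsto b l (𝓝 B) ∧
      (∀ᶠ ε in l, a ε ≤ b ε + δ) ∧ (∀ᶠ ε in l, b ε ≤ a ε + δ) ∧ A ≤ B + δ ∧ B ≤ A + δ) :
    Tendsto a l (𝓝 A) := by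
  rw [ENNReal.tendsto_nhds hA]
  intro η hη
  -- Three errors of size δ occur in each direction; the minimum with 1 keeps δ finite.
  set δ := min η 1 / 4 with hδ
  have hm0 : min η 1 ≠ 0 := (lt_min hη one_pos).ne'
  have hmt : min η 1 ≠ ∞ := ne_top_of_le_ne_top ENNReal.one_ne_top (min_le_right _ _)
  have hδ0 : δ ≠ 0 := by simp [hδ, hm0]
  have hδt : δ ≠ ∞ := ENNReal.div_ne_top hmt (by norm_num)
  have h4 : δ + δ + δ + δ ≤ η := by
    calc δ + δ + δ + δ = 4 * (min η 1 / 4) := by rw [hδ]; ring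
      _ = min η 1 := ENNReal.mul_div_cancel (by norm_num) (by norm_num)
      _ ≤ η := min_le_left _ _
  obtain ⟨b, B, hb, h1, h2, h3, h5⟩ := h δ hδ0
  have hB : B ≠ ∞ := ne_top_of_le_ne_top (ENNReal.add_ne_top.2 ⟨hA, hδt⟩) h5
  filter_upwards [h1, h2, (ENNReal.tendsto_nhds hB).1 hb δ (pos_iff_ne_zero.2 hδ0)] with
    ε g1 g2 ⟨g3, g4⟩
  constructor
  · rw [tsub_le_iff_right] at g3 ⊢
    calc A ≤ B + δ := h3
      _ ≤ (b ε + δ) + δ := by gcongr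
      _ ≤ ((a ε + δ) + δ) + δ := by gcongr
      _ ≤ a ε + (δ + δ + δ + δ) := by
        rw [show a ε + δ + δ + δ = a ε + (δ + δ + δ) by ring]
        gcongr
        exact le_self_add
      _ ≤ a ε + η := by gcongr
  · calc a ε ≤ b ε + δ := g1
      _ ≤ (B + δ) + δ := by gcongr
      _ ≤ ((A + δ) + δ) + δ := by gcongr
      _ ≤ A + (δ + δ + δ + δ) := by
        rw [show A + δ + δ + δ = A + (δ + δ + δ) by ring]
        gcongr
        exact le_self_add
      _ ≤ A + η := by gcongr

lemma eLpNorm_bubble_conj {f : ℝ → ℂ} {ε : ℝ} (hε : 0 < ε) :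
    eLpNorm (fun ξ => conj (f (-((ξ + 1) / ε)))) 2 =
      ENNReal.ofReal ε ^ (1 / 2 : ℝ) * eLpNorm f 2 := by
  have h0 : eLpNorm (fun ξ => conj (f (-((ξ + 1) / ε)))) 2 =
      eLpNorm (fun ξ => f (-((ξ + 1) / ε))) 2 :=
    eLpNorm_congr_norm_ae (Eventually.of_forall fun ξ => by simp)
  have h1 : eLpNorm (fun ξ => f (-((ξ + 1) / ε))) 2 = eLpNorm (fun ξ => f ((ξ - 1) / ε)) 2 := by
    have h2 : eLpNorm (fun ξ => f (-((ξ + 1) / ε))) 2 ^ 2 =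
        eLpNorm (fun ξ => f ((ξ - 1) / ε)) 2 ^ 2 := by
      rw [eLpNorm_two_sq, eLpNorm_two_sq, ← lintegral_neg_eq_self]
      refine lintegral_congr fun ξ => ?_
      rw [show -((-ξ + 1) / ε) = (ξ - 1) / ε by ring]
    exact (ENNReal.pow_right_strictMono two_ne_zero).injective h2
  rw [h0, h1, eLpNorm_comp_sub_div 1 hε]

lemma memLp_bubble_conj {f : ℝ → ℂ} (hf : MemLp f 2) {ε : ℝ} (hε : 0 < ε) :
    MemLp (fun ξ => conj (f (-((ξ + 1) / ε)))) 2 := by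
  refine (memLp_affine hf (neg_ne_zero.2 (inv_ne_zero hε.ne')) (-(1 / ε))).star.ae_eq
    (Eventually.of_forall fun ξ => ?_)
  simp only [Pi.star_apply, starRingEnd_apply]
  congr 2; ring

lemma memLp_twoBubble {f : ℝ → ℂ} (hf : MemLp f 2) {ε : ℝ} (hε : 0 < ε) :
    MemLp (twoBubble f ε) 2 :=
  (memLp_comp_sub_div hf hε).add (memLp_bubble_conj hf hε)

/-- The constant 2 is not sharp, but it holds for every ε and every datum, which is what the density
argument needs for the error f − g. -/
lemma eLpNorm_twoBubble_le {f : ℝ → ℂ} (hf : MemLp f 2) {ε : ℝ} (hε : 0 < ε) :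
    eLpNorm (twoBubble f ε) 2 ≤ ENNReal.ofReal ε ^ (1 / 2 : ℝ) * (2 * eLpNorm f 2) := by
  refine (eLpNorm_add_le (memLp_comp_sub_div hf hε).1 (memLp_bubble_conj hf hε).1
    (by norm_num)).trans (le_of_eq ?_)
  rw [eLpNorm_comp_sub_div 1 hε, eLpNorm_bubble_conj hε]
  ring

lemma twoBubble_sub (f g : ℝ → ℂ) (ε : ℝ) :
    twoBubble (f - g) ε = twoBubble f ε - twoBubble g ε := by
  ext ξ
  simp only [twoBubble, Pi.sub_apply, map_sub]
  ring

/-- For small ε the two bubbles have disjoint supports, so their squared norms add and the constant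
is √2. -/
lemma IsBump.eLpNorm_twoBubble {g : ℝ → ℂ} {R : ℝ} (hg : IsBump g R) {ε : ℝ} (hε0 : 0 < ε)
    (hε : ε ≤ 1 / (2 * R)) :
    eLpNorm (twoBubble g ε) 2 =
      ENNReal.ofReal ε ^ (1 / 2 : ℝ) * (2 ^ (1 / 2 : ℝ) * eLpNorm g 2) := by
  have hpt : ∀ ξ, ‖twoBubble g ε ξ‖ₑ ^ 2 =
      ‖g ((ξ - 1) / ε)‖ₑ ^ 2 + ‖conj (g (-((ξ + 1) / ε)))‖ₑ ^ 2 := by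
    intro ξ
    by_cases h1 : g ((ξ - 1) / ε) = 0
    · simp [twoBubble, h1]
    · have h2 : g (-((ξ + 1) / ε)) = 0 := by
        by_contra h2
        have h3 := abs_lt.1 (hg.abs_mul_lt hε0.le hε h1)
        have h4 := abs_lt.1 (hg.abs_mul_lt hε0.le hε h2)
        rw [mul_neg, mul_div_cancel₀ _ hε0.ne'] at h4
        rw [mul_div_cancel₀ _ hε0.ne'] at h3
        linarith [h3.1, h4.2]
      simp [twoBubble, h2]
  have hm : Measurable fun ξ => ‖g ((ξ - 1) / ε)‖ₑ ^ 2 :=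
    ((hg.contDiff.continuous.comp (by fun_prop : Continuous fun ξ : ℝ =>
      (ξ - 1) / ε)).measurable.enorm).pow_const 2
  have h1 : eLpNorm (twoBubble g ε) 2 ^ 2 =
      (ENNReal.ofReal ε ^ (1 / 2 : ℝ) * (2 ^ (1 / 2 : ℝ) * eLpNorm g 2)) ^ 2 := by
    rw [eLpNorm_two_sq, lintegral_congr hpt, lintegral_add_left hm, ← eLpNorm_two_sq,
      ← eLpNorm_two_sq, eLpNorm_comp_sub_div 1 hε0, eLpNorm_bubble_conj hε0, ← two_mul]
    have h2 : ((2 : ℝ≥0∞) ^ (1 / 2 : ℝ)) ^ 2 = 2 := by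
      rw [← ENNReal.rpow_natCast, ← ENNReal.rpow_mul]; norm_num
    rw [mul_pow, mul_pow, mul_pow, h2]
    ring
  exact (ENNReal.pow_right_strictMono two_ne_zero).injective h1

lemma rpow_half_cancel {ε : ℝ} (hε : 0 < ε) (z : ℝ≥0∞) :
    ENNReal.ofReal ε ^ (-(1 / 2) : ℝ) * (ENNReal.ofReal ε ^ (1 / 2 : ℝ) * z) = z := by
  have he0 : ENNReal.ofReal ε ≠ 0 := by simpa using hε
  rw [← mul_assoc, ← ENNReal.rpow_add _ _ he0 ENNReal.ofReal_ne_top]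
  norm_num

/-- Asymptotic norm of the two-bubble data. -/
lemma tendsto_eLpNorm_twoBubble {f : ℝ → ℂ} (hf : MemLp f 2) :
    Tendsto (fun ε => ENNReal.ofReal ε ^ (-(1 / 2) : ℝ) * eLpNorm (twoBubble f ε) 2) (𝓝[>] 0)
      (𝓝 (2 ^ (1 / 2 : ℝ) * eLpNorm f 2)) := by
  have hc : (2 : ℝ≥0∞) ^ (1 / 2 : ℝ) ≤ 2 := by
    conv_rhs => rw [← ENNReal.rpow_one 2]
    exact ENNReal.rpow_le_rpow_of_exponent_le (by norm_num) (by norm_num)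
  refine tendsto_of_approx (ENNReal.mul_ne_top (ne_top_of_le_ne_top (by norm_num) hc)
    hf.eLpNorm_ne_top) fun δ hδ => ?_
  obtain ⟨g, ⟨R, hg⟩, hgδ⟩ := exists_isBump_eLpNorm_sub_le hf (δ := δ / 2) (by simp [hδ])
  have hδ2 : 2 * (δ / 2) = δ := ENNReal.mul_div_cancel (by norm_num) (by norm_num)
  have hgδ2 : 2 * eLpNorm (f - g) 2 ≤ δ := by
    rw [← hδ2]; exact mul_le_mul_right hgδ _
  have hgδ3 : 2 ^ (1 / 2 : ℝ) * eLpNorm (f - g) 2 ≤ δ := (mul_le_mul_left hc _).trans hgδ2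
  have hdiff : ∀ ε : ℝ, 0 < ε →
      ENNReal.ofReal ε ^ (-(1 / 2) : ℝ) * eLpNorm (twoBubble (f - g) ε) 2 ≤ δ := by
    intro ε hε
    refine (mul_le_mul_right (eLpNorm_twoBubble_le (hf.sub hg.memLp) hε) _).trans ?_
    rwa [rpow_half_cancel hε]
  refine ⟨fun ε => ENNReal.ofReal ε ^ (-(1 / 2) : ℝ) * eLpNorm (twoBubble g ε) 2,
    2 ^ (1 / 2 : ℝ) * eLpNorm g 2, ?_, ?_, ?_, ?_, ?_⟩
  · refine tendsto_const_nhds.congr' ?_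
    filter_upwards [eventually_small hg.pos] with ε ⟨h1, h2⟩
    rw [hg.eLpNorm_twoBubble h1 h2, rpow_half_cancel h1]
  · filter_upwards [self_mem_nhdsWithin] with ε hε
    refine le_trans ?_ (add_le_add_right (hdiff ε hε) _)
    rw [← mul_add]
    refine mul_le_mul_right ?_ _
    have := eLpNorm_add_le (memLp_twoBubble hg.memLp hε).1
      (memLp_twoBubble (hf.sub hg.memLp) hε).1 (p := 2) (by norm_num)
    rwa [twoBubble_sub, add_sub_cancel, ← twoBubble_sub] at this
  · filter_upwards [self_mem_nhdsWithin] with ε hε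
    refine le_trans ?_ (add_le_add_right (hdiff ε hε) _)
    rw [← mul_add]
    refine mul_le_mul_right ?_ _
    have := eLpNorm_sub_le (memLp_twoBubble hf hε).1
      (memLp_twoBubble (hf.sub hg.memLp) hε).1 (p := 2) (by norm_num)
    rwa [twoBubble_sub, sub_sub_cancel, ← twoBubble_sub] at this
  · refine le_trans ?_ (add_le_add_right hgδ3 _)
    rw [← mul_add]
    refine mul_le_mul_right ?_ _
    have := eLpNorm_add_le hg.memLp.1 (hf.sub hg.memLp).1 (p := 2) (by norm_num)
    rwa [add_sub_cancel] at this
  · refine le_trans ?_ (add_le_add_right hgδ3 _)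
    rw [← mul_add]
    refine mul_le_mul_right ?_ _
    have := eLpNorm_sub_le hf.1 (hf.sub hg.memLp).1 (p := 2) (by norm_num)
    rwa [sub_sub_cancel] at this

/-- Flows depend continuously on their data, in the mixed norm. -/
lemma mixedEnergy_rpow_le_add_of_flow {p q : ℝ} (hp : 1 ≤ p) (hq : 1 ≤ q) {σ : ℝ → ℝ → ℂ}
    (hσ : IsSymbol σ) {C : ℝ≥0∞} (hC : ∀ f : ℝ → ℂ, MemLp f 2 →
      ∀ F, IsFlow σ f F → mixedEnergy p q F ≤ C * eLpNorm f 2 ^ p)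
    {f g : ℝ → ℂ} (hf : MemLp f 2) (hg : MemLp g 2) {F G : ℝ → ℝ → ℂ} (hF : IsFlow σ f F)
    (hG : IsFlow σ g G) :
    mixedEnergy p q F ^ (1 / p) ≤ mixedEnergy p q G ^ (1 / p) +
      C ^ (1 / p) * eLpNorm (f - g) 2 := by
  have hp0 : 0 < p := by linarith
  have hD := hF.sub hσ hf hg hG
  have h1 := hC _ (hf.sub hg) _ hD
  have h2 : mixedEnergy p q (fun t x => F t x - G t x) ^ (1 / p) ≤
      C ^ (1 / p) * eLpNorm (f - g) 2 := by
    have h3 := ENNReal.rpow_le_rpow h1 (z := 1 / p) (by positivity)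
    rwa [ENNReal.mul_rpow_of_nonneg _ _ (by positivity), ← ENNReal.rpow_mul,
      mul_one_div_cancel hp0.ne', ENNReal.rpow_one] at h3
  refine (mixedEnergy_rpow_le_add hp hq hG.1 hD.1 fun t x => ?_).trans (add_le_add_right h2 _)
  have := norm_add_le (G t x) (F t x - G t x)
  rwa [add_sub_cancel] at this

lemma IsBump.isAnnular_neg {g : ℝ → ℂ} {R : ℝ} (hg : IsBump g R) {ε : ℝ} (hε0 : 0 < ε)
    (hε : ε ≤ 1 / (2 * R)) : IsAnnular fun ξ => conj (g (-((ξ + 1) / ε))) := by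
  refine ⟨(Complex.continuous_conj.comp (hg.contDiff.continuous.comp
    (by fun_prop : Continuous fun ξ : ℝ => -((ξ + 1) / ε)))).measurable,
    memLp_bubble_conj hg.memLp hε0, 1 / 2, 3 / 2, by norm_num, by norm_num, fun ξ h => ?_⟩
  have h0 : g (-((ξ + 1) / ε)) ≠ 0 := fun h0 => h (by simp [h0])
  have h3 := abs_lt.1 (hg.abs_mul_lt hε0.le hε h0)
  rw [mul_neg, mul_div_cancel₀ _ hε0.ne'] at h3
  rw [abs_of_neg (by linarith [h3.1])]
  constructor <;> linarith [h3.1, h3.2]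

/-- The Airy flow of a smooth two-bubble in rescaled variables. -/
lemma IsBump.isFlow_twoBubble {g : ℝ → ℂ} {R : ℝ} (hg : IsBump g R) (s : ℝ) {ε : ℝ} (hε0 : 0 < ε)
    (hε : ε ≤ 1 / (2 * R)) :
    IsFlow (airySymbol s) (twoBubble g ε)
      fun t x => (ε : ℂ) * realProfile s g ε (ε ^ 2 * t) (ε * x + 3 * ε * t) := by
  have i1 := fun t => ((hg.isAnnular_pos hε0 hε).airySymbol_mul s t).integrable
  have i2 := fun t => ((hg.isAnnular_neg hε0 hε).airySymbol_mul s t).integrable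
  have e : ∀ t ξ, airySymbol s t ξ * twoBubble g ε ξ = airySymbol s t ξ * g ((ξ - 1) / ε) +
      airySymbol s t ξ * conj (g (-((ξ + 1) / ε))) := fun t ξ => mul_add _ _ _
  have h1 := isFlow_invFT (measurable_airySymbol s) (f := twoBubble g ε)
    ((hg.isAnnular_pos hε0 hε).measurable.add (hg.isAnnular_neg hε0 hε).measurable) fun t => by
      simp only [e]; exact (i1 t).add (i2 t)
  convert h1 using 1
  ext t x
  simp only [e]
  rw [invFT_add (i1 t) (i2 t), invFT_airySymbol_bubble_conj, invFT_airySymbol_bubble _ _ hε0,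
    realProfile, Complex.add_conj, Complex.re_ofReal_mul]
  -- The carrier phase x + t, expressed in the rescaled variables, is X/ε − 2T/ε².
  have e2 : (ε * x + 3 * ε * t) / ε + -(2 * (ε ^ 2 * t) / ε ^ 2) = x + t := by
    field_simp; ring
  rw [e2]
  push_cast
  ring

lemma mul_le_mul_add_of_le {w w' a b c d e M δ : ℝ≥0∞} (hw : ∀ z, w * (w' * z) = z)
    (h1 : a ≤ b + c * d) (h2 : d ≤ w' * (2 * e)) (hM : c * 2 ≤ M) (hδ : M * e ≤ δ) :
    w * a ≤ w * b + δ := by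
  calc w * a ≤ w * (b + c * (w' * (2 * e))) := by gcongr; exact h1.trans (by gcongr)
    _ = w * b + c * 2 * e := by rw [mul_add, mul_left_comm c, hw, mul_assoc]
    _ ≤ w * b + M * e := by gcongr
    _ ≤ w * b + δ := by gcongr

/-- The factor ε^{-1/2} exactly compensates the ε^{1/2} in the norm of two-bubble data, so the
Lipschitz constant of the rescaled norm is independent of ε. -/
lemma rescaled_mixedEnergy_le_add {p q : ℝ} (hp : 4 < p) (hq : 2 < q) {C : ℝ≥0∞}
    (hC : ∀ f : ℝ → ℂ, MemLp f 2 →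
      ∀ F, IsFlow (airySymbol (1 / p)) f F → mixedEnergy p q F ≤ C * eLpNorm f 2 ^ p)
    {M δ : ℝ≥0∞} (hM : C ^ (1 / p) * 2 ≤ M) {f g : ℝ → ℂ} (hf : MemLp f 2) (hg : MemLp g 2)
    (hfg : M * eLpNorm (f - g) 2 ≤ δ) {ε : ℝ} (hε : 0 < ε) {F G : ℝ → ℝ → ℂ}
    (hF : IsFlow (airySymbol (1 / p)) (twoBubble f ε) F)
    (hG : IsFlow (airySymbol (1 / p)) (twoBubble g ε) G) :
    ENNReal.ofReal ε ^ (-(1 / 2) : ℝ) * mixedEnergy p q F ^ (1 / p) ≤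
      ENNReal.ofReal ε ^ (-(1 / 2) : ℝ) * mixedEnergy p q G ^ (1 / p) + δ := by
  have hσ : IsSymbol (airySymbol (1 / p)) :=
    isSymbol_airySymbol (by positivity) (by rw [div_le_one (by linarith)]; linarith)
  have h1 := mixedEnergy_rpow_le_add_of_flow (q := q) (by linarith) (by linarith) hσ
    hC (memLp_twoBubble hf hε) (memLp_twoBubble hg hε) hF hG
  rw [← twoBubble_sub] at h1
  exact mul_le_mul_add_of_le (rpow_half_cancel hε) h1 (eLpNorm_twoBubble_le (hf.sub hg) hε) hM hfg

lemma mul_mixedEnergy_schrodinger_le_add {p q : ℝ} (hp : 4 < p) (hq : 2 < q) {D : ℝ≥0∞}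
    (hD : ∀ f : ℝ → ℂ, MemLp f 2 →
      ∀ F, IsFlow (fun t ξ => Complex.exp (3 * Complex.I * t * ξ ^ 2)) f F →
        mixedEnergy p q F ≤ D * eLpNorm f 2 ^ p)
    {κ M δ : ℝ≥0∞} (hM : κ * D ^ (1 / p) ≤ M) {f g : ℝ → ℂ} (hf : MemLp f 2) (hg : MemLp g 2)
    (hfg : M * eLpNorm (f - g) 2 ≤ δ) {F G : ℝ → ℝ → ℂ}
    (hF : IsFlow (fun t ξ => Complex.exp (3 * Complex.I * t * ξ ^ 2)) f F)
    (hG : IsFlow (fun t ξ => Complex.exp (3 * Complex.I * t * ξ ^ 2)) g G) :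
    κ * mixedEnergy p q F ^ (1 / p) ≤ κ * mixedEnergy p q G ^ (1 / p) + δ := by
  have h1 := mixedEnergy_rpow_le_add_of_flow (q := q) (by linarith) (by linarith)
    isSymbol_schrodinger hD hf hg hF hG
  refine (mul_le_mul_right h1 _).trans ?_
  rw [mul_add, ← mul_assoc κ]
  exact add_le_add_right ((mul_le_mul_left hM _).trans hfg) _

lemma IsBump.isFlow_profile_zero {g : ℝ → ℂ} {R : ℝ} (hg : IsBump g R) (s : ℝ) :
    IsFlow (fun t ξ => Complex.exp (3 * Complex.I * t * ξ ^ 2)) g (profile s g 0) := by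
  have h1 := isFlow_invFT isSymbol_schrodinger.measurable hg.contDiff.continuous.measurable
    fun t => by
      have h2 := hg.integrable_profileSymbol_mul (s := 0) le_rfl zero_le_one le_rfl
        (by have := hg.pos; positivity) t
      refine h2.congr (Eventually.of_forall fun ξ => ?_)
      simp only [profileSymbol, Real.rpow_zero, Complex.ofReal_one, one_mul]
      congr 2
      push_cast; ring
  convert h1 using 1
  ext t x
  rw [profile_zero]

lemma rescaled_mixedEnergy_eq {p q : ℝ} (hp : 4 < p) (hpq : 2 / p + 1 / q = 1 / 2)
    (g : ℝ → ℂ) {ε : ℝ} (hε : 0 < ε) :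
    ENNReal.ofReal ε ^ (-(1 / 2) : ℝ) * mixedEnergy p q (fun t x =>
      (ε : ℂ) * realProfile (1 / p) g ε (ε ^ 2 * t) (ε * x + 3 * ε * t)) ^ (1 / p) =
      mixedEnergy p q (realProfile (1 / p) g ε) ^ (1 / p) := by
  have hq := two_lt_of_admissible hp hpq
  have hp0 : 0 < p := by linarith
  rw [mixedEnergy_scale hp0 (by linarith) hpq hε, ENNReal.mul_rpow_of_nonneg _ _ (by positivity),
    ← ENNReal.rpow_mul, show p / 2 * (1 / p) = 1 / 2 by field_simp, rpow_half_cancel hε]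

/-- Asymptotic mixed norm of the Airy flows of two-bubble data. -/
lemma tendsto_mixedEnergy_twoBubble {p q : ℝ} (hp : 4 < p) (hpq : 2 / p + 1 / q = 1 / 2)
    {f : ℝ → ℂ} (hf : MemLp f 2) {v : ℝ → ℝ → ℂ}
    (hv : IsFlow (fun t ξ => Complex.exp (3 * Complex.I * t * ξ ^ 2)) f v) {Ψ : ℝ → ℝ → ℝ → ℂ}
    (hΨ : ∀ ε, 0 < ε → IsFlow (airySymbol (1 / p)) (twoBubble f ε) (Ψ ε)) :
    Tendsto (fun ε => ENNReal.ofReal ε ^ (-(1 / 2) : ℝ) * mixedEnergy p q (Ψ ε) ^ (1 / p)) (𝓝[>] 0)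
      (𝓝 (((2 ^ q * ENNReal.ofReal (cosMean q)) ^ (p / q)) ^ (1 / p) *
        mixedEnergy p q v ^ (1 / p))) := by
  have hq := two_lt_of_admissible hp hpq
  have hp0 : 0 < p := by linarith
  have hp1 : 0 ≤ 1 / p := by positivity
  have hr : 0 ≤ p / q := by positivity
  obtain ⟨C, hC, hCA⟩ := exists_strichartz_airy hp hpq
  obtain ⟨D, hD, hDS⟩ := exists_strichartz_schrodinger hp hpq
  set κ : ℝ≥0∞ := ((2 ^ q * ENNReal.ofReal (cosMean q)) ^ (p / q)) ^ (1 / p) with hκ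
  have hκt : κ ≠ ∞ := ENNReal.rpow_ne_top_of_nonneg hp1 (ENNReal.rpow_ne_top_of_nonneg hr
    (ENNReal.mul_ne_top (ENNReal.rpow_ne_top_of_nonneg (by linarith) (by norm_num))
      ENNReal.ofReal_ne_top))
  have hvt : mixedEnergy p q v ≠ ∞ := ne_top_of_le_ne_top (ENNReal.mul_ne_top hD
    (ENNReal.rpow_ne_top_of_nonneg hp0.le hf.eLpNorm_ne_top)) ((hDS f hf).2 v hv)
  -- `M` dominates the Lipschitz constants of both the rescaled Airy norm and the limiting
  -- Schrödinger norm, so one approximant g serves both.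
  set M : ℝ≥0∞ := C ^ (1 / p) * 2 + κ * D ^ (1 / p) + 1 with hM
  have hCt : C ^ (1 / p) ≠ ∞ := ENNReal.rpow_ne_top_of_nonneg hp1 hC
  have hDt : D ^ (1 / p) ≠ ∞ := ENNReal.rpow_ne_top_of_nonneg hp1 hD
  have hMt : M ≠ ∞ := ENNReal.add_ne_top.2 ⟨ENNReal.add_ne_top.2
    ⟨ENNReal.mul_ne_top hCt (by norm_num), ENNReal.mul_ne_top hκt hDt⟩, ENNReal.one_ne_top⟩
  have hM0 : M ≠ 0 := by simp [hM]
  refine tendsto_of_approx (ENNReal.mul_ne_top hκt (ENNReal.rpow_ne_top_of_nonneg hp1 hvt))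
    fun δ hδ => ?_
  obtain ⟨g, ⟨R, hg⟩, hgδ⟩ := exists_isBump_eLpNorm_sub_le hf (δ := δ / M)
    (ENNReal.div_ne_zero.2 ⟨hδ, hMt⟩)
  have hMδ : M * eLpNorm (f - g) 2 ≤ δ :=
    (mul_le_mul_right hgδ _).trans ENNReal.mul_div_le
  have hMδ' : M * eLpNorm (g - f) 2 ≤ δ := by rwa [eLpNorm_sub_comm]
  have hCδ : C ^ (1 / p) * 2 ≤ M := by rw [hM, add_assoc]; exact le_self_add
  have hDδ : κ * D ^ (1 / p) ≤ M := by
    rw [hM, add_comm (C ^ (1 / p) * 2), add_assoc]; exact le_self_add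
  have hA : ∀ f₁ : ℝ → ℂ, MemLp f₁ 2 → ∀ F, IsFlow (airySymbol (1 / p)) f₁ F →
      mixedEnergy p q F ≤ C * eLpNorm f₁ 2 ^ p := fun f₁ h₁ => (hCA f₁ h₁).2
  have hS : ∀ f₁ : ℝ → ℂ, MemLp f₁ 2 →
      ∀ F, IsFlow (fun t ξ => Complex.exp (3 * Complex.I * t * ξ ^ 2)) f₁ F →
        mixedEnergy p q F ≤ D * eLpNorm f₁ 2 ^ p := fun f₁ h₁ => (hDS f₁ h₁).2
  have hg0 := hg.isFlow_profile_zero (1 / p)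
  have hmain := ((ENNReal.continuous_rpow_const (y := 1 / p)).tendsto _).comp
    (hg.tendsto_mixedEnergy_realProfile hp hpq)
  rw [ENNReal.mul_rpow_of_nonneg _ _ hp1] at hmain
  refine ⟨_, _, hmain, ?_, ?_,
    mul_mixedEnergy_schrodinger_le_add hp hq hS hDδ hf hg.memLp hMδ hv hg0,
    mul_mixedEnergy_schrodinger_le_add hp hq hS hDδ hg.memLp hf hMδ' hg0 hv⟩
  · filter_upwards [eventually_small hg.pos] with ε ⟨h1, h2⟩
    simp only [Function.comp_apply]
    rw [← rescaled_mixedEnergy_eq hp hpq g h1]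
    exact rescaled_mixedEnergy_le_add hp hq hA hCδ hf hg.memLp hMδ h1 (hΨ ε h1)
      (hg.isFlow_twoBubble (1 / p) h1 h2)
  · filter_upwards [eventually_small hg.pos] with ε ⟨h1, h2⟩
    simp only [Function.comp_apply]
    rw [← rescaled_mixedEnergy_eq hp hpq g h1]
    exact rescaled_mixedEnergy_le_add hp hq hA hCδ hg.memLp hf hMδ' h1
      (hg.isFlow_twoBubble (1 / p) h1 h2) (hΨ ε h1)

/-! ### The constant and the limit of the quotient -/

/-- The numerator carries 2^p times the p/q-th power of the mean of |cos|^q, while the √2 in the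
limiting norm removes 2^{p/2}. The powers of π and the Gamma quotient come from that mean. -/
lemma aConst_eq {p q : ℝ} (hp : 4 < p) (hpq : 2 / p + 1 / q = 1 / 2) :
    ENNReal.ofReal (aConst p q) * (2 ^ (1 / 2 : ℝ)) ^ p =
      (2 ^ q * ENNReal.ofReal (cosMean q)) ^ (p / q) := by
  have hq := two_lt_of_admissible hp hpq
  have hr : 0 ≤ p / q := by positivity
  have hG1 : 0 < Real.Gamma ((q + 1) / 2) := Real.Gamma_pos_of_pos (by linarith)
  have hG2 : 0 < Real.Gamma ((q + 2) / 2) := Real.Gamma_pos_of_pos (by linarith)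
  have hpi := Real.pi_pos
  have h1 : cosMean q ^ (p / q) = (Real.Gamma ((q + 1) / 2) / Real.Gamma ((q + 2) / 2)) ^ (p / q) /
      Real.pi ^ (p / (2 * q)) := by
    rw [cosMean_eq (by linarith), mul_comm (Real.sqrt _), ← div_div,
      Real.div_rpow (div_pos hG1 hG2).le (Real.sqrt_nonneg _), Real.sqrt_eq_rpow, ← Real.rpow_mul hpi.le]
    congr 2
    field_simp
  have h2 : aConst p q * 2 ^ (p / 2) = 2 ^ p * cosMean q ^ (p / q) := by
    rw [aConst, h1]
    have h3 : (2 : ℝ) ^ p = 2 ^ (p / 2) * 2 ^ (p / 2) := by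
      rw [← Real.rpow_add two_pos]; congr 1; ring
    rw [h3]; ring
  have h4 : ∀ y : ℝ, 0 ≤ y → (2 : ℝ≥0∞) ^ y = ENNReal.ofReal (2 ^ y) := fun y hy => by
    rw [← ENNReal.ofReal_rpow_of_nonneg zero_le_two hy]; simp
  rw [← ENNReal.rpow_mul, show 1 / 2 * p = p / 2 by ring, ENNReal.mul_rpow_of_nonneg _ _ hr,
    ← ENNReal.rpow_mul, mul_div_cancel₀ _ (by linarith : q ≠ 0), h4 _ (by linarith),
    h4 _ (by linarith), ENNReal.ofReal_rpow_of_nonneg (cosMean_nonneg q) hr,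
    ← ENNReal.ofReal_mul' (Real.rpow_nonneg zero_le_two _),
    ← ENNReal.ofReal_mul (Real.rpow_nonneg zero_le_two _), h2]

lemma IsTwoBubble.hat_ae_eq {χ w : L2} {ε : ℝ} (h : IsTwoBubble χ ε w) :
    hat w =ᵐ[volume] twoBubble (hat χ) ε := h

lemma tendsto_rescaled_enorm {χ : L2} {χε : ℝ → L2}
    (hχε : ∀ ε : ℝ, 0 < ε → IsTwoBubble χ ε (χε ε)) :
    Tendsto (fun ε => ENNReal.ofReal ε ^ (-(1 / 2) : ℝ) * ‖χε ε‖ₑ) (𝓝[>] 0)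
      (𝓝 (2 ^ (1 / 2 : ℝ) * ‖χ‖ₑ)) := by
  have h1 := tendsto_eLpNorm_twoBubble (memLp_hat χ)
  rw [eLpNorm_hat] at h1
  refine h1.congr' ?_
  filter_upwards [self_mem_nhdsWithin] with ε hε
  rw [← eLpNorm_hat, eLpNorm_congr_ae (hχε ε hε).hat_ae_eq]

lemma eventually_ne_zero_of_isTwoBubble {χ : L2} (hχ : χ ≠ 0) {χε : ℝ → L2}
    (hχε : ∀ ε : ℝ, 0 < ε → IsTwoBubble χ ε (χε ε)) : ∀ᶠ ε : ℝ in 𝓝[>] 0, χε ε ≠ 0 := by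
  have h0 : (0 : ℝ≥0∞) < 2 ^ (1 / 2 : ℝ) * ‖χ‖ₑ :=
    ENNReal.mul_pos (by simp) (by simpa using hχ)
  filter_upwards [(tendsto_rescaled_enorm hχε).eventually_const_lt h0] with ε hε h
  simp [h] at hε

/-- The common scaling factor cancels in the quotient. -/
lemma rescaled_div_eq {p : ℝ} (hp : 0 < p) {ε : ℝ} (hε : 0 < ε) (E n : ℝ≥0∞) :
    (ENNReal.ofReal ε ^ (-(1 / 2) : ℝ) * E ^ (1 / p)) ^ p /
      (ENNReal.ofReal ε ^ (-(1 / 2) : ℝ) * n) ^ p = E / n ^ p := by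
  have he0 : ENNReal.ofReal ε ≠ 0 := by simpa using hε
  have h1 : (ENNReal.ofReal ε ^ (-(1 / 2) : ℝ)) ^ p ≠ 0 := by
    rw [← ENNReal.rpow_mul]; exact (ENNReal.rpow_pos he0.bot_lt ENNReal.ofReal_ne_top).ne'
  have h2 : (ENNReal.ofReal ε ^ (-(1 / 2) : ℝ)) ^ p ≠ ∞ := by
    rw [← ENNReal.rpow_mul]; exact ENNReal.rpow_ne_top_of_ne_zero he0 ENNReal.ofReal_ne_top
  rw [ENNReal.mul_rpow_of_nonneg _ _ hp.le, ENNReal.mul_rpow_of_nonneg _ _ hp.le,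
    ← ENNReal.rpow_mul E, one_div_mul_cancel hp.ne', ENNReal.rpow_one,
    ENNReal.mul_div_mul_left _ _ h1 h2]

lemma tendsto_quotient {p q : ℝ} (hp : 4 < p) (hpq : 2 / p + 1 / q = 1 / 2) {χ : L2} (hχ : χ ≠ 0)
    {χε : ℝ → L2} (hχε : ∀ ε : ℝ, 0 < ε → IsTwoBubble χ ε (χε ε)) {v : ℝ → ℝ → ℂ}
    (hv : IsSchrodingerFlow χ v) {Ψ : ℝ → ℝ → ℝ → ℂ}
    (hΨ : ∀ ε : ℝ, 0 < ε → IsAiryFlow p (χε ε) (Ψ ε)) :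
    Tendsto (fun ε : ℝ => mixedEnergy p q (Ψ ε) / ‖χε ε‖ₑ ^ p) (𝓝[>] 0)
      (𝓝 (ENNReal.ofReal (aConst p q) * (mixedEnergy p q v / ‖χ‖ₑ ^ p))) := by
  have hp0 : 0 < p := by linarith
  have hnum := tendsto_mixedEnergy_twoBubble hp hpq (memLp_hat χ) hv fun ε hε =>
    IsFlow.congr_ae (isAiryFlow_iff.1 (hΨ ε hε)) (hχε ε hε).hat_ae_eq
  have hden := tendsto_rescaled_enorm hχε
  have hnum' := ((ENNReal.continuous_rpow_const (y := p)).tendsto _).comp hnum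
  have hden' := ((ENNReal.continuous_rpow_const (y := p)).tendsto _).comp hden
  rw [ENNReal.mul_rpow_of_nonneg _ _ hp0.le, ← ENNReal.rpow_mul (_ ^ (p / q)),
    ← ENNReal.rpow_mul (mixedEnergy p q v), one_div_mul_cancel hp0.ne', ENNReal.rpow_one,
    ENNReal.rpow_one, ← aConst_eq hp hpq] at hnum'
  rw [ENNReal.mul_rpow_of_nonneg _ _ hp0.le] at hden'
  have hs0 : ((2 : ℝ≥0∞) ^ (1 / 2 : ℝ)) ^ p ≠ 0 := by
    rw [← ENNReal.rpow_mul]; exact (ENNReal.rpow_pos (by norm_num) (by norm_num)).ne'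
  have hst : ((2 : ℝ≥0∞) ^ (1 / 2 : ℝ)) ^ p ≠ ∞ := by
    rw [← ENNReal.rpow_mul]; exact ENNReal.rpow_ne_top_of_nonneg (by positivity) (by norm_num)
  have hχ0 : ‖χ‖ₑ ^ p ≠ 0 := (ENNReal.rpow_pos (by simpa [pos_iff_ne_zero] using hχ)
    enorm_ne_top).ne'
  have hχt : ‖χ‖ₑ ^ p ≠ ∞ := ENNReal.rpow_ne_top_of_nonneg hp0.le enorm_ne_top
  -- Numerator and denominator converge separately after multiplication by the same power of ε; the
  -- limiting denominator is nonzero and finite because χ ≠ 0.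
  have hq := ENNReal.Tendsto.div hnum' (Or.inr (mul_ne_zero hs0 hχ0)) hden'
    (Or.inl (ENNReal.mul_ne_top hst hχt))
  have e : ENNReal.ofReal (aConst p q) * (2 ^ (1 / 2 : ℝ)) ^ p * mixedEnergy p q v /
      ((2 ^ (1 / 2 : ℝ)) ^ p * ‖χ‖ₑ ^ p) =
      ENNReal.ofReal (aConst p q) * (mixedEnergy p q v / ‖χ‖ₑ ^ p) := by
    rw [mul_comm (ENNReal.ofReal _), mul_assoc, ENNReal.mul_div_mul_left _ _ hs0 hst, mul_div_assoc]
  rw [e] at hq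
  refine hq.congr' ?_
  filter_upwards [self_mem_nhdsWithin] with ε hε
  exact rescaled_div_eq hp0 hε _ _

end AiryStrichartz

end

theorem lemma2p3 (p q : ℝ) (hp : 4 < p) (hpq : 2 / p + 1 / q = 1 / 2)
    (χ : AiryStrichartz.L2) (hχ : χ ≠ 0)
    (χε : ℝ → AiryStrichartz.L2)
    (hχε : ∀ ε : ℝ, 0 < ε → AiryStrichartz.IsTwoBubble χ ε (χε ε)) :
    -- the functions and integrals in the claim exist and are finite, and `χ_ε ≠ 0` for small `ε`
    (∃ v : ℝ → ℝ → ℂ, AiryStrichartz.IsSchrodingerFlow χ v ∧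
      AiryStrichartz.mixedEnergy p q v ≠ ∞) ∧
    (∀ ε : ℝ, 0 < ε → ∃ Ψ : ℝ → ℝ → ℂ, AiryStrichartz.IsAiryFlow p (χε ε) Ψ ∧
      AiryStrichartz.mixedEnergy p q Ψ ≠ ∞) ∧
    (∀ᶠ ε : ℝ in 𝓝[>] 0, χε ε ≠ 0) ∧
    -- the convergence of the quotients
    (∀ (v : ℝ → ℝ → ℂ) (Ψ : ℝ → ℝ → ℝ → ℂ),
      AiryStrichartz.IsSchrodingerFlow χ v →
      (∀ ε : ℝ, 0 < ε → AiryStrichartz.IsAiryFlow p (χε ε) (Ψ ε)) →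
      Tendsto (fun ε : ℝ => AiryStrichartz.mixedEnergy p q (Ψ ε) / ‖χε ε‖ₑ ^ p) (𝓝[>] 0)
        (𝓝 (ENNReal.ofReal (AiryStrichartz.aConst p q) *
          (AiryStrichartz.mixedEnergy p q v / ‖χ‖ₑ ^ p)))) := by
  have hp0 : 0 < p := by linarith
  refine ⟨?_, fun ε hε => ?_, AiryStrichartz.eventually_ne_zero_of_isTwoBubble hχ hχε,
    fun v Ψ hv hΨ => AiryStrichartz.tendsto_quotient hp hpq hχ hχε hv hΨ⟩
  · obtain ⟨C, hC, h⟩ := AiryStrichartz.exists_strichartz_schrodinger hp hpq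
    obtain ⟨⟨v, hv⟩, hb⟩ := h _ (AiryStrichartz.memLp_hat χ)
    exact ⟨v, hv, ne_top_of_le_ne_top (ENNReal.mul_ne_top hC (ENNReal.rpow_ne_top_of_nonneg hp0.le
      (AiryStrichartz.memLp_hat χ).eLpNorm_ne_top)) (hb v hv)⟩
  · obtain ⟨C, hC, h⟩ := AiryStrichartz.exists_strichartz_airy hp hpq
    obtain ⟨⟨Ψ, hΨ⟩, hb⟩ := h _ (AiryStrichartz.memLp_hat (χε ε))
    exact ⟨Ψ, hΨ, ne_top_of_le_ne_top (ENNReal.mul_ne_top hC (ENNReal.rpow_ne_top_of_nonneg hp0.le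
      (AiryStrichartz.memLp_hat (χε ε)).eLpNorm_ne_top)) (hb Ψ hΨ)⟩
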